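/- Let $k$ be an algebraically closed field of characteristic $0$, let $\mathcal C$ be a finite semisimple $k$-linear abelian category, and let a finite group $G$ act on $\mathcal C$ by $k$-linear autoequivalences $\rho^g$, with coherence isomorphisms $\rho_2^{g,h}:\rho^g\rho^h\to\rho^{gh}$ and $\rho_0:\mathrm{id}\to\rho^e$. For a subgroup $H\le G$, let $\mathcal C^H$ be the category of $H$-equivariant objects $(N,\nu)$, $\nu^h:\rho^hN\xrightarrow{\sim}N$. For a simple object $Y$ of $\mathcal C$ put $G_Y=\{g\in G:\rho^g Y\simeq Y\}$, and let $\mathcal R$ be any set of representatives of the left cosets of $G_Y$ in $G$. The relative induction functor $L_Y:\mathcal C^{G_Y}\to\mathcal C^G$ is $L_Y(N,\nu)=(\bigoplus_{t\in\mathcal R}\rho^t N,\mu)$, where $\mu^g$ has components $\rho^s(\nu^h)(\rho_2^{s,h})^{-1}\rho_2^{g,t}:\rho^g\rho^tN\to\rho^sN$ for $gt=sh$ with $s\in\mathcal R$, $h\in G_Y$. Given isomorphisms $c^g:\rho^g Y\to Y$ $(g\in G_Y)$, define $\tilde\alpha_Y:G_Y\times G_Y\to k^*$ by $\tilde\alpha_Y(g,h)^{-1}\mathrm{id}_Y=c^g\rho^g(c^h)(\rho_2^{g,h})_Y^{-1}(c^{gh})^{-1}$.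 A projective representation of $G_Y$ with factor set $\tilde\alpha_Y$ is a finite dimensional space $V$ with maps $\pi(g)\in GL(V)$ such that $\pi(g)\pi(h)=\tilde\alpha_Y(g,h)\pi(gh)$; two such, with the same $\tilde\alpha_Y$, are isomorphic if a linear isomorphism commutes with all the $\pi(g)$. For $(N,\nu)\in\mathcal C^{G_Y}$, the space $\mathrm{Hom}_{\mathcal C}(Y,N)$ is such a representation via $\pi(g)f=\nu^g\rho^g(f)(c^g)^{-1}$, and for $(X,\mu)\in\mathcal C^G$ so is $\mathrm{Hom}_{\mathcal C}(Y,X)$. For $\pi$ on $V$, let $\pi\otimes Y=(V\otimes Y,(\pi(g)\otimes c^g)_g)\in\mathcal C^{G_Y}$ and $S_{Y,\pi}=L_Y(\pi\otimes Y)$. **(1)** For every simple $Y$, the functor $L_Y$ induces a bijection from the isomorphism classes of simple $(N,\nu)\in\mathcal C^{G_Y}$ with $\mathrm{Hom}_{\mathcal C}(Y,N)\ne0$ to the isomorphism classes of simple $(X,\mu)\in\mathcal C^{G}$ with $\mathrm{Hom}_{\mathcal C}(Y,X)\ne0$. If $(X,\mu)\simeq L_Y(N,\nu)$ under this bijection,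 then $\mathrm{Hom}_{\mathcal C}(Y,N)\simeq\mathrm{Hom}_{\mathcal C}(Y,X)$ as projective representations of $G_Y$ (for every choice of $c$), and $N\simeq\mathrm{Hom}_{\mathcal C}(Y,N)\otimes Y$. **(2)** Choose a simple object $Y$ in each $G$-orbit on the set $\mathrm{Irr}(\mathcal C)$ of isomorphism classes of simple objects and, for each of them, isomorphisms $c$ and representatives $\mathcal R$. Then $(Y,\pi)\mapsto S_{Y,\pi}$ induces a bijection from the set of pairs $(Y,\pi)$, with $Y$ an orbit and $\pi$ an isomorphism class of irreducible projective representations of $G_Y$ with factor set $\tilde\alpha_Y$, to the set of isomorphism classes of simple objects of $\mathcal C^G$. **(3)** If $Y$ is simple, $\pi$ is irreducible and $(X,\mu)\simeq S_{Y,\pi}$, then $X\simeq\bigoplus_{t\in\mathcal R}\rho^t(V\otimes Y)$ and $\pi\simeq\mathrm{Hom}_{\mathcal C}(Y,X)$. Consequently $d(X)=\dim\pi\,[G:G_Y]\,d(Y)$ for every isomorphism-invariant, additive, $G$-invariant function $d$ from objects of $\mathcal C$ to $\mathbb R$. If moreover $\mathcal C$ is a fusion category and $G$ acts by tensor autoequivalences,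 so that $\mathcal C^G$ is monoidal, then $$\mathrm{FPdim}_{\mathcal C^G}S_{Y,\pi}=\dim\pi\cdot[G:G_Y]\cdot\mathrm{FPdim}_{\mathcal C}Y,$$ where $\mathrm{FPdim}\,Z$ is the largest real eigenvalue of the matrix of left multiplication by $Z$ on the Grothendieck ring, in the basis of simple objects. -/

import Mathlib

open CategoryTheory CategoryTheory.Limits
namespace EquivClifford

universe w v u x v' u'

noncomputable section

/-! ### Isomorphism classes and simple objects -/

/-- Isomorphism classes of objects. -/
abbrev IsoClass (C : Type u) [Category.{v} C] : Type u := _root_.Quotient (isIsomorphicSetoid C)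

/-- The isomorphism class of an object. -/
abbrev isoClass {C : Type u} [Category.{v} C] (X : C) : IsoClass C :=
  _root_.Quotient.mk (isIsomorphicSetoid C) X

/-- The map induced by a functor on isomorphism classes of objects. -/
def mapIsoClass {C : Type u} [Category.{v} C] {D : Type u'} [Category.{v'} D] (F : C ⥤ D) :
    IsoClass C → IsoClass D :=
  _root_.Quotient.map F.obj fun _ _ ⟨e⟩ => ⟨F.mapIso e⟩

/-- `Irr C`: the set of isomorphism classes of simple objects. -/
def Irr (C : Type u) [Category.{v} C] [HasZeroMorphisms C] : Type u :=
  {x : IsoClass C // ∃ X : C, Simple X ∧ isoClass X = x}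

/-- The element of `Irr C` given by a simple object. -/
def Irr.mk {C : Type u} [Category.{v} C] [HasZeroMorphisms C] (X : C) [hX : Simple X] : Irr C :=
  ⟨isoClass X, X, hX, rfl⟩

/-- A (chosen) object in the given class. -/
def Irr.rep {C : Type u} [Category.{v} C] [HasZeroMorphisms C] (i : Irr C) : C :=
  i.property.choose

theorem Irr.ext_iff_iso {C : Type u} [Category.{v} C] [HasZeroMorphisms C] (X Y : C)
    [Simple X] [Simple Y] : Irr.mk X = Irr.mk Y ↔ Nonempty (X ≅ Y) := by
  unfold Irr.mk
  refine Subtype.ext_iff.trans ?_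
  exact _root_.Quotient.eq (r := isIsomorphicSetoid C)

attribute [instance] Abelian.hasFiniteBiproducts

/-- A `k`-linear abelian category is finite semisimple if its Hom spaces are finite dimensional,
every object is a finite direct sum of simple objects, and there are finitely many simple objects
up to isomorphism. -/
class IsFiniteSemisimple (k : Type w) [Field k] (C : Type u) [Category.{v} C] [Abelian C]
    [Linear k C] : Prop where
  finite_hom : ∀ X Y : C, FiniteDimensional k (X ⟶ Y)
  semisimple : ∀ X : C, ∃ (n : ℕ) (S : Fin n → C), (∀ i, Simple (S i)) ∧ Nonempty (X ≅ ⨁ S)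
  finite_irr : Finite (Irr C)

attribute [instance] IsFiniteSemisimple.finite_hom

/-! ### Group actions on linear categories -/

/-- An action of `G` on the `k`-linear category `C` by `k`-linear autoequivalences, i.e. a monoidal
functor from the discrete monoidal category of `G` to the category of `k`-linear autoequivalences
of `C`.

The coherence isomorphism `ρ^g ρ^h ≅ ρ^(g h)` is written as `comp g h l e : ρ^g ρ^h ≅ ρ^l`, where
`e : g * h = l`. (This is the same data, since `l` is determined by `e`.) That every `ρ^g` is an
equivalence is a consequence, since `ρ^g ρ^(g⁻¹) ≅ ρ^1 ≅ id`. -/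
structure GAction (k : Type w) [Field k] (G : Type x) [Group G] (C : Type u) [Category.{v} C]
    [Preadditive C] [Linear k C] where
  fn : G → C ⥤ C
  [additive : ∀ g, (fn g).Additive]
  [linear : ∀ g, (fn g).Linear k]
  comp (g h l : G) (e : g * h = l) : fn h ⋙ fn g ≅ fn l
  unit : 𝟭 C ≅ fn 1
  assoc (a b c ab bc abc : G) (hab : a * b = ab) (hbc : b * c = bc) (h₁ : ab * c = abc)
    (h₂ : a * bc = abc) (X : C) :
    (comp a b ab hab).hom.app ((fn c).obj X) ≫ (comp ab c abc h₁).hom.app X =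
      (fn a).map ((comp b c bc hbc).hom.app X) ≫ (comp a bc abc h₂).hom.app X
  unit_left (a : G) (X : C) :
    unit.hom.app ((fn a).obj X) ≫ (comp 1 a a (one_mul a)).hom.app X = 𝟙 _
  unit_right (a : G) (X : C) :
    (fn a).map (unit.hom.app X) ≫ (comp a 1 a (mul_one a)).hom.app X = 𝟙 _

attribute [instance] GAction.additive GAction.linear

section Action

variable {k : Type w} [Field k] {G : Type x} [Group G] {C : Type u} [Category.{v} C]
  [Preadditive C] [Linear k C]

namespace GAction

/-- The restriction of an action to a subgroup. -/
abbrev restrict (ρ : GAction k G C) (H : Subgroup G) : GAction k H C where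
  fn g := ρ.fn g
  comp g h l e := ρ.comp g h l (congrArg Subtype.val e)
  unit := ρ.unit
  assoc _ _ _ _ _ _ _ _ _ _ X := ρ.assoc _ _ _ _ _ _ _ _ _ _ X
  unit_left _ X := ρ.unit_left _ X
  unit_right _ X := ρ.unit_right _ X

/-- `ρ^g` is an equivalence with quasi-inverse `ρ^(g⁻¹)`. -/
theorem isEquivalence (ρ : GAction k G C) (g : G) : (ρ.fn g).IsEquivalence :=
  (CategoryTheory.Equivalence.mk (ρ.fn g) (ρ.fn g⁻¹)
    (ρ.unit ≪≫ (ρ.comp g⁻¹ g 1 (inv_mul_cancel g)).symm)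
    (ρ.comp g g⁻¹ 1 (mul_inv_cancel g) ≪≫ ρ.unit.symm)).isEquivalence_functor

/-- The inertia subgroup `G_Y = {g | ρ^g Y ≅ Y}`. -/
def inertia (ρ : GAction k G C) (Y : C) : Subgroup G where
  carrier := {g | Nonempty ((ρ.fn g).obj Y ≅ Y)}
  one_mem' := ⟨(ρ.unit.app Y).symm⟩
  mul_mem' := by
    rintro a b ⟨ea⟩ ⟨eb⟩
    exact ⟨((ρ.comp a b (a * b) rfl).app Y).symm ≪≫ (ρ.fn a).mapIso eb ≪≫ ea⟩
  inv_mem' := by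
    rintro a ⟨ea⟩
    exact ⟨(ρ.fn a⁻¹).mapIso ea.symm ≪≫ (ρ.comp a⁻¹ a 1 (inv_mul_cancel a)).app Y ≪≫
      (ρ.unit.app Y).symm⟩

theorem simple_fn_obj (ρ : GAction k G C) (g : G) (X : C) [Simple X] :
    Simple ((ρ.fn g).obj X) := by
  have := ρ.isEquivalence g
  exact simple_obj (ρ.fn g) X

/-- The action of `G` on `Irr C`. -/
@[reducible]
def irrAction (ρ : GAction k G C) : MulAction G (Irr C) where
  smul g i := ⟨mapIsoClass (ρ.fn g) i.1, by
    obtain ⟨_, X, hX, rfl⟩ := i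
    exact ⟨(ρ.fn g).obj X, ρ.simple_fn_obj g X, rfl⟩⟩
  one_smul := by
    rintro ⟨_, X, hX, rfl⟩
    exact Subtype.ext (_root_.Quotient.sound ⟨(ρ.unit.app X).symm⟩)
  mul_smul := by
    rintro a b ⟨_, X, hX, rfl⟩
    exact Subtype.ext (_root_.Quotient.sound ⟨((ρ.comp a b _ rfl).app X).symm⟩)

/-- The set `Irr(C)/G` of orbits. -/
def Orbits (ρ : GAction k G C) : Type u :=
  letI := ρ.irrAction
  MulAction.orbitRel.Quotient G (Irr C)

/-- The orbit of (the class of) a simple object. -/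
def orbit (ρ : GAction k G C) (Y : C) [Simple Y] : ρ.Orbits :=
  letI := ρ.irrAction
  _root_.Quotient.mk (MulAction.orbitRel G (Irr C)) (Irr.mk Y)

end GAction

/-! ### Equivariant objects -/

/-- `G`-equivariant objects `(X, μ)`, `μ^g : ρ^g X ≅ X`. -/
structure EqObj (ρ : GAction k G C) where
  obj : C
  act (g : G) : (ρ.fn g).obj obj ⟶ obj
  isIso_act (g : G) : IsIso (act g)
  act_mul (g h : G) : (ρ.fn g).map (act h) ≫ act g = (ρ.comp g h _ rfl).hom.app obj ≫ act (g * h)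
  act_one : ρ.unit.hom.app obj ≫ act 1 = 𝟙 obj

namespace EqObj

/-- The equivariance relations force the structure maps to be isomorphisms. -/
theorem isIso_of_laws (ρ : GAction k G C) (X : C) (act : ∀ g : G, (ρ.fn g).obj X ⟶ X)
    (act_mul : ∀ g h : G,
      (ρ.fn g).map (act h) ≫ act g = (ρ.comp g h _ rfl).hom.app X ≫ act (g * h))
    (act_one : ρ.unit.hom.app X ≫ act 1 = 𝟙 X) (g : G) : IsIso (act g) := by
  have h1 : IsIso (act 1) := by
    have : act 1 = inv (ρ.unit.hom.app X) := by
      rw [← cancel_epi (ρ.unit.hom.app X), act_one]; exact (IsIso.hom_inv_id (ρ.unit.hom.app X)).symm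
    rw [this]; infer_instance
  have key : ∀ a b l : G, a * b = 1 → l = 1 → IsIso ((ρ.fn a).map (act b) ≫ act a) := by
    intro a b l hab hl
    rw [act_mul]
    have : IsIso (act (a * b)) := by rw [hab]; exact h1
    infer_instance
  have hse : ∀ a : G, IsSplitEpi (act a) := by
    intro a
    have := key a a⁻¹ 1 (mul_inv_cancel a) rfl
    exact ⟨⟨inv ((ρ.fn a).map (act a⁻¹) ≫ act a) ≫ (ρ.fn a).map (act a⁻¹), by
      rw [Category.assoc, IsIso.inv_hom_id]⟩⟩
  have := key g g⁻¹ 1 (mul_inv_cancel g) rfl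
  have := hse g⁻¹
  have : IsSplitMono ((ρ.fn g).map (act g⁻¹)) :=
    ⟨⟨act g ≫ inv ((ρ.fn g).map (act g⁻¹) ≫ act g), by
      rw [← Category.assoc, IsIso.hom_inv_id]⟩⟩
  have : IsIso ((ρ.fn g).map (act g⁻¹)) := isIso_of_epi_of_isSplitMono _
  exact IsIso.of_isIso_comp_left ((ρ.fn g).map (act g⁻¹)) (act g)

/-- Morphisms of equivariant objects: the morphisms `f : X ⟶ X'` commuting with the structures. -/
def homSubmodule {ρ : GAction k G C} (M N : EqObj ρ) : Submodule k (M.obj ⟶ N.obj) where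
  carrier := {f | ∀ g, M.act g ≫ f = (ρ.fn g).map f ≫ N.act g}
  add_mem' := by
    intro a b ha hb g
    rw [Preadditive.comp_add, ha g, hb g, Functor.map_add, Preadditive.add_comp]
  zero_mem' := by intro g; simp
  smul_mem' := by
    intro c f hf g
    rw [Linear.comp_smul, hf g, Functor.map_smul, Linear.smul_comp]

/-- The equivariantization `C^G`. -/
instance category (ρ : GAction k G C) : Category (EqObj ρ) where
  Hom M N := homSubmodule M N
  id M := ⟨𝟙 M.obj, fun g => by simp⟩
  comp f f' := ⟨f.1 ≫ f'.1, fun g => by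
    rw [← Category.assoc, f.2 g, Category.assoc, f'.2 g, Functor.map_comp, Category.assoc]⟩
  id_comp f := Subtype.ext (Category.id_comp f.1)
  comp_id f := Subtype.ext (Category.comp_id f.1)
  assoc f f' f'' := Subtype.ext (Category.assoc f.1 f'.1 f''.1)

variable {ρ : GAction k G C}

instance preadditive : Preadditive (EqObj ρ) where
  homGroup M N := inferInstanceAs (AddCommGroup (homSubmodule M N))
  add_comp _ _ _ f f' g := Subtype.ext (Preadditive.add_comp _ _ _ f.1 f'.1 g.1)
  comp_add _ _ _ f g g' := Subtype.ext (Preadditive.comp_add _ _ _ f.1 g.1 g'.1)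

instance linear : Linear k (EqObj ρ) where
  homModule M N := inferInstanceAs (Module k (homSubmodule M N))
  smul_comp _ _ _ r f g := Subtype.ext (Linear.smul_comp _ _ _ r f.1 g.1)
  comp_smul _ _ _ f r g := Subtype.ext (Linear.comp_smul _ _ _ f.1 r g.1)

/-- Constructor for isomorphisms of equivariant objects. -/
def mkIso {M N : EqObj ρ} (e : M.obj ≅ N.obj)
    (he : ∀ g, M.act g ≫ e.hom = (ρ.fn g).map e.hom ≫ N.act g) : M ≅ N where
  hom := ⟨e.hom, he⟩
  inv := ⟨e.inv, fun g => by
    rw [← cancel_mono e.hom, Category.assoc, Category.assoc, he g, Iso.inv_hom_id,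
      Category.comp_id, ← Category.assoc, ← Functor.map_comp, Iso.inv_hom_id, CategoryTheory.Functor.map_id,
      Category.id_comp]⟩
  hom_inv_id := Subtype.ext e.hom_inv_id
  inv_hom_id := Subtype.ext e.inv_hom_id

variable (ρ) in
/-- The forgetful functor `C^G ⥤ C`. -/
def forget : EqObj ρ ⥤ C where
  obj M := M.obj
  map f := f.1

instance : (forget ρ).Faithful where
  map_injective h := Subtype.ext h

variable (ρ) in
/-- The forgetful functor `C^G ⥤ C^H` for a subgroup `H` of `G`. -/
def restrict (H : Subgroup G) : EqObj ρ ⥤ EqObj (ρ.restrict H) where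
  obj M :=
    { obj := M.obj
      act := fun g => M.act g
      isIso_act := fun g => M.isIso_act g
      act_mul := fun g h => M.act_mul g h
      act_one := M.act_one }
  map f := ⟨f.1, fun g => f.2 g⟩

end EqObj

/-! ### Relative induction -/

section Sums

variable {C' : Type u'} [Category.{v'} C'] [Preadditive C'] {J : Type x} [Finite J]
  (F : C ⥤ C') [F.Additive] (f : J → C) [HasBiproduct f]

/-- The morphism out of `F (⨁ f)`, for an additive functor `F`, with components `m`. -/
def mapDesc {Z : C'} (m : ∀ j, F.obj (f j) ⟶ Z) : F.obj (⨁ f) ⟶ Z :=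
  letI := Fintype.ofFinite J
  ∑ j, F.map (biproduct.π f j) ≫ m j

theorem map_ι_mapDesc {Z : C'} (m : ∀ j, F.obj (f j) ⟶ Z) (j : J) :
    F.map (biproduct.ι f j) ≫ mapDesc F f m = m j := by
  classical
  let := Fintype.ofFinite J
  rw [mapDesc, Preadditive.comp_sum, Finset.sum_eq_single j]
  · rw [← Category.assoc, ← Functor.map_comp, biproduct.ι_π_self, CategoryTheory.Functor.map_id,
      Category.id_comp]
  · intro i _ hi
    rw [← Category.assoc, ← Functor.map_comp, biproduct.ι_π_ne f (Ne.symm hi), Functor.map_zero,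
      zero_comp]
  · intro h
    exact absurd (Finset.mem_univ j) h

theorem map_ι_mapDesc_assoc {Z T : C'} (m : ∀ j, F.obj (f j) ⟶ Z) (j : J) (t : Z ⟶ T) :
    F.map (biproduct.ι f j) ≫ mapDesc F f m ≫ t = m j ≫ t := by
  rw [← Category.assoc, map_ι_mapDesc]

theorem map_sum_hom_ext {Z : C'} {a b : F.obj (⨁ f) ⟶ Z}
    (h : ∀ j, F.map (biproduct.ι f j) ≫ a = F.map (biproduct.ι f j) ≫ b) : a = b := by
  classical
  let := Fintype.ofFinite J
  have total : ∑ j, biproduct.π f j ≫ biproduct.ι f j = 𝟙 (⨁ f) := by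
    apply biproduct.hom_ext'
    intro j
    rw [Preadditive.comp_sum, Finset.sum_eq_single j]
    · simp
    · intro i _ hi
      rw [← Category.assoc, biproduct.ι_π_ne f (Ne.symm hi), zero_comp]
    · intro h
      exact absurd (Finset.mem_univ j) h
  rw [← Category.id_comp a, ← Category.id_comp b, ← CategoryTheory.Functor.map_id,
    ← total, Functor.map_sum, Preadditive.sum_comp, Preadditive.sum_comp]
  refine Finset.sum_congr rfl fun j _ => ?_
  rw [Functor.map_comp, Category.assoc, Category.assoc, h j]

end Sums

/-- A set of representatives of the left cosets of `H` in `G`. -/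
structure Transversal {G : Type x} [Group G] (H : Subgroup G) where
  rep : G ⧸ H → G
  rep_spec (q : G ⧸ H) : (rep q : G ⧸ H) = q

namespace Transversal

variable {H : Subgroup G} (r : Transversal H)

/-- The element `h` of `H` with `g t = s h`, where `t`, `s` are the representatives of the cosets
`q` and `g q`. -/
def cocyc (g : G) (q : G ⧸ H) : H :=
  ⟨(r.rep (g • q))⁻¹ * (g * r.rep q), by
    rw [← QuotientGroup.eq, r.rep_spec]
    conv_lhs => rw [← r.rep_spec q]
    rfl⟩

theorem rep_mul_cocyc (g : G) (q : G ⧸ H) : r.rep (g • q) * r.cocyc g q = g * r.rep q :=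
  mul_inv_cancel_left _ _

end Transversal

section Induction

variable (ρ : GAction k G C) {H : Subgroup G}

/-- For `g t = s h` and `ν : ρ^h X ⟶ X`, the morphism
`ρ^s(ν) (ρ₂^{s,h})⁻¹ ρ₂^{g,t} : ρ^g ρ^t X ⟶ ρ^s X`. -/
def indComp {X : C} (g t s h : G) (e : s * h = g * t) (ν : (ρ.fn h).obj X ⟶ X) :
    (ρ.fn g).obj ((ρ.fn t).obj X) ⟶ (ρ.fn s).obj X :=
  (ρ.comp g t (g * t) rfl).hom.app X ≫ (ρ.comp s h (g * t) e).inv.app X ≫ (ρ.fn s).map ν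

theorem indComp_mul {X : C} (a b t s s' h h' l : G) (ν : (ρ.fn h).obj X ⟶ X)
    (ν' : (ρ.fn h').obj X ⟶ X) (ν'' : (ρ.fn l).obj X ⟶ X) (el : h' * h = l)
    (hν : (ρ.fn h').map ν ≫ ν' = (ρ.comp h' h l el).hom.app X ≫ ν'')
    (e : s * h = b * t) (e' : s' * h' = a * s) (e'' : s' * l = (a * b) * t) :
    (ρ.fn a).map (indComp ρ b t s h e ν) ≫ indComp ρ a s s' h' e' ν' =
      (ρ.comp a b (a * b) rfl).hom.app ((ρ.fn t).obj X) ≫ indComp ρ (a * b) t s' l e'' ν'' := by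
  have eabt : a * b * t = a * (b * t) := mul_assoc a b t
  have eash : a * s * h = a * b * t := by rw [mul_assoc, e, mul_assoc]
  have n1 : (ρ.fn a).map ((ρ.fn s).map ν) ≫ (ρ.comp a s (a * s) rfl).hom.app X =
      (ρ.comp a s (a * s) rfl).hom.app ((ρ.fn h).obj X) ≫ (ρ.fn (a * s)).map ν :=
    (ρ.comp a s (a * s) rfl).hom.naturality ν
  have n2 : (ρ.fn (a * s)).map ν ≫ (ρ.comp s' h' (a * s) e').inv.app X =
      (ρ.comp s' h' (a * s) e').inv.app ((ρ.fn h).obj X) ≫ (ρ.fn s').map ((ρ.fn h').map ν) :=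
    (ρ.comp s' h' (a * s) e').inv.naturality ν
  have a1 := ρ.assoc a b t (a * b) (b * t) (a * b * t) rfl rfl rfl eabt.symm X
  have a2 := ρ.assoc a s h (a * s) (b * t) (a * b * t) rfl e eash eabt.symm X
  have a3 := ρ.assoc s' h' h (a * s) l (a * b * t) e' el eash e'' X
  have a2' : (ρ.fn a).map ((ρ.comp s h (b * t) e).inv.app X) ≫
      (ρ.comp a s (a * s) rfl).hom.app ((ρ.fn h).obj X) =
      (ρ.comp a (b * t) (a * b * t) eabt.symm).hom.app X ≫
        (ρ.comp (a * s) h (a * b * t) eash).inv.app X := by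
    rw [← cancel_mono ((ρ.comp (a * s) h (a * b * t) eash).hom.app X), Category.assoc, a2,
      ← Category.assoc, ← Functor.map_comp, Iso.inv_hom_id_app, CategoryTheory.Functor.map_id,
      Category.id_comp, Category.assoc, Iso.inv_hom_id_app]
    exact (Category.comp_id _).symm
  have a3' : (ρ.comp (a * s) h (a * b * t) eash).inv.app X ≫
      (ρ.comp s' h' (a * s) e').inv.app ((ρ.fn h).obj X) ≫
        (ρ.fn s').map ((ρ.comp h' h l el).hom.app X) =
      (ρ.comp s' l (a * b * t) e'').inv.app X := by
    rw [← cancel_mono ((ρ.comp s' l (a * b * t) e'').hom.app X),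
      Category.assoc, Category.assoc, ← a3, Iso.inv_hom_id_app_assoc, Iso.inv_hom_id_app,
      Iso.inv_hom_id_app]
  unfold indComp
  simp only [Functor.map_comp, Category.assoc]
  rw [reassoc_of% n1, reassoc_of% n2, ← Functor.map_comp, hν, Functor.map_comp,
    reassoc_of% a2', reassoc_of% a3', ← reassoc_of% a1]

theorem indComp_one {X : C} (t : G) (e : t * 1 = 1 * t) (ν : (ρ.fn 1).obj X ⟶ X)
    (hν : ρ.unit.hom.app X ≫ ν = 𝟙 X) :
    ρ.unit.hom.app ((ρ.fn t).obj X) ≫ indComp ρ 1 t t 1 e ν = 𝟙 _ := by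
  have key : ∀ (l : G) (h₁ : 1 * t = l) (h₂ : t * 1 = l),
      ρ.unit.hom.app ((ρ.fn t).obj X) ≫ (ρ.comp 1 t l h₁).hom.app X ≫
        (ρ.comp t 1 l h₂).inv.app X = (ρ.fn t).map (ρ.unit.hom.app X) := by
    intro l h₁ h₂
    obtain rfl : t = l := (one_mul t).symm.trans h₁
    rw [← cancel_mono ((ρ.comp t 1 t h₂).hom.app X), Category.assoc, Category.assoc,
      Iso.inv_hom_id_app, ρ.unit_right]
    exact (congrArg _ (Category.comp_id _)).trans (ρ.unit_left t X)
  unfold indComp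
  have := key _ rfl e
  rw [← Category.assoc, ← Category.assoc, Category.assoc (ρ.unit.hom.app _)]
  refine (congrArg (· ≫ (ρ.fn t).map ν) this).trans ?_
  refine ((ρ.fn t).map_comp _ _).symm.trans ?_
  rw [hν]
  exact (ρ.fn t).map_id X

theorem indComp_naturality {X X' : C} (f : X ⟶ X') (g t s h : G) (e : s * h = g * t)
    (ν : (ρ.fn h).obj X ⟶ X) (ν' : (ρ.fn h).obj X' ⟶ X') (hf : ν ≫ f = (ρ.fn h).map f ≫ ν') :
    (ρ.fn g).map ((ρ.fn t).map f) ≫ indComp ρ g t s h e ν' =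
      indComp ρ g t s h e ν ≫ (ρ.fn s).map f := by
  have n1 : (ρ.fn g).map ((ρ.fn t).map f) ≫ (ρ.comp g t (g * t) rfl).hom.app X' =
      (ρ.comp g t (g * t) rfl).hom.app X ≫ (ρ.fn (g * t)).map f :=
    (ρ.comp g t (g * t) rfl).hom.naturality f
  have n2 : (ρ.fn (g * t)).map f ≫ (ρ.comp s h (g * t) e).inv.app X' =
      (ρ.comp s h (g * t) e).inv.app X ≫ (ρ.fn s).map ((ρ.fn h).map f) :=
    (ρ.comp s h (g * t) e).inv.naturality f
  unfold indComp
  rw [reassoc_of% n1, reassoc_of% n2, Category.assoc, Category.assoc, ← Functor.map_comp,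
    ← Functor.map_comp, hf]

variable [HasFiniteBiproducts C] [Finite G] (r : Transversal H)

/-- The structure map `μ^g` of the induced object, given componentwise by `indComp`. -/
def indAct (N : EqObj (ρ.restrict H)) (g : G) :
    (ρ.fn g).obj (⨁ fun q : G ⧸ H => (ρ.fn (r.rep q)).obj N.obj) ⟶
      ⨁ fun q : G ⧸ H => (ρ.fn (r.rep q)).obj N.obj :=
  mapDesc (ρ.fn g) _ fun q =>
    indComp ρ g (r.rep q) (r.rep (g • q)) (r.cocyc g q) (r.rep_mul_cocyc g q)
      (N.act (r.cocyc g q)) ≫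
      biproduct.ι (fun q : G ⧸ H => (ρ.fn (r.rep q)).obj N.obj) (g • q)

theorem indAct_ι (N : EqObj (ρ.restrict H)) (g : G) (q q' : G ⧸ H) (hq : g • q = q') (h : H)
    (e : r.rep q' * h = g * r.rep q) :
    (ρ.fn g).map (biproduct.ι (fun q : G ⧸ H => (ρ.fn (r.rep q)).obj N.obj) q) ≫ indAct ρ r N g =
      indComp ρ g (r.rep q) (r.rep q') h e (N.act h) ≫
        biproduct.ι (fun q : G ⧸ H => (ρ.fn (r.rep q)).obj N.obj) q' := by
  subst hq
  have : h = r.cocyc g q :=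
    Subtype.ext (mul_left_cancel (e.trans (r.rep_mul_cocyc g q).symm))
  subst this
  exact map_ι_mapDesc _ _ _ q

theorem indAct_mul (N : EqObj (ρ.restrict H)) (a b : G) :
    (ρ.fn a).map (indAct ρ r N b) ≫ indAct ρ r N a =
      (ρ.comp a b _ rfl).hom.app _ ≫ indAct ρ r N (a * b) := by
  apply map_sum_hom_ext (ρ.fn b ⋙ ρ.fn a)
  intro q
  have hb := indAct_ι ρ r N b q (b • q) rfl _ (r.rep_mul_cocyc b q)
  have ha := indAct_ι ρ r N a (b • q) (a • b • q) rfl _ (r.rep_mul_cocyc a (b • q))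
  have e : r.rep (a • b • q) * ((r.cocyc a (b • q) * r.cocyc b q : H) : G) =
      a * b * r.rep q := by
    rw [Subgroup.coe_mul, ← mul_assoc, r.rep_mul_cocyc, mul_assoc, r.rep_mul_cocyc, mul_assoc]
  have hab := indAct_ι ρ r N (a * b) q (a • b • q) (mul_smul a b q) _ e
  have nat := (ρ.comp a b (a * b) rfl).hom.naturality
    (biproduct.ι (fun q : G ⧸ H => (ρ.fn (r.rep q)).obj N.obj) q)
  refine Eq.trans ?_ ((congrArg (· ≫ _) nat).trans (Category.assoc _ _ _)).symm |>.trans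
    (Category.assoc _ _ _)
  rw [hab, Functor.comp_map, ← Category.assoc, ← Functor.map_comp, hb,
    Functor.map_comp, Category.assoc, ha, ← Category.assoc,
    indComp_mul ρ a b _ _ _ _ _ _ _ _ _ rfl
      (N.act_mul (r.cocyc a (b • q)) (r.cocyc b q)) (r.rep_mul_cocyc b q)
      (r.rep_mul_cocyc a (b • q)) e,
    Category.assoc]
  rfl

theorem indAct_one (N : EqObj (ρ.restrict H)) :
    ρ.unit.hom.app _ ≫ indAct ρ r N 1 = 𝟙 _ := by
  apply biproduct.hom_ext'
  intro q
  have e : r.rep q * ((1 : H) : G) = 1 * r.rep q := by simp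
  have h1 := indAct_ι ρ r N 1 q q (one_smul G q) 1 e
  have nat := ρ.unit.hom.naturality
    (biproduct.ι (fun q : G ⧸ H => (ρ.fn (r.rep q)).obj N.obj) q)
  rw [Functor.id_map] at nat
  rw [reassoc_of% nat, h1, ← Category.assoc]
  refine (congrArg (· ≫ _) (indComp_one ρ (r.rep q) e (N.act 1) N.act_one)).trans ?_
  exact (Category.id_comp _).trans (Category.comp_id _).symm

/-- The relative induction functor `L : C^H ⥤ C^G`,
`(N, ν) ↦ (⨁_{t ∈ G/H} ρ^t N, μ)`. -/
def relInd : EqObj (ρ.restrict H) ⥤ EqObj ρ where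
  obj N :=
    { obj := ⨁ fun q : G ⧸ H => (ρ.fn (r.rep q)).obj N.obj
      act := indAct ρ r N
      isIso_act := EqObj.isIso_of_laws ρ _ _ (indAct_mul ρ r N) (indAct_one ρ r N)
      act_mul := indAct_mul ρ r N
      act_one := indAct_one ρ r N }
  map {N N'} f := ⟨biproduct.map fun q => (ρ.fn (r.rep q)).map f.1, by
    intro g
    apply map_sum_hom_ext (ρ.fn g)
    intro q
    have h1 := indAct_ι ρ r N g q (g • q) rfl _ (r.rep_mul_cocyc g q)
    have h2 := indAct_ι ρ r N' g q (g • q) rfl _ (r.rep_mul_cocyc g q)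
    have nat := indComp_naturality ρ f.1 g _ _ _ (r.rep_mul_cocyc g q) _ _ (f.2 (r.cocyc g q))
    change (ρ.fn g).map _ ≫ indAct ρ r N g ≫ _ = (ρ.fn g).map _ ≫ _ ≫ indAct ρ r N' g
    rw [reassoc_of% h1, biproduct.ι_map, ← Category.assoc, ← Category.assoc, ← nat,
      ← Functor.map_comp, biproduct.ι_map, Functor.map_comp, Category.assoc, Category.assoc, h2]⟩
  map_id N := Subtype.ext (by
    change biproduct.map (fun q : G ⧸ H => (ρ.fn (r.rep q)).map (𝟙 N.obj)) = 𝟙 _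
    apply biproduct.hom_ext'
    intro q
    rw [biproduct.ι_map, CategoryTheory.Functor.map_id, Category.id_comp, Category.comp_id])
  map_comp {N N' N''} f f' := Subtype.ext (by
    change biproduct.map (fun q : G ⧸ H => (ρ.fn (r.rep q)).map (f.1 ≫ f'.1)) =
      biproduct.map (fun q : G ⧸ H => (ρ.fn (r.rep q)).map f.1) ≫
        biproduct.map (fun q : G ⧸ H => (ρ.fn (r.rep q)).map f'.1)
    apply biproduct.hom_ext'
    intro q
    rw [biproduct.ι_map, biproduct.ι_map_assoc, biproduct.ι_map, Functor.map_comp,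
      Category.assoc])

end Induction

end Action

/-! ### Projective representations -/

/-- A finite dimensional projective representation of `H` over `k` with factor set `α`. -/
structure ProjRep (k : Type w) [Field k] (H : Type x) [Group H] (α : H → H → kˣ) where
  V : Type v
  [addCommGroup : AddCommGroup V]
  [module : Module k V]
  [finite : FiniteDimensional k V]
  act : H → V ≃ₗ[k] V
  act_mul (g h : H) (z : V) : act g (act h z) = (α g h : k) • act (g * h) z

attribute [instance] ProjRep.addCommGroup ProjRep.module ProjRep.finite

namespace ProjRep

variable {k : Type w} [Field k] {H : Type x} [Group H] {α : H → H → kˣ}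

/-- Isomorphism of projective representations with the same factor set `α`, i.e. isomorphism of
modules over the twisted group algebra. -/
def Isomorphic (π : ProjRep.{w, v, x} k H α) (π' : ProjRep.{w, v', x} k H α) : Prop :=
  ∃ φ : π.V ≃ₗ[k] π'.V, ∀ (g : H) (z : π.V), φ (π.act g z) = π'.act g (φ z)

/-- A nonzero projective representation is irreducible if it has no proper nonzero invariant
subspace. -/
def IsIrreducible (π : ProjRep.{w, v, x} k H α) : Prop :=
  Nontrivial π.V ∧
    ∀ W : Submodule k π.V, (∀ (g : H), ∀ z ∈ W, π.act g z ∈ W) → W = ⊥ ∨ W = ⊤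

/-- The dimension of a projective representation. -/
def dim (π : ProjRep.{w, v, x} k H α) : ℕ := Module.finrank k π.V

variable (k H α) in
/-- Isomorphism as an equivalence relation. -/
def setoid : Setoid (ProjRep.{w, v, x} k H α) where
  r := Isomorphic
  iseqv :=
    { refl := fun π => ⟨LinearEquiv.refl k π.V, fun _ _ => rfl⟩
      symm := by
        rintro π π' ⟨φ, hφ⟩
        refine ⟨φ.symm, fun g z => ?_⟩
        rw [LinearEquiv.symm_apply_eq, hφ, LinearEquiv.apply_symm_apply]
      trans := by
        rintro π π' π'' ⟨φ, hφ⟩ ⟨ψ, hψ⟩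
        refine ⟨φ.trans ψ, fun g z => ?_⟩
        rw [LinearEquiv.trans_apply, LinearEquiv.trans_apply, hφ, hψ] }

end ProjRep

/-- Isomorphism classes of projective representations of `H` with factor set `α`. -/
abbrev ProjRepClass (k : Type w) [Field k] (H : Type x) [Group H] (α : H → H → kˣ) :
    Type (max (w + 1) x) :=
  _root_.Quotient (ProjRep.setoid.{w, w, x} k H α)

section Clifford

variable {k : Type w} [Field k] {H : Type x} [Group H] {C : Type u} [Category.{v} C]
  [Abelian C] [Linear k C]

/-- A choice of isomorphisms `c^h : σ^h Y ≅ Y`, for all `h` in `H`. -/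
abbrev StableIsos (σ : GAction k H C) (Y : C) : Type (max x v) :=
  ∀ h : H, (σ.fn h).obj Y ≅ Y

/-- `V ⊗ Y`, for a finite dimensional vector space `V`: the direct sum of `dim V` copies of `Y`,
indexed by the chosen basis `Module.finBasis k V`. -/
abbrev copower (k : Type w) [Field k] (V : Type v') [AddCommGroup V] [Module k V]
    [FiniteDimensional k V] (Y : C) : C :=
  ⨁ fun _ : Fin (Module.finrank k V) => Y

/-- For an additive functor `F`, a linear map `A : V → W` and a morphism `f : F Y ⟶ Z`, the morphism
`A ⊗ f : F (V ⊗ Y) = V ⊗ F Y ⟶ W ⊗ Z`; its components are the matrix entries of `A` times `f`. -/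
def copowerMap (F : C ⥤ C) [F.Additive] {V : Type v'} [AddCommGroup V] [Module k V]
    [FiniteDimensional k V] {W : Type u'} [AddCommGroup W] [Module k W] [FiniteDimensional k W]
    (A : V →ₗ[k] W) {Y Z : C} (f : F.obj Y ⟶ Z) :
    F.obj (copower k V Y) ⟶ copower k W Z :=
  mapDesc F _ fun i => biproduct.lift fun j =>
    LinearMap.toMatrix (Module.finBasis k V) (Module.finBasis k W) A j i • f

theorem copowerMap_comp (F F' : C ⥤ C) [F.Additive] [F'.Additive] [F'.Linear k]
    {V : Type v'} [AddCommGroup V] [Module k V] [FiniteDimensional k V]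
    {W : Type u'} [AddCommGroup W] [Module k W] [FiniteDimensional k W]
    {U : Type x} [AddCommGroup U] [Module k U] [FiniteDimensional k U]
    (A : V →ₗ[k] W) (B : W →ₗ[k] U) {Y Z T : C} (f : F.obj Y ⟶ Z) (f' : F'.obj Z ⟶ T) :
    F'.map (copowerMap F A f) ≫ copowerMap F' B f' =
      copowerMap (F ⋙ F') (B ∘ₗ A) (F'.map f ≫ f') := by
  apply map_sum_hom_ext (F ⋙ F')
  intro i
  unfold copowerMap
  rw [map_ι_mapDesc, Functor.comp_map, ← Category.assoc, ← Functor.map_comp, map_ι_mapDesc]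
  apply biproduct.hom_ext
  intro j
  have hsum : ∀ m : ∀ _ : Fin (Module.finrank k W), F.obj Y ⟶ Z,
      biproduct.lift m = ∑ l, m l ≫ biproduct.ι (fun _ : Fin (Module.finrank k W) => Z) l :=
    fun m => biproduct.lift_eq
  rw [hsum, Functor.map_sum, Preadditive.sum_comp, Preadditive.sum_comp, biproduct.lift_π,
    LinearMap.toMatrix_comp _ (Module.finBasis k W), Matrix.mul_apply, Finset.sum_smul]
  refine Finset.sum_congr rfl fun l _ => ?_
  rw [Functor.map_comp, Category.assoc, Category.assoc, map_ι_mapDesc_assoc, biproduct.lift_π,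
    Functor.map_smul, Linear.smul_comp, Linear.comp_smul, smul_smul, mul_comm]

theorem copowerMap_smul (F : C ⥤ C) [F.Additive]
    {V : Type v'} [AddCommGroup V] [Module k V] [FiniteDimensional k V]
    {W : Type u'} [AddCommGroup W] [Module k W] [FiniteDimensional k W]
    (a : k) (A : V →ₗ[k] W) {Y Z : C} (f : F.obj Y ⟶ Z) :
    copowerMap F (a • A) f = copowerMap F A (a • f) := by
  unfold copowerMap
  congr 1
  funext i
  congr 1
  funext j
  rw [map_smul, Matrix.smul_apply, smul_eq_mul, smul_smul, mul_comm]

theorem copowerMap_naturality {F F' : C ⥤ C} [F.Additive] [F'.Additive] (τ : F ⟶ F')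
    {V : Type v'} [AddCommGroup V] [Module k V] [FiniteDimensional k V]
    {W : Type u'} [AddCommGroup W] [Module k W] [FiniteDimensional k W]
    (A : V →ₗ[k] W) {Y Z : C} (f : F'.obj Y ⟶ Z) :
    copowerMap F A (τ.app Y ≫ f) = τ.app _ ≫ copowerMap F' A f := by
  apply map_sum_hom_ext F
  intro i
  unfold copowerMap
  rw [map_ι_mapDesc, τ.naturality_assoc, map_ι_mapDesc]
  apply biproduct.hom_ext
  intro j
  rw [biproduct.lift_π, Category.assoc, biproduct.lift_π, Linear.comp_smul]

theorem copowerMap_id {V : Type v'} [AddCommGroup V] [Module k V] [FiniteDimensional k V] (Y : C) :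
    copowerMap (k := k) (𝟭 C) (LinearMap.id : V →ₗ[k] V) (𝟙 Y) = 𝟙 (copower k V Y) := by
  classical
  apply map_sum_hom_ext (𝟭 C)
  intro i
  unfold copowerMap
  rw [map_ι_mapDesc]
  apply biproduct.hom_ext
  intro j
  rw [biproduct.lift_π, LinearMap.toMatrix_id, Matrix.one_apply]
  by_cases h : j = i
  · subst h
    simp
  · rw [if_neg h, zero_smul]
    have h1 := biproduct.ι_π_ne (fun _ : Fin (Module.finrank k V) => Y) (Ne.symm h)
    exact (h1.symm.trans (congrArg (· ≫ _) (Category.comp_id _).symm))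

variable [IsAlgClosed k] [IsFiniteSemisimple k C] (σ : GAction k H C) (Y : C) [Simple Y]
  (c : StableIsos σ Y)

theorem exists_factor (g h : H) : ∃ a : kˣ,
    (c (g * h)).inv ≫ (σ.comp g h _ rfl).inv.app Y ≫ (σ.fn g).map (c h).hom ≫ (c g).hom =
      ((a⁻¹ : kˣ) : k) • 𝟙 Y := by
  obtain ⟨b, hb⟩ := endomorphism_simple_eq_smul_id k
    ((c (g * h)).inv ≫ (σ.comp g h _ rfl).inv.app Y ≫ (σ.fn g).map (c h).hom ≫ (c g).hom)
  have hb0 : b ≠ 0 := by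
    rintro rfl
    rw [zero_smul] at hb
    have h1 : IsIso (0 : Y ⟶ Y) := by rw [hb]; infer_instance
    exact id_nonzero Y ((isIsoZeroEquiv Y Y h1).1)
  exact ⟨(Units.mk0 b hb0)⁻¹, by rw [inv_inv, Units.val_mk0, hb]⟩

/-- The factor set `α` attached to the isomorphisms `c`:
`α(g, h)⁻¹ id_Y = c^g ρ^g(c^h) (ρ₂^{g,h})⁻¹ (c^{gh})⁻¹`. -/
def factorSet (g h : H) : kˣ := (exists_factor σ Y c g h).choose

theorem factorSet_spec (g h : H) :
    (c (g * h)).inv ≫ (σ.comp g h _ rfl).inv.app Y ≫ (σ.fn g).map (c h).hom ≫ (c g).hom =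
      (((factorSet σ Y c g h)⁻¹ : kˣ) : k) • 𝟙 Y :=
  (exists_factor σ Y c g h).choose_spec

theorem factorSet_spec' (g h : H) :
    (σ.fn g).map (c h).hom ≫ (c g).hom =
      (((factorSet σ Y c g h)⁻¹ : kˣ) : k) •
        ((σ.comp g h _ rfl).hom.app Y ≫ (c (g * h)).hom) := by
  rw [← cancel_epi ((σ.comp g h _ rfl).inv.app Y), ← cancel_epi (c (g * h)).inv,
    factorSet_spec, Linear.comp_smul, Linear.comp_smul, Iso.inv_hom_id_app_assoc, Iso.inv_hom_id]

theorem factorSet_unit :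
    σ.unit.hom.app Y ≫ (c 1).hom = (((factorSet σ Y c 1 1)⁻¹ : kˣ) : k) • 𝟙 Y := by
  have h1 : ∀ (l : H) (e : 1 * 1 = l), (σ.fn 1).map (c 1).hom ≫ (c 1).hom =
      (((factorSet σ Y c 1 1)⁻¹ : kˣ) : k) • ((σ.comp 1 1 l e).hom.app Y ≫ (c l).hom) := by
    rintro l rfl
    exact factorSet_spec' σ Y c 1 1
  have h2 : (σ.fn 1).map (c 1).hom =
      (((factorSet σ Y c 1 1)⁻¹ : kˣ) : k) • (σ.comp 1 1 1 (one_mul 1)).hom.app Y := by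
    rw [← cancel_mono (c 1).hom, h1 1 (one_mul 1), Linear.smul_comp]
  have nat : (c 1).hom ≫ σ.unit.hom.app Y =
      σ.unit.hom.app ((σ.fn 1).obj Y) ≫ (σ.fn 1).map (c 1).hom :=
    σ.unit.hom.naturality (c 1).hom
  rw [h2, Linear.comp_smul, σ.unit_left] at nat
  rw [← cancel_epi (c 1).hom, reassoc_of% nat, Linear.smul_comp, Linear.comp_smul]
  exact congrArg _ ((Category.id_comp _).trans (Category.comp_id _).symm)

theorem factorSet_spec_inv (g h : H) :
    (c g).inv ≫ (σ.fn g).map (c h).inv ≫ (σ.comp g h _ rfl).hom.app Y =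
      (factorSet σ Y c g h : k) • (c (g * h)).inv := by
  have h1 := factorSet_spec' σ Y c g h
  rw [← cancel_mono (c (g * h)).hom, Linear.smul_comp, Iso.inv_hom_id, Category.assoc,
    Category.assoc, ← cancel_epi (c g).hom, Iso.hom_inv_id_assoc,
    ← cancel_epi ((σ.fn g).map (c h).hom), ← Category.assoc, ← Functor.map_comp, Iso.hom_inv_id,
    CategoryTheory.Functor.map_id, Linear.comp_smul, Linear.comp_smul, Category.comp_id, h1,
    smul_smul, Units.mul_inv, one_smul]
  exact Category.id_comp _

variable {σ} in
/-- The projective representation of `H` on `Hom(Y, N)`, for `(N, ν)` in `C^H`, given by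
`π(h)(f) = ν^h ρ^h(f) (c^h)⁻¹`. -/
def homRep (N : EqObj σ) : ProjRep.{w, v, x} k H (factorSet σ Y c) where
  V := Y ⟶ N.obj
  act h := LinearEquiv.ofInjectiveEndo
    { toFun := fun f => (c h).inv ≫ (σ.fn h).map f ≫ N.act h
      map_add' := fun f f' => by simp
      map_smul' := fun a f => by simp } (by
        intro f f' hf
        have := σ.isEquivalence h
        have := N.isIso_act h
        exact (σ.fn h).map_injective ((cancel_mono (N.act h)).1 ((cancel_epi (c h).inv).1 hf)))
  act_mul g h f := by
    change (c g).inv ≫ (σ.fn g).map ((c h).inv ≫ (σ.fn h).map f ≫ N.act h) ≫ N.act g =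
      (factorSet σ Y c g h : k) • ((c (g * h)).inv ≫ (σ.fn (g * h)).map f ≫ N.act (g * h))
    have nat : (σ.fn g).map ((σ.fn h).map f) ≫ (σ.comp g h _ rfl).hom.app N.obj =
        (σ.comp g h _ rfl).hom.app Y ≫ (σ.fn (g * h)).map f :=
      (σ.comp g h _ rfl).hom.naturality f
    have hc := factorSet_spec_inv σ Y c g h
    rw [Functor.map_comp, Functor.map_comp, Category.assoc, Category.assoc, N.act_mul,
      reassoc_of% nat, reassoc_of% hc, Linear.smul_comp]

theorem repObj_act_mul (π : ProjRep.{w, v', x} k H (factorSet σ Y c)) (g h : H) :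
    (σ.fn g).map (copowerMap (σ.fn h) (π.act h).toLinearMap (c h).hom) ≫
        copowerMap (σ.fn g) (π.act g).toLinearMap (c g).hom =
      (σ.comp g h _ rfl).hom.app (copower k π.V Y) ≫
        copowerMap (σ.fn (g * h)) (π.act (g * h)).toLinearMap (c (g * h)).hom := by
  have hπ : (π.act g).toLinearMap ∘ₗ (π.act h).toLinearMap =
      (factorSet σ Y c g h : k) • (π.act (g * h)).toLinearMap :=
    LinearMap.ext fun z => π.act_mul g h z
  rw [copowerMap_comp, hπ, copowerMap_smul, factorSet_spec', smul_smul, Units.mul_inv, one_smul,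
    copowerMap_naturality]

theorem repObj_act_one (π : ProjRep.{w, v', x} k H (factorSet σ Y c)) :
    σ.unit.hom.app (copower k π.V Y) ≫
      copowerMap (σ.fn 1) (π.act 1).toLinearMap (c 1).hom = 𝟙 (copower k π.V Y) := by
  have hπ : (π.act 1).toLinearMap = (factorSet σ Y c 1 1 : k) • LinearMap.id := by
    refine LinearMap.ext fun z => ?_
    have h1 := π.act_mul 1 1 ((π.act 1).symm z)
    rw [LinearEquiv.apply_symm_apply, mul_one, LinearEquiv.apply_symm_apply] at h1
    exact h1
  have h2 := copowerMap_naturality σ.unit.hom (LinearMap.id : π.V →ₗ[k] π.V)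
    ((factorSet σ Y c 1 1 : k) • (c 1).hom)
  rw [hπ, copowerMap_smul, ← copowerMap_id]
  refine h2.symm.trans (congrArg _ ?_)
  rw [Linear.comp_smul, factorSet_unit, smul_smul, Units.mul_inv, one_smul]

variable {σ Y} in
/-- The `H`-equivariant object `π ⊗ Y = (V ⊗ Y, π(h) ⊗ c^h)`. -/
def repObj (π : ProjRep.{w, v', x} k H (factorSet σ Y c)) : EqObj σ where
  obj := copower k π.V Y
  act h := copowerMap (σ.fn h) (π.act h).toLinearMap (c h).hom
  isIso_act := EqObj.isIso_of_laws σ _ _ (repObj_act_mul σ Y c π) (repObj_act_one σ Y c π)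
  act_mul := repObj_act_mul σ Y c π
  act_one := repObj_act_one σ Y c π

theorem repObj_iso (π π' : ProjRep.{w, v', x} k H (factorSet σ Y c)) (h : π.Isomorphic π') :
    Nonempty (repObj c π ≅ repObj c π') := by
  obtain ⟨φ, hφ⟩ := h
  have hid : ∀ {V W : Type v'} [AddCommGroup V] [Module k V] [FiniteDimensional k V]
      [AddCommGroup W] [Module k W] [FiniteDimensional k W] (ψ : V ≃ₗ[k] W),
      copowerMap (𝟭 C) ψ.toLinearMap (𝟙 Y) ≫ copowerMap (𝟭 C) ψ.symm.toLinearMap (𝟙 Y) =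
        𝟙 (copower k V Y) := by
    intro V W _ _ _ _ _ _ ψ
    have h1 := copowerMap_comp (𝟭 C) (𝟭 C) ψ.toLinearMap ψ.symm.toLinearMap (𝟙 Y) (𝟙 Y)
    have h2 : ψ.symm.toLinearMap ∘ₗ ψ.toLinearMap = LinearMap.id :=
      LinearMap.ext fun z => ψ.symm_apply_apply z
    rw [h2] at h1
    refine h1.trans (Eq.trans ?_ (copowerMap_id Y))
    exact congrArg _ (Category.comp_id _)
  refine ⟨EqObj.mkIso
    { hom := copowerMap (𝟭 C) φ.toLinearMap (𝟙 Y)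
      inv := copowerMap (𝟭 C) φ.symm.toLinearMap (𝟙 Y)
      hom_inv_id := hid φ
      inv_hom_id := hid φ.symm } fun g => ?_⟩
  have hφ' : φ.toLinearMap ∘ₗ (π.act g).toLinearMap = (π'.act g).toLinearMap ∘ₗ φ.toLinearMap :=
    LinearMap.ext fun z => hφ g z
  have h1 := copowerMap_comp (σ.fn g) (𝟭 C) (π.act g).toLinearMap φ.toLinearMap (c g).hom (𝟙 Y)
  have h2 := copowerMap_comp (𝟭 C) (σ.fn g) φ.toLinearMap (π'.act g).toLinearMap (𝟙 Y) (c g).hom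
  rw [hφ'] at h1
  refine h1.trans (Eq.trans ?_ h2.symm)
  have e : (𝟭 C).map (c g).hom ≫ 𝟙 Y = (σ.fn g).map (𝟙 Y) ≫ (c g).hom := by simp
  exact congrArg (copowerMap (σ.fn g) ((π'.act g).toLinearMap ∘ₗ φ.toLinearMap)) e

end Clifford

/-! ### Tensor actions on monoidal categories and Frobenius-Perron dimension -/

section Monoidal

open MonoidalCategory Functor.LaxMonoidal Functor.OplaxMonoidal

variable {k : Type w} [Field k] {G : Type x} [Group G] {C : Type u} [Category.{v} C]
  [MonoidalCategory C]

theorem app_δ {F F' : C ⥤ C} [F.Monoidal] [F'.Monoidal] (τ : F ⟶ F') [NatTrans.IsMonoidal τ]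
    (X Y : C) : τ.app (X ⊗ Y) ≫ δ F' X Y = δ F X Y ≫ (τ.app X ⊗ₘ τ.app Y) := by
  rw [← cancel_epi (μ F X Y), NatTrans.IsMonoidal.tensor_assoc, Functor.Monoidal.μ_δ,
    Functor.Monoidal.μ_δ_assoc, Category.comp_id]

theorem app_η {F F' : C ⥤ C} [F.Monoidal] [F'.Monoidal] (τ : F ⟶ F') [NatTrans.IsMonoidal τ] :
    τ.app (𝟙_ C) ≫ η F' = η F := by
  rw [← cancel_epi (ε F), NatTrans.IsMonoidal.unit_assoc, Functor.Monoidal.ε_η,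
    Functor.Monoidal.ε_η]

variable [Preadditive C] [Linear k C]

/-- The structure of an action by tensor autoequivalences: every `ρ^g` is a monoidal functor, and
the coherence isomorphisms of the action are monoidal. -/
class TensorAction (ρ : GAction k G C) where
  [monoidal : ∀ g, (ρ.fn g).Monoidal]
  comp_isMonoidal (g h l : G) (e : g * h = l) : NatTrans.IsMonoidal (ρ.comp g h l e).hom
  unit_isMonoidal : NatTrans.IsMonoidal ρ.unit.hom

attribute [reducible] TensorAction.monoidal

attribute [instance] TensorAction.monoidal TensorAction.comp_isMonoidal
  TensorAction.unit_isMonoidal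

variable {ρ : GAction k G C} [TensorAction ρ]

namespace EqObj

theorem tensor_act_mul (M N : EqObj ρ) (g h : G) :
    (ρ.fn g).map (δ (ρ.fn h) M.obj N.obj ≫ (M.act h ⊗ₘ N.act h)) ≫
        δ (ρ.fn g) M.obj N.obj ≫ (M.act g ⊗ₘ N.act g) =
      (ρ.comp g h _ rfl).hom.app (M.obj ⊗ N.obj) ≫
        δ (ρ.fn (g * h)) M.obj N.obj ≫ (M.act (g * h) ⊗ₘ N.act (g * h)) := by
  have h1 := app_δ (ρ.comp g h _ rfl).hom M.obj N.obj
  rw [← Category.assoc ((ρ.comp g h _ rfl).hom.app _), h1, Functor.OplaxMonoidal.comp_δ,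
    Category.assoc, Category.assoc, tensorHom_comp_tensorHom, ← M.act_mul, ← N.act_mul,
    ← tensorHom_comp_tensorHom, Functor.map_comp, Category.assoc, δ_natural_assoc]

theorem tensor_act_one (M N : EqObj ρ) :
    ρ.unit.hom.app (M.obj ⊗ N.obj) ≫
      δ (ρ.fn 1) M.obj N.obj ≫ (M.act 1 ⊗ₘ N.act 1) = 𝟙 (M.obj ⊗ N.obj) := by
  have h1 := app_δ ρ.unit.hom M.obj N.obj
  rw [← Category.assoc, h1, Functor.OplaxMonoidal.id_δ, Category.assoc, tensorHom_comp_tensorHom,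
    M.act_one, N.act_one]
  exact (Category.id_comp _).trans (id_tensorHom_id _ _)

/-- The tensor product `(X, μ) ⊗ (X', μ')` of equivariant objects: `X ⊗ X'` with the structure maps
`ρ^g(X ⊗ X') ≅ ρ^g X ⊗ ρ^g X' ⟶ X ⊗ X'` given by `μ^g ⊗ μ'^g`. -/
def tensor (M N : EqObj ρ) : EqObj ρ where
  obj := M.obj ⊗ N.obj
  act g := δ (ρ.fn g) M.obj N.obj ≫ (M.act g ⊗ₘ N.act g)
  isIso_act := isIso_of_laws ρ _ _ (tensor_act_mul M N) (tensor_act_one M N)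
  act_mul := tensor_act_mul M N
  act_one := tensor_act_one M N

variable (ρ) in
theorem unit_act_mul (g h : G) :
    (ρ.fn g).map (η (ρ.fn h)) ≫ η (ρ.fn g) =
      (ρ.comp g h _ rfl).hom.app (𝟙_ C) ≫ η (ρ.fn (g * h)) := by
  rw [app_η, Functor.OplaxMonoidal.comp_η]

variable (ρ) in
theorem unit_act_one : ρ.unit.hom.app (𝟙_ C) ≫ η (ρ.fn 1) = 𝟙 (𝟙_ C) := by
  rw [app_η, Functor.OplaxMonoidal.id_η]
  rfl

variable (ρ) in
/-- The unit object, with structure maps `ρ^g 𝟙 ≅ 𝟙`. -/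
def tensorUnit : EqObj ρ where
  obj := 𝟙_ C
  act g := η (ρ.fn g)
  isIso_act := isIso_of_laws ρ _ _ (unit_act_mul ρ) (unit_act_one ρ)
  act_mul := unit_act_mul ρ
  act_one := unit_act_one ρ

theorem tensor_hom_comm {M N M' N' : EqObj ρ} (f : M ⟶ M') (f' : N ⟶ N') (g : G) :
    (δ (ρ.fn g) M.obj N.obj ≫ (M.act g ⊗ₘ N.act g)) ≫ (f.1 ⊗ₘ f'.1) =
      (ρ.fn g).map (f.1 ⊗ₘ f'.1) ≫ δ (ρ.fn g) M'.obj N'.obj ≫ (M'.act g ⊗ₘ N'.act g) := by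
  rw [Category.assoc, tensorHom_comp_tensorHom, f.2 g, f'.2 g, ← tensorHom_comp_tensorHom,
    δ_natural_assoc]

theorem tensor_assoc_comm (M N P : EqObj ρ) (g : G) :
    (δ (ρ.fn g) (M.obj ⊗ N.obj) P.obj ≫
        ((δ (ρ.fn g) M.obj N.obj ≫ (M.act g ⊗ₘ N.act g)) ⊗ₘ P.act g)) ≫
          (α_ M.obj N.obj P.obj).hom =
      (ρ.fn g).map (α_ M.obj N.obj P.obj).hom ≫ δ (ρ.fn g) M.obj (N.obj ⊗ P.obj) ≫
        (M.act g ⊗ₘ (δ (ρ.fn g) N.obj P.obj ≫ (N.act g ⊗ₘ P.act g))) := by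
  have h1 := Functor.OplaxMonoidal.associativity (ρ.fn g) M.obj N.obj P.obj
  have h2 : ((δ (ρ.fn g) M.obj N.obj ≫ (M.act g ⊗ₘ N.act g)) ⊗ₘ P.act g) =
      δ (ρ.fn g) M.obj N.obj ▷ (ρ.fn g).obj P.obj ≫ ((M.act g ⊗ₘ N.act g) ⊗ₘ P.act g) := by
    rw [← tensorHom_id, tensorHom_comp_tensorHom, Category.id_comp]
  have h3 : (M.act g ⊗ₘ (δ (ρ.fn g) N.obj P.obj ≫ (N.act g ⊗ₘ P.act g))) =
      (ρ.fn g).obj M.obj ◁ δ (ρ.fn g) N.obj P.obj ≫ (M.act g ⊗ₘ (N.act g ⊗ₘ P.act g)) := by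
    rw [← id_tensorHom, tensorHom_comp_tensorHom, Category.id_comp]
  rw [h2, h3, Category.assoc, Category.assoc, associator_naturality, ← reassoc_of% h1]

theorem tensor_leftUnitor_comm (M : EqObj ρ) (g : G) :
    (δ (ρ.fn g) (𝟙_ C) M.obj ≫ (η (ρ.fn g) ⊗ₘ M.act g)) ≫ (λ_ M.obj).hom =
      (ρ.fn g).map (λ_ M.obj).hom ≫ M.act g := by
  have h1 := Functor.OplaxMonoidal.left_unitality_hom (ρ.fn g) M.obj
  rw [MonoidalCategory.tensorHom_def, Category.assoc, Category.assoc, leftUnitor_naturality,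
    reassoc_of% h1]

theorem tensor_rightUnitor_comm (M : EqObj ρ) (g : G) :
    (δ (ρ.fn g) M.obj (𝟙_ C) ≫ (M.act g ⊗ₘ η (ρ.fn g))) ≫ (ρ_ M.obj).hom =
      (ρ.fn g).map (ρ_ M.obj).hom ≫ M.act g := by
  have h1 := Functor.OplaxMonoidal.right_unitality_hom (ρ.fn g) M.obj
  rw [MonoidalCategory.tensorHom_def', Category.assoc, Category.assoc, rightUnitor_naturality,
    reassoc_of% h1]

instance monoidalStruct : MonoidalCategoryStruct (EqObj ρ) where
  tensorObj := tensor
  tensorUnit := tensorUnit ρ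
  whiskerLeft M N N' f := ⟨M.obj ◁ f.1, by
    intro g
    rw [← id_tensorHom]
    exact tensor_hom_comm (𝟙 M) f g⟩
  whiskerRight f M := ⟨f.1 ▷ M.obj, by
    intro g
    rw [← tensorHom_id]
    exact tensor_hom_comm f (𝟙 M) g⟩
  tensorHom f f' := ⟨f.1 ⊗ₘ f'.1, tensor_hom_comm f f'⟩
  associator M N P := mkIso (α_ M.obj N.obj P.obj) (tensor_assoc_comm M N P)
  leftUnitor M := mkIso (λ_ M.obj) (tensor_leftUnitor_comm M)
  rightUnitor M := mkIso (ρ_ M.obj) (tensor_rightUnitor_comm M)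

/-- The monoidal structure of `C^G`; the forgetful functor to `C` is (strictly) monoidal. -/
instance monoidalCategory : MonoidalCategory (EqObj ρ) :=
  Monoidal.induced (forget ρ)
    { μIso := fun M N => Iso.refl (M.obj ⊗ N.obj)
      εIso := Iso.refl (𝟙_ C)
      whiskerLeft_eq := by
        intro M N N' f
        exact ((Category.id_comp _).trans (Category.comp_id _)).symm
      whiskerRight_eq := by
        intro M N f P
        exact ((Category.id_comp _).trans (Category.comp_id _)).symm
      tensorHom_eq := by
        intro M N M' N' f f'
        exact ((Category.id_comp _).trans (Category.comp_id _)).symm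
      associator_eq := by
        intro M N P
        change (α_ M.obj N.obj P.obj).hom = (𝟙 _ ≫ (𝟙 (M.obj ⊗ N.obj) ⊗ₘ 𝟙 P.obj)) ≫
          (α_ M.obj N.obj P.obj).hom ≫ ((𝟙 M.obj ⊗ₘ 𝟙 (N.obj ⊗ P.obj)) ≫ 𝟙 _)
        simp
      leftUnitor_eq := by
        intro M
        change (λ_ M.obj).hom = (𝟙 _ ≫ (𝟙 (𝟙_ C) ⊗ₘ 𝟙 M.obj)) ≫ (λ_ M.obj).hom
        simp
      rightUnitor_eq := by
        intro M
        change (ρ_ M.obj).hom = (𝟙 _ ≫ (𝟙 M.obj ⊗ₘ 𝟙 (𝟙_ C))) ≫ (ρ_ M.obj).hom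
        simp }

end EqObj

/-- The Frobenius-Perron dimension of `X`: the largest real eigenvalue of the matrix
`(N_{X,j}^i)_{i,j ∈ Irr}`, `N_{X,j}^i = dim Hom(S_i, X ⊗ S_j)`, of left multiplication by `X` on the
Grothendieck ring. -/
def FPdim (k : Type w) [Field k] {D : Type u} [Category.{v} D] [Preadditive D] [Linear k D]
    [MonoidalCategory D] (X : D) : ℝ :=
  sSup {a : ℝ | ∃ z : Irr D → ℝ, z ≠ 0 ∧ ∀ i : Irr D,
    ∑ᶠ j : Irr D, (Module.finrank k (i.rep ⟶ X ⊗ j.rep) : ℝ) * z j = a * z i}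

end Monoidal

/-! ### The simple objects `S_{Y,π}` -/

section CliffordObj

variable {k : Type w} [Field k] [IsAlgClosed k] {C : Type u} [Category.{v} C] [Abelian C]
  [Linear k C] [IsFiniteSemisimple k C] {G : Type x} [Group G] [Finite G]

/-- The `G`-equivariant object `S_{Y,π} = L_Y(π ⊗ Y)`, where `L_Y : C^{G_Y} ⥤ C^G` is the relative
induction functor. -/
def cliffordObj (ρ : GAction k G C) {Y : C} [Simple Y] (r : Transversal (ρ.inertia Y))
    (c : StableIsos (ρ.restrict (ρ.inertia Y)) Y)
    (π : ProjRep.{w, v', x} k (ρ.inertia Y) (factorSet (ρ.restrict (ρ.inertia Y)) Y c)) :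
    EqObj ρ :=
  (relInd ρ r).obj (repObj c π)

/-- The map `[π] ↦ [S_{Y,π}]` on isomorphism classes. -/
def cliffordClass (ρ : GAction k G C) {Y : C} [Simple Y] (r : Transversal (ρ.inertia Y))
    (c : StableIsos (ρ.restrict (ρ.inertia Y)) Y) :
    ProjRepClass k (ρ.inertia Y) (factorSet (ρ.restrict (ρ.inertia Y)) Y c) →
      IsoClass (EqObj ρ) :=
  _root_.Quotient.lift (fun π => isoClass (cliffordObj ρ r c π)) fun π π' h => by
    obtain ⟨e⟩ := repObj_iso (ρ.restrict (ρ.inertia Y)) Y c π π' h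
    exact _root_.Quotient.sound ⟨(relInd ρ r).mapIso e⟩

end CliffordObj

end

end EquivClifford

open CategoryTheory CategoryTheory.Limits CategoryTheory.MonoidalCategory EquivClifford

universe w v u x

namespace EquivClifford

universe v' u'

noncomputable section

/-! ### Finite direct sum decompositions and semisimple categories -/

/-! Everything is controlled by the functor `Hom(Y, -)`. Write `H` for the inertia group of `Y`. The
simple constituents of the summand `ρ^t N` of an induced object are conjugates by `t` of those of
`N`. If `N` is a multiple of `Y`, then `Y` occurs in `ρ^t N` only for `t ∈ H`, so every map from `Y`
to `L N` lands in the one summand isomorphic to `N`, and `Hom(Y, L N) = Hom(Y, N)`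
(`exists_eq_comp_unitMap`, `isomorphic_homRep_relInd`). Schur's lemma gives `Hom(Y, V ⊗ Y) = V`,
hence `Hom(Y, S_{Y,π}) = π`.

Since `G` permutes the summands of `L N` transitively, an equivariant morphism from or to `L N`
vanishes as soon as it does so on `Hom(Y, -)`; this is the property `IsDetected`. Two consequences
carry the correspondence. If `π` is irreducible, then `S_{Y,π}` is simple: a nonzero subobject has a
nonzero, hence full, `Hom(Y, -)`, and by Maschke's theorem (averaging over the group) it is a direct
summand whose complementary projection vanishes (`IsDetected.simple`). If `X` is simple, then any
nonzero invariant subspace `W` of `Hom(Y, X)` yields a nonzero monomorphism from `S_{Y,W}` to `X`,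
hence an isomorphism (`isIso_cliffordDesc`). This shows both that `Hom(Y, X)` is irreducible and
that `X` is recovered from it. The orbit of `Y` is determined because all simple constituents of
`S_{Y,π}` are conjugates of `Y`.

For Frobenius-Perron dimensions, call a function on objects a dimension function if it is additive,
multiplicative and positive on simple objects. Its values on the simple objects form a positive left
eigenvector of each multiplication matrix, so it must equal `FPdim` (`IsDimFn.FPdim_eq`). On a
fusion category one is produced from a Perron eigenvector (`exists_isDimFn`). Composed with the
forgetful functor it computes `FPdim` on `C^G`; composed with `ρ^g` it is again a dimension
function, hence unchanged. The formula then follows by counting summands. -/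

/-- A decomposition of `Z` as the direct sum of a finite family `S`. -/
structure SumDecomp {D : Type u} [Category.{v} D] [Preadditive D] (Z : D) {J : Type x} [Fintype J]
    (S : J → D) where
  inj : ∀ j, S j ⟶ Z
  proj : ∀ j, Z ⟶ S j
  inj_proj_self : ∀ j, inj j ≫ proj j = 𝟙 (S j)
  inj_proj_ne : ∀ i j, i ≠ j → inj i ≫ proj j = 0
  total : ∑ j, proj j ≫ inj j = 𝟙 Z

namespace SumDecomp

variable {D : Type u} [Category.{v} D] [Preadditive D] {Z : D} {J : Type x} [Fintype J] {S : J → D}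

/-- A finite biproduct is decomposed by its factors. -/
def biproduct (S : J → D) [HasBiproduct S] : SumDecomp (⨁ S) S where
  inj := biproduct.ι S
  proj := biproduct.π S
  inj_proj_self := biproduct.ι_π_self S
  inj_proj_ne _ _ h := biproduct.ι_π_ne S h
  total := by
    classical
    apply biproduct.hom_ext'
    intro j
    rw [Preadditive.comp_sum, Finset.sum_eq_single j]
    · simp
    · intro i _ hi
      rw [← Category.assoc, biproduct.ι_π_ne S (Ne.symm hi), zero_comp]
    · intro h
      exact absurd (Finset.mem_univ j) h

/-- Transport of a decomposition along an isomorphism. -/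
def ofIso (b : SumDecomp Z S) {Z' : D} (e : Z' ≅ Z) : SumDecomp Z' S where
  inj j := b.inj j ≫ e.inv
  proj j := e.hom ≫ b.proj j
  inj_proj_self j := by simp [b.inj_proj_self]
  inj_proj_ne i j h := by simp [b.inj_proj_ne i j h]
  total := by
    have := congrArg (fun t => e.hom ≫ t ≫ e.inv) b.total
    simpa [Preadditive.comp_sum, Preadditive.sum_comp] using this

/-- The decomposition of an object with a single summand isomorphic to it. -/
def ofUnique {Z' : D} (e : Z ≅ Z') : SumDecomp Z (fun _ : Fin 1 => Z') where
  inj _ := e.inv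
  proj _ := e.hom
  inj_proj_self _ := e.inv_hom_id
  inj_proj_ne i j h := absurd (Subsingleton.elim i j) h
  total := by simp

/-- The image of a decomposition under an additive functor. -/
def map (b : SumDecomp Z S) {D' : Type u'} [Category.{v'} D'] [Preadditive D'] (F : D ⥤ D')
    [F.Additive] : SumDecomp (F.obj Z) (fun j => F.obj (S j)) where
  inj j := F.map (b.inj j)
  proj j := F.map (b.proj j)
  inj_proj_self j := by rw [← F.map_comp, b.inj_proj_self, F.map_id]
  inj_proj_ne i j h := by rw [← F.map_comp, b.inj_proj_ne i j h, F.map_zero]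
  total := by simp only [← F.map_comp, ← F.map_sum, b.total, F.map_id]

/-- Concatenation of the decompositions of two complementary summands. -/
def glue {A B : D} {I : Type x} {J : Type x} [Fintype I] [Fintype J] {S : I → D} {T : J → D}
    (a : SumDecomp A S) (b : SumDecomp B T) (iA : A ⟶ Z) (pA : Z ⟶ A) (iB : B ⟶ Z) (pB : Z ⟶ B)
    (hA : iA ≫ pA = 𝟙 A) (hB : iB ≫ pB = 𝟙 B) (hAB : iA ≫ pB = 0) (hBA : iB ≫ pA = 0)
    (ht : pA ≫ iA + pB ≫ iB = 𝟙 Z) : SumDecomp Z (Sum.elim S T) where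
  inj
    | Sum.inl i => a.inj i ≫ iA
    | Sum.inr i => b.inj i ≫ iB
  proj
    | Sum.inl i => pA ≫ a.proj i
    | Sum.inr i => pB ≫ b.proj i
  inj_proj_self
    | Sum.inl i => by
      change (a.inj i ≫ iA) ≫ pA ≫ a.proj i = 𝟙 (S i)
      rw [Category.assoc, reassoc_of% hA, a.inj_proj_self]
    | Sum.inr i => by
      change (b.inj i ≫ iB) ≫ pB ≫ b.proj i = 𝟙 (T i)
      rw [Category.assoc, reassoc_of% hB, b.inj_proj_self]
  inj_proj_ne
    | Sum.inl i, Sum.inl j, h => by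
      change (a.inj i ≫ iA) ≫ pA ≫ a.proj j = 0
      rw [Category.assoc, reassoc_of% hA, a.inj_proj_ne i j (fun e => h (congrArg _ e))]
    | Sum.inr i, Sum.inr j, h => by
      change (b.inj i ≫ iB) ≫ pB ≫ b.proj j = 0
      rw [Category.assoc, reassoc_of% hB, b.inj_proj_ne i j (fun e => h (congrArg _ e))]
    | Sum.inl i, Sum.inr j, _ => by
      change (a.inj i ≫ iA) ≫ pB ≫ b.proj j = 0
      rw [Category.assoc, reassoc_of% hAB, zero_comp, comp_zero]
    | Sum.inr i, Sum.inl j, _ => by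
      change (b.inj i ≫ iB) ≫ pA ≫ a.proj j = 0
      rw [Category.assoc, reassoc_of% hBA, zero_comp, comp_zero]
  total := by
    rw [Fintype.sum_sum_type]
    have h1 : ∑ i, (pA ≫ a.proj i) ≫ a.inj i ≫ iA = pA ≫ iA := by
      simp only [Category.assoc]
      rw [← Preadditive.comp_sum]
      simp only [← Category.assoc (a.proj _)]
      rw [← Preadditive.sum_comp, a.total, Category.id_comp]
    have h2 : ∑ i, (pB ≫ b.proj i) ≫ b.inj i ≫ iB = pB ≫ iB := by
      simp only [Category.assoc]
      rw [← Preadditive.comp_sum]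
      simp only [← Category.assoc (b.proj _)]
      rw [← Preadditive.sum_comp, b.total, Category.id_comp]
    exact (congrArg₂ (· + ·) h1 h2).trans ht

/-- A morphism out of a direct sum vanishes if its components do. -/
theorem eq_zero_of_inj (b : SumDecomp Z S) {X : D} (a : Z ⟶ X) (h : ∀ j, b.inj j ≫ a = 0) :
    a = 0 := by
  rw [← Category.id_comp a, ← b.total, Preadditive.sum_comp]
  exact Finset.sum_eq_zero fun j _ => by rw [Category.assoc, h, comp_zero]

/-- A morphism to a direct sum vanishes if its components do. -/
theorem eq_zero_of_proj (b : SumDecomp Z S) {X : D} (a : X ⟶ Z) (h : ∀ j, a ≫ b.proj j = 0) :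
    a = 0 := by
  rw [← Category.comp_id a, ← b.total, Preadditive.comp_sum]
  exact Finset.sum_eq_zero fun j _ => by rw [reassoc_of% h, zero_comp]

/-- Morphisms to a direct sum are families of morphisms to the summands. -/
def homEquiv (k : Type w) [Field k] [Linear k D] (b : SumDecomp Z S) (T : D) :
    (T ⟶ Z) ≃ₗ[k] ∀ j, T ⟶ S j where
  toFun f j := f ≫ b.proj j
  map_add' f g := by ext; simp
  map_smul' c f := by ext; simp
  invFun m := ∑ j, m j ≫ b.inj j
  left_inv f := by
    simp only [Category.assoc]
    rw [← Preadditive.comp_sum, b.total, Category.comp_id]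
  right_inv m := by
    classical
    funext j
    change (∑ i, m i ≫ b.inj i) ≫ b.proj j = m j
    rw [Preadditive.sum_comp, Finset.sum_eq_single j]
    · rw [Category.assoc, b.inj_proj_self, Category.comp_id]
    · intro i _ hi
      rw [Category.assoc, b.inj_proj_ne i j hi, comp_zero]
    · intro h
      exact absurd (Finset.mem_univ j) h

theorem finrank_hom (k : Type w) [Field k] [Linear k D] [∀ X Y : D, FiniteDimensional k (X ⟶ Y)]
    (b : SumDecomp Z S) (T : D) :
    Module.finrank k (T ⟶ Z) = ∑ j, Module.finrank k (T ⟶ S j) := by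
  rw [(b.homEquiv k T).finrank_eq, Module.finrank_pi_fintype]

end SumDecomp

/-- A category in which every object is a finite direct sum of simple objects. -/
class IsSemisimpleCat (D : Type u) [Category.{v} D] [Preadditive D] : Prop where
  decomp : ∀ X : D, ∃ (J : Type) (_ : Fintype J) (S : J → D), (∀ j, Simple (S j)) ∧
    Nonempty (SumDecomp X S)

/-! ### Semisimplicity criteria that need only kernels and split monomorphisms -/

section Semisimple

variable {D : Type u} [Category.{v} D] [Preadditive D]

theorem eq_zero_of_simple [IsSemisimpleCat D] {X Z : D} (a : X ⟶ Z)
    (h : ∀ (T : D) [Simple T] (f : T ⟶ X), f ≫ a = 0) : a = 0 := by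
  obtain ⟨J, _, S, hS, ⟨b⟩⟩ := IsSemisimpleCat.decomp X
  exact b.eq_zero_of_inj a fun j => by
    have := hS j
    exact h (S j) _

theorem exists_simple_hom_ne_zero [IsSemisimpleCat D] {X : D} (h : 𝟙 X ≠ 0) :
    ∃ (T : D) (_ : Simple T) (f : T ⟶ X), f ≠ 0 := by
  by_contra! hc
  exact h (eq_zero_of_simple _ fun T _ f => by rw [hc T inferInstance f, zero_comp])

theorem hom_simple_eq_zero [HasKernels D] {X Y : D} [Simple X] [Simple Y] (f : X ⟶ Y)
    (h : ¬ Nonempty (X ≅ Y)) : f = 0 := by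
  by_contra hf
  have := isIso_of_hom_simple hf
  exact h ⟨asIso f⟩

/-- If all maps from simple objects other than `Y` to `Z` vanish, morphisms to `Z` are detected by
maps from `Y`. -/
theorem eq_zero_of_hom_from [IsSemisimpleCat D] {X Y Z : D} (a : X ⟶ Z)
    (hZ : ∀ (T : D) [Simple T], ¬ Nonempty (T ≅ Y) → ∀ f : T ⟶ Z, f = 0)
    (h : ∀ f : Y ⟶ X, f ≫ a = 0) : a = 0 := by
  refine eq_zero_of_simple a fun T _ f => ?_
  by_cases hT : Nonempty (T ≅ Y)
  · obtain ⟨e⟩ := hT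
    rw [← cancel_epi e.inv, ← Category.assoc, h, comp_zero]
  · exact hZ T hT _

/-- The map `e ↦ r ≫ e ≫ i` embeds `End A` into `End X`, and its image misses the identity when the
retract is proper. The dimension of the endomorphism algebra is thus a measure for splitting an
object into simple ones. -/
theorem finrank_end_lt (k : Type w) [Field k] [Linear k D] {A X : D}
    [FiniteDimensional k (X ⟶ X)] (i : A ⟶ X) (r : X ⟶ A) (h : i ≫ r = 𝟙 A) (h' : r ≫ i ≠ 𝟙 X) :
    Module.finrank k (A ⟶ A) < Module.finrank k (X ⟶ X) := by
  let φ : (A ⟶ A) →ₗ[k] (X ⟶ X) := Linear.leftComp k X r ∘ₗ Linear.rightComp k A i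
  have hφ : ∀ e, φ e = r ≫ e ≫ i := fun _ => rfl
  have inj : Function.Injective φ := by
    intro a b hab
    have := congrArg (fun t => i ≫ t ≫ r) hab
    simpa only [hφ, Category.assoc, h, reassoc_of% h, Category.comp_id] using this
  rw [← LinearMap.finrank_range_of_inj inj]
  refine Submodule.finrank_lt fun htop => h' ?_
  obtain ⟨e, he⟩ : 𝟙 X ∈ LinearMap.range φ := htop ▸ Submodule.mem_top
  rw [← Category.comp_id (r ≫ i), ← he, hφ, Category.assoc, reassoc_of% h]

/-- A linear category with kernels and finite dimensional Hom spaces in which monomorphisms split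
is semisimple. -/
theorem isSemisimpleCat_of_split (k : Type w) [Field k] [Linear k D] [HasKernels D]
    [∀ X Y : D, FiniteDimensional k (X ⟶ Y)]
    (hs : ∀ {A X : D} (f : A ⟶ X) [Mono f], ∃ r : X ⟶ A, f ≫ r = 𝟙 A) : IsSemisimpleCat D := by
  -- Induction on a bound for `dim End X`: a nonzero non-simple object splits into two proper
  -- retracts, both with smaller endomorphism algebras.
  have key : ∀ (n : ℕ) (X : D), Module.finrank k (X ⟶ X) < n →
      ∃ (J : Type) (_ : Fintype J) (S : J → D), (∀ j, Simple (S j)) ∧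
        Nonempty (SumDecomp X S) := by
    intro n
    induction n with
    | zero => intro X h; exact absurd h (Nat.not_lt_zero _)
    | succ n ih =>
      intro X hX
      by_cases h0 : 𝟙 X = 0
      · exact ⟨Empty, inferInstance, fun e => e.elim, fun e => e.elim,
          ⟨⟨fun e => e.elim, fun e => e.elim, fun e => e.elim, fun e => e.elim, by simp [h0]⟩⟩⟩
      by_cases hsim : Simple X
      · exact ⟨Fin 1, inferInstance, fun _ => X, fun _ => hsim, ⟨SumDecomp.ofUnique (Iso.refl X)⟩⟩
      have : ∃ (A : D) (f : A ⟶ X), Mono f ∧ f ≠ 0 ∧ ¬ IsIso f := by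
        by_contra! hc
        refine hsim ⟨fun {A} f _ => ⟨fun hi hf => h0 ?_, fun hf => hc A f inferInstance hf⟩⟩
        rw [← cancel_epi f, hf, zero_comp, zero_comp]
      obtain ⟨A, f, _, hf0, hfi⟩ := this
      obtain ⟨r, hr⟩ := hs f
      -- The idempotent complementary to `r ≫ f` factors through `kernel r`, which is therefore the
      -- complement of `A`.
      have hp : (𝟙 X - r ≫ f) ≫ r = 0 := by
        rw [Preadditive.sub_comp, Category.assoc, hr]; simp
      have h1 : kernel.ι r ≫ kernel.lift r _ hp = 𝟙 _ := by
        rw [← cancel_mono (kernel.ι r), Category.assoc, kernel.lift_ι]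
        simp [Preadditive.comp_sub]
      have hrf : r ≫ f ≠ 𝟙 X := fun e => hfi ⟨r, hr, e⟩
      have hlt : Module.finrank k (A ⟶ A) < n :=
        (finrank_end_lt k f r hr hrf).trans_le (Nat.lt_succ_iff.1 hX)
      have hlt' : Module.finrank k (kernel r ⟶ kernel r) < n := by
        refine (finrank_end_lt k (kernel.ι r) (kernel.lift r _ hp) h1 ?_).trans_le
          (Nat.lt_succ_iff.1 hX)
        rw [kernel.lift_ι]
        intro e
        refine hf0 ?_
        have : r ≫ f = 0 := by simpa using e
        rw [← Category.id_comp f, ← hr, Category.assoc, this, comp_zero]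
      obtain ⟨I, _, S, hS, ⟨a⟩⟩ := ih A hlt
      obtain ⟨J, _, T, hT, ⟨b⟩⟩ := ih (kernel r) hlt'
      refine ⟨I ⊕ J, inferInstance, Sum.elim S T, ?_,
        ⟨a.glue b f r (kernel.ι r) (kernel.lift r _ hp) hr h1 ?_ (kernel.condition r) ?_⟩⟩
      · rintro (i | j)
        exacts [hS i, hT j]
      · rw [← cancel_mono (kernel.ι r), Category.assoc, kernel.lift_ι, Preadditive.comp_sub,
          reassoc_of% hr]
        simp
      · rw [kernel.lift_ι]; abel
  exact ⟨fun X => key _ X (Nat.lt_succ_self _)⟩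

end Semisimple

/-! ### Splitting of epimorphisms and monomorphisms in a semisimple abelian category -/

section Abelian

variable {k : Type w} [Field k] {C : Type u} [Category.{v} C] [Abelian C] [Linear k C]

theorem IsFiniteSemisimple.isSemisimpleCat (k : Type w) [Field k] (C : Type u) [Category.{v} C]
    [Abelian C] [Linear k C] [IsFiniteSemisimple k C] : IsSemisimpleCat C where
  decomp X := by
    obtain ⟨n, S, hS, ⟨e⟩⟩ := IsFiniteSemisimple.semisimple (k := k) X
    exact ⟨Fin n, inferInstance, S, hS, ⟨(SumDecomp.biproduct S).ofIso e⟩⟩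

variable [IsSemisimpleCat C]

/-- Some simple summand of `E` maps nontrivially to `T`, hence isomorphically by Schur's lemma; its
inverse gives the section. -/
theorem exists_section_of_simple {E T : C} [Simple T] (e : E ⟶ T) [Epi e] :
    ∃ s : T ⟶ E, s ≫ e = 𝟙 T := by
  have he : e ≠ 0 := by
    rintro rfl
    have : 𝟙 T = 0 := by rw [← cancel_epi (0 : E ⟶ T)]; simp
    exact id_nonzero T this
  obtain ⟨J, _, S, hS, ⟨b⟩⟩ := IsSemisimpleCat.decomp E
  have : ∃ j, b.inj j ≫ e ≠ 0 := by
    by_contra! hc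
    exact he (b.eq_zero_of_inj e hc)
  obtain ⟨j, hj⟩ := this
  have := hS j
  have := isIso_of_hom_simple hj
  exact ⟨inv (b.inj j ≫ e) ≫ b.inj j, by rw [Category.assoc, IsIso.inv_hom_id]⟩

/-- Pulling `e` back along the inclusion of each simple summand of `Z` reduces to a simple target,
and the resulting lifts are added up. -/
theorem exists_section {E Z : C} (e : E ⟶ Z) [Epi e] : ∃ s : Z ⟶ E, s ≫ e = 𝟙 Z := by
  obtain ⟨J, _, S, hS, ⟨b⟩⟩ := IsSemisimpleCat.decomp Z
  have : ∀ j, ∃ t : S j ⟶ E, t ≫ e = b.inj j := by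
    intro j
    have := hS j
    obtain ⟨s, hs⟩ := exists_section_of_simple (pullback.snd e (b.inj j))
    exact ⟨s ≫ pullback.fst e (b.inj j), by
      rw [Category.assoc, pullback.condition, reassoc_of% hs]⟩
  choose t ht using this
  refine ⟨∑ j, b.proj j ≫ t j, ?_⟩
  rw [Preadditive.sum_comp, ← b.total]
  exact Finset.sum_congr rfl fun j _ => by rw [Category.assoc, ht]

/-- Monomorphisms in a semisimple abelian category split. -/
theorem exists_retraction {A X : C} (f : A ⟶ X) [Mono f] : ∃ r : X ⟶ A, f ≫ r = 𝟙 A := by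
  obtain ⟨s, hs⟩ := exists_section (cokernel.π f)
  have hp : (𝟙 X - cokernel.π f ≫ s) ≫ cokernel.π f = 0 := by
    rw [Preadditive.sub_comp, Category.assoc, hs]; simp
  -- A section of the cokernel map gives an idempotent of `X` killed by the cokernel, so it factors
  -- through `f`; the factorization is the retraction.
  refine ⟨Abelian.monoLift f _ hp, ?_⟩
  rw [← cancel_mono f, Category.assoc, Abelian.monoLift_comp]
  simp [Preadditive.comp_sub]

end Abelian

/-! ### Kernels and Maschke's theorem for equivariant objects -/

namespace EqObj

variable {k : Type w} [Field k] {G : Type x} [Group G] {C : Type u} [Category.{v} C]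
  [Preadditive C] [Linear k C] {ρ : GAction k G C}

instance : (forget ρ).Additive where
  map_add := rfl

instance : (forget ρ).Linear k where
  map_smul _ _ := rfl

@[simp] theorem comp_val {M N P : EqObj ρ} (f : M ⟶ N) (f' : N ⟶ P) : (f ≫ f').1 = f.1 ≫ f'.1 := rfl

@[simp] theorem id_val (M : EqObj ρ) : (𝟙 M : M ⟶ M).1 = 𝟙 M.obj := rfl

theorem hom_ext {M N : EqObj ρ} {f f' : M ⟶ N} (h : f.1 = f'.1) : f = f' := Subtype.ext h

instance finite_hom [∀ X Y : C, FiniteDimensional k (X ⟶ Y)] (M N : EqObj ρ) :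
    FiniteDimensional k (M ⟶ N) :=
  inferInstanceAs (FiniteDimensional k (homSubmodule M N))

/-- An equivariant structure on a subobject stable under the structure maps. -/
def ofMono (M : EqObj ρ) {K : C} (i : K ⟶ M.obj) [Mono i] (act : ∀ g, (ρ.fn g).obj K ⟶ K)
    (h : ∀ g, act g ≫ i = (ρ.fn g).map i ≫ M.act g) : EqObj ρ :=
  have mul : ∀ g g' : G, (ρ.fn g).map (act g') ≫ act g =
      (ρ.comp g g' _ rfl).hom.app K ≫ act (g * g') := fun g g' => by
    have nat : (ρ.fn g).map ((ρ.fn g').map i) ≫ (ρ.comp g g' _ rfl).hom.app M.obj =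
        (ρ.comp g g' _ rfl).hom.app K ≫ (ρ.fn (g * g')).map i :=
      (ρ.comp g g' _ rfl).hom.naturality i
    rw [← cancel_mono i, Category.assoc, Category.assoc, h, h, ← Category.assoc, ← Functor.map_comp,
      h, Functor.map_comp, Category.assoc, M.act_mul, reassoc_of% nat]
  have one : ρ.unit.hom.app K ≫ act 1 = 𝟙 K := by
    have nat : i ≫ ρ.unit.hom.app M.obj = ρ.unit.hom.app K ≫ (ρ.fn 1).map i :=
      ρ.unit.hom.naturality i
    rw [← cancel_mono i, Category.assoc, h, ← reassoc_of% nat, M.act_one]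
    simp
  { obj := K
    act := act
    isIso_act := isIso_of_laws ρ K act mul one
    act_mul := mul
    act_one := one }

/-- A factorization, in the underlying category, of an equivariant morphism through an equivariant
monomorphism is equivariant. -/
def lift {K M W : EqObj ρ} (i : K ⟶ M) [Mono i.1] (t : W ⟶ M) (l : W.obj ⟶ K.obj)
    (h : l ≫ i.1 = t.1) : W ⟶ K :=
  ⟨l, fun g => by
    rw [← cancel_mono i.1, Category.assoc, h, Category.assoc, i.2 g, ← Category.assoc,
      ← Functor.map_comp, h, t.2 g]⟩

section Kernel

variable [HasKernels C] {M N : EqObj ρ} (f : M ⟶ N)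

/-- The kernel of a morphism of equivariant objects. -/
def ker : EqObj ρ :=
  M.ofMono (kernel.ι f.1)
    (fun g => kernel.lift f.1 ((ρ.fn g).map (kernel.ι f.1) ≫ M.act g) (by
      rw [Category.assoc, f.2 g, ← Category.assoc, ← Functor.map_comp, kernel.condition,
        Functor.map_zero, zero_comp]))
    (fun g => kernel.lift_ι _ _ _)

/-- The inclusion of the kernel. -/
def kerι : ker f ⟶ M := ⟨kernel.ι f.1, fun _ => kernel.lift_ι _ _ _⟩

instance : Mono (kerι f).1 := inferInstanceAs (Mono (kernel.ι f.1))

theorem kerι_comp : kerι f ≫ f = 0 := hom_ext (kernel.condition f.1)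

instance : HasKernels (EqObj ρ) where
  has_limit f := HasLimit.mk
    { cone := KernelFork.ofι (kerι f) (kerι_comp f)
      isLimit := KernelFork.IsLimit.ofι (kerι f) (kerι_comp f)
        (fun t ht => lift (kerι f) t (kernel.lift f.1 t.1 (congrArg Subtype.val ht))
          (kernel.lift_ι _ _ _))
        (fun _ _ => hom_ext (kernel.lift_ι _ _ _))
        (fun t _ _ hm => hom_ext ((cancel_mono (kerι f).1).1
          ((congrArg Subtype.val hm).trans (kernel.lift_ι f.1 t.1 _).symm))) }

/-- Kernels of equivariant morphisms are computed in `C`, so the forgetful functor preserves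
monomorphisms. -/
instance mono_val [Mono f] : Mono f.1 := by
  refine Preadditive.mono_of_kernel_zero ?_
  have h : kerι f = 0 := by rw [← cancel_mono f, kerι_comp, zero_comp]
  exact congrArg Subtype.val h

end Kernel

section Maschke

theorem map_act_inv (M : EqObj ρ) (g h : G) :
    haveI := M.isIso_act g
    haveI := M.isIso_act (g * h)
    haveI := M.isIso_act h
    (ρ.fn g).map (inv (M.act h)) ≫ (ρ.comp g h _ rfl).hom.app M.obj ≫ M.act (g * h) = M.act g := by
  have := M.isIso_act h
  rw [← M.act_mul, ← Category.assoc, ← Functor.map_comp, IsIso.inv_hom_id]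
  simp

/-- The conjugate of a morphism between underlying objects by a group element. -/
def conj (M N : EqObj ρ) (g : G) (r : M.obj ⟶ N.obj) : M.obj ⟶ N.obj :=
  haveI := M.isIso_act g
  inv (M.act g) ≫ (ρ.fn g).map r ≫ N.act g

/-- The structure maps carry the conjugate by `h` to the conjugate by `g * h`. Summation over the
group is then invariant under the shift, which makes `average` equivariant. -/
theorem act_conj (M N : EqObj ρ) (g h : G) (r : M.obj ⟶ N.obj) :
    M.act g ≫ conj M N (g * h) r = (ρ.fn g).map (conj M N h r) ≫ N.act g := by
  have := M.isIso_act h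
  have := M.isIso_act (g * h)
  have nat : (ρ.fn g).map ((ρ.fn h).map r) ≫ (ρ.comp g h _ rfl).hom.app N.obj =
      (ρ.comp g h _ rfl).hom.app M.obj ≫ (ρ.fn (g * h)).map r :=
    (ρ.comp g h _ rfl).hom.naturality r
  have h1 := map_act_inv M g h
  unfold conj
  rw [← h1, Functor.map_comp, Functor.map_comp, Category.assoc, Category.assoc, Category.assoc,
    Category.assoc, N.act_mul, reassoc_of% nat, IsIso.hom_inv_id_assoc]

variable [Finite G]

/-- The average of a morphism over the group. -/
def average (M N : EqObj ρ) (r : M.obj ⟶ N.obj) : M ⟶ N :=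
  letI := Fintype.ofFinite G
  ⟨(Nat.card G : k)⁻¹ • ∑ g, conj M N g r, fun g => by
    rw [Linear.comp_smul, Functor.map_smul, Linear.smul_comp, Preadditive.comp_sum,
      Functor.map_sum, Preadditive.sum_comp]
    congr 1
    rw [← Equiv.sum_comp (Equiv.mulLeft g)]
    exact Finset.sum_congr rfl fun h _ => act_conj M N g h r⟩

/-- As `f` and `t` are equivariant, each conjugate of `r` still satisfies `f ≫ r = t`, so the mean
of the conjugates does too; characteristic `0` allows division by the group order. For `t` the
identity, a retraction in `C` becomes an equivariant one. -/
theorem comp_average {A M N : EqObj ρ} (f : A ⟶ M) (r : M.obj ⟶ N.obj) (t : A ⟶ N)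
    (h : f.1 ≫ r = t.1) [CharZero k] : f ≫ average M N r = t := by
  have key : ∀ g, f.1 ≫ conj M N g r = t.1 := by
    intro g
    have := M.isIso_act g
    have := A.isIso_act g
    have hf : f.1 ≫ inv (M.act g) = inv (A.act g) ≫ (ρ.fn g).map f.1 := by
      rw [IsIso.comp_inv_eq, Category.assoc, ← f.2 g, IsIso.inv_hom_id_assoc]
    unfold conj
    rw [reassoc_of% hf, ← Category.assoc ((ρ.fn g).map f.1), ← Functor.map_comp, h, ← t.2 g,
      IsIso.inv_hom_id_assoc]
  let := Fintype.ofFinite G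
  refine hom_ext ?_
  change f.1 ≫ ((Nat.card G : k)⁻¹ • ∑ g, conj M N g r) = t.1
  rw [Linear.comp_smul, Preadditive.comp_sum, Finset.sum_congr rfl fun g _ => key g,
    Finset.sum_const, ← Nat.cast_smul_eq_nsmul k, smul_smul, Finset.card_univ,
    ← Nat.card_eq_fintype_card, inv_mul_cancel₀, one_smul]
  exact Nat.cast_ne_zero.2 Nat.card_pos.ne'

end Maschke

end EqObj

section

variable {k : Type w} [Field k] [CharZero k] {G : Type x} [Group G] [Finite G] {C : Type u}
  [Category.{v} C] [Abelian C] [Linear k C] [IsSemisimpleCat C] {ρ : GAction k G C}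

/-- Maschke's theorem: monomorphisms of equivariant objects split. -/
theorem EqObj.exists_retraction {A M : EqObj ρ} (f : A ⟶ M) [Mono f] :
    ∃ r : M ⟶ A, f ≫ r = 𝟙 A := by
  obtain ⟨r, hr⟩ := EquivClifford.exists_retraction f.1
  exact ⟨EqObj.average M A r, EqObj.comp_average f r (𝟙 A) hr⟩

instance EqObj.isSemisimpleCat [∀ X Y : C, FiniteDimensional k (X ⟶ Y)] :
    IsSemisimpleCat (EqObj ρ) :=
  isSemisimpleCat_of_split k fun f _ => EqObj.exists_retraction f

end

/-! ### The universal property of `V ⊗ Y` -/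

section Copower

variable {k : Type w} [Field k] {C : Type u} [Category.{v} C] [Abelian C] [Linear k C]
  {V : Type v'} [AddCommGroup V] [Module k V] [FiniteDimensional k V] {Y : C}

/-- The morphism `V ⊗ Y ⟶ N` corresponding to a linear map `V → Hom(Y, N)`. -/
def copowerDesc {N : C} (φ : V →ₗ[k] (Y ⟶ N)) : copower k V Y ⟶ N :=
  biproduct.desc fun i => φ (Module.finBasis k V i)

variable (k Y) in
/-- The morphism `Y ⟶ V ⊗ Y` given by a vector of `V`. -/
def coev : V →ₗ[k] (Y ⟶ copower k V Y) where
  toFun z := biproduct.lift fun i => (Module.finBasis k V).repr z i • 𝟙 Y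
  map_add' z z' := by
    apply biproduct.hom_ext
    intro j
    simp [add_smul]
  map_smul' a z := by
    apply biproduct.hom_ext
    intro j
    simp [mul_smul]

theorem coev_π (z : V) (i : Fin (Module.finrank k V)) :
    coev k Y z ≫ biproduct.π (fun _ : Fin (Module.finrank k V) => Y) i =
      (Module.finBasis k V).repr z i • 𝟙 Y :=
  biproduct.lift_π _ _

theorem coev_basis (i : Fin (Module.finrank k V)) :
    coev k Y (Module.finBasis k V i) =
      biproduct.ι (fun _ : Fin (Module.finrank k V) => Y) i := by
  classical
  apply biproduct.hom_ext
  intro j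
  rw [coev_π, Module.Basis.repr_self, Finsupp.single_apply]
  by_cases h : i = j
  · subst h
    simp
  · rw [if_neg h, zero_smul, biproduct.ι_π_ne _ h]

theorem coev_eq_sum (z : V) : coev k Y z = ∑ i, (Module.finBasis k V).repr z i •
    biproduct.ι (fun _ : Fin (Module.finrank k V) => Y) i := by
  conv_lhs => rw [← (Module.finBasis k V).sum_repr z, map_sum]
  exact Finset.sum_congr rfl fun i _ => by rw [map_smul, coev_basis]

@[simp] theorem coev_copowerDesc {N : C} (φ : V →ₗ[k] (Y ⟶ N)) (z : V) :
    coev k Y z ≫ copowerDesc φ = φ z := by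
  rw [coev_eq_sum, Preadditive.sum_comp]
  conv_rhs => rw [← (Module.finBasis k V).sum_repr z, map_sum]
  exact Finset.sum_congr rfl fun i _ => by
    rw [Linear.smul_comp, map_smul, copowerDesc, biproduct.ι_desc]

/-- The basis-free form of `A ⊗ f`: the copy of `F Y` labelled by `z` goes to the copy of `Z`
labelled by `A z`. Below, it replaces computations with matrix entries. -/
theorem map_coev_copowerMap (F : C ⥤ C) [F.Additive] [F.Linear k] {W : Type u'} [AddCommGroup W]
    [Module k W] [FiniteDimensional k W] (A : V →ₗ[k] W) {Z : C} (f : F.obj Y ⟶ Z) (z : V) :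
    F.map (coev k Y z) ≫ copowerMap F A f = f ≫ coev k Z (A z) := by
  apply biproduct.hom_ext
  intro j
  rw [Category.assoc, Category.assoc, coev_π, Linear.comp_smul, Category.comp_id, coev_eq_sum,
    Functor.map_sum, Preadditive.sum_comp,
    ← LinearMap.toMatrix_mulVec_repr (Module.finBasis k V) (Module.finBasis k W), Matrix.mulVec,
    dotProduct, Finset.sum_smul]
  refine Finset.sum_congr rfl fun i _ => ?_
  rw [Functor.map_smul, Linear.smul_comp, copowerMap, map_ι_mapDesc_assoc, biproduct.lift_π,
    smul_smul, mul_comm]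

theorem map_copower_hom_ext (F : C ⥤ C) [F.Additive] {Z : C} {a b : F.obj (copower k V Y) ⟶ Z}
    (h : ∀ z : V, F.map (coev k Y z) ≫ a = F.map (coev k Y z) ≫ b) : a = b := by
  apply map_sum_hom_ext F
  intro i
  rw [← coev_basis]
  exact h _

/-- Reduces a commuting square on `V ⊗ Y` to an identity for each vector. This is how intertwiners
become equivariant morphisms. -/
theorem copowerMap_copowerDesc (F : C ⥤ C) [F.Additive] [F.Linear k] {W : Type u'}
    [AddCommGroup W] [Module k W] [FiniteDimensional k W] (A : V →ₗ[k] W) {Z N N' : C}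
    (f : F.obj Y ⟶ Z) (ψ : W →ₗ[k] (Z ⟶ N')) (φ : V →ₗ[k] (Y ⟶ N)) (a : F.obj N ⟶ N')
    (h : ∀ z, f ≫ ψ (A z) = F.map (φ z) ≫ a) :
    copowerMap F A f ≫ copowerDesc ψ = F.map (copowerDesc φ) ≫ a := by
  apply map_copower_hom_ext (k := k) F
  intro z
  have h1 := map_coev_copowerMap F A f z
  rw [reassoc_of% h1, coev_copowerDesc, ← Category.assoc, ← Functor.map_comp, coev_copowerDesc, h]

theorem coev_injective [Simple Y] : Function.Injective (coev k Y : V →ₗ[k] _) := by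
  rw [← LinearMap.ker_eq_bot, LinearMap.ker_eq_bot']
  intro z hz
  refine (Module.finBasis k V).ext_elem fun i => ?_
  have h1 := coev_π (k := k) (Y := Y) z i
  rw [hz, zero_comp] at h1
  have := (smul_eq_zero.1 h1.symm).resolve_right (id_nonzero Y)
  rw [this, map_zero, Finsupp.zero_apply]

variable [IsAlgClosed k] [∀ X Y : C, FiniteDimensional k (X ⟶ Y)]

/-- Over an algebraically closed field `End Y` consists of scalars, so each component of `f` is a
coordinate of a vector. -/
theorem coev_surjective [Simple Y] : Function.Surjective (coev k Y : V →ₗ[k] _) := by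
  intro f
  choose a ha using fun i => endomorphism_simple_eq_smul_id k
    (f ≫ biproduct.π (fun _ : Fin (Module.finrank k V) => Y) i)
  refine ⟨∑ i, a i • Module.finBasis k V i, ?_⟩
  apply biproduct.hom_ext
  intro j
  rw [coev_π, Module.Basis.repr_sum_self, ha]

variable (k V Y) in
/-- `V ≅ Hom(Y, V ⊗ Y)` for a simple object `Y`. -/
def coevEquiv [Simple Y] : V ≃ₗ[k] (Y ⟶ copower k V Y) :=
  LinearEquiv.ofBijective (coev k Y) ⟨coev_injective, coev_surjective⟩

end Copower

/-- An object all of whose simple constituents are isomorphic to `Y`. -/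
def IsIsotypic {C : Type u} [Category.{v} C] [Preadditive C] (Y N : C) : Prop :=
  ∀ (T : C) [Simple T], ¬ Nonempty (T ≅ Y) → ∀ f : T ⟶ N, f = 0

section Isotypic

variable {C : Type u} [Category.{v} C] [Preadditive C]

theorem IsIsotypic.of_iso {Y N N' : C} (h : IsIsotypic Y N) (e : N' ≅ N) : IsIsotypic Y N' :=
  fun T _ hT _ => (cancel_mono e.hom).1 ((h T hT _).trans zero_comp.symm)

theorem isIsotypic_copower {k : Type w} [Field k] {C : Type u} [Category.{v} C] [Abelian C]
    [Linear k C] (V : Type v') [AddCommGroup V] [Module k V] [FiniteDimensional k V] (Y : C)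
    [Simple Y] : IsIsotypic Y (copower k V Y) := by
  intro T _ hT f
  apply biproduct.hom_ext
  intro j
  rw [zero_comp]
  exact hom_simple_eq_zero _ hT

theorem IsIsotypic.eq_zero_of_to [IsSemisimpleCat C] {Y N X : C} (h : IsIsotypic Y N) (a : X ⟶ N)
    (ha : ∀ f : Y ⟶ X, f ≫ a = 0) : a = 0 :=
  eq_zero_of_hom_from a h ha

theorem IsIsotypic.eq_zero_of_from [IsSemisimpleCat C] {Y N X : C} (h : IsIsotypic Y N)
    (a : N ⟶ X) (ha : ∀ f : Y ⟶ N, f ≫ a = 0) : a = 0 := by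
  refine eq_zero_of_simple a fun T _ f => ?_
  by_cases hT : Nonempty (T ≅ Y)
  · obtain ⟨e⟩ := hT
    rw [← cancel_epi e.inv, ← Category.assoc, ha, comp_zero]
  · rw [h T hT f, zero_comp]

end Isotypic

/-! ### Equivariant objects controlled by `Hom(Y, -)` -/

section Detected

variable {k : Type w} [Field k] {H : Type x} [Group H] {C : Type u} [Category.{v} C]
  [Preadditive C] [Linear k C] {σ : GAction k H C}

/-- Equivariant morphisms from and to `M` are detected by `Hom(Y, -)`. -/
structure IsDetected (Y : C) (M : EqObj σ) : Prop where
  of_from {X : EqObj σ} (a : M ⟶ X) : (∀ f : Y ⟶ M.obj, f ≫ a.1 = 0) → a = 0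
  of_to {X : EqObj σ} (a : X ⟶ M) : (∀ f : Y ⟶ X.obj, f ≫ a.1 = 0) → a = 0

/-- A morphism killed by `F` has image in the part of `M` invisible to `Y`; morphisms to `M` being
detected by `Y`, it is zero. -/
theorem IsDetected.mono {Y : C} {M X : EqObj σ} (hM : IsDetected Y M) (F : M ⟶ X)
    (hF : ∀ f : Y ⟶ M.obj, f ≫ F.1 = 0 → f = 0) : Mono F := by
  refine Preadditive.mono_of_cancel_zero _ fun {K} a ha => hM.of_to a fun f => hF _ ?_
  rw [Category.assoc, ← EqObj.comp_val, ha]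
  exact comp_zero

end Detected

/-- The hypothesis `h` is irreducibility of `Hom(Y, M)` in terms of subobjects. A nonzero `K`
contains `Y` by detection, hence absorbs all of `Hom(Y, M)`. If `r` is an equivariant retraction of
`i`, then `𝟙 M - r ≫ i` vanishes on every map from `Y`, hence is zero by detection. -/
theorem IsDetected.simple {k : Type w} [Field k] [CharZero k] {H : Type x} [Group H] [Finite H]
    {C : Type u} [Category.{v} C] [Abelian C] [Linear k C] [IsSemisimpleCat C] {σ : GAction k H C}
    {Y : C} {M : EqObj σ} (hM : IsDetected Y M) [Nontrivial (Y ⟶ M.obj)]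
    (h : ∀ (K : EqObj σ) (i : K ⟶ M) [Mono i], (∃ f : Y ⟶ K.obj, f ≠ 0) →
      ∀ f : Y ⟶ M.obj, ∃ f' : Y ⟶ K.obj, f' ≫ i.1 = f) : Simple M := by
  refine ⟨fun {K} i _ => ⟨fun hi hi0 => ?_, fun hi => ?_⟩⟩
  · obtain ⟨f, hf⟩ := exists_ne (0 : Y ⟶ M.obj)
    have h1 : 𝟙 M = 0 := by rw [← cancel_epi i, hi0, zero_comp, zero_comp]
    refine hf ?_
    rw [← Category.comp_id f, ← EqObj.id_val, h1]
    exact comp_zero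
  · have h0 : ∃ f : Y ⟶ K.obj, f ≠ 0 := by
      by_contra! hc
      exact hi (hM.of_to i fun f => by rw [hc f, zero_comp])
    obtain ⟨r, hr⟩ := EqObj.exists_retraction i
    have h1 : 𝟙 M - r ≫ i = 0 := by
      refine hM.of_from _ fun f => ?_
      obtain ⟨f', rfl⟩ := h K i h0 f
      have h2 : i ≫ (𝟙 M - r ≫ i) = 0 := by
        rw [Preadditive.comp_sub, reassoc_of% hr]; simp
      rw [Category.assoc, ← EqObj.comp_val, h2]
      exact comp_zero
    exact ⟨r, hr, (sub_eq_zero.1 h1).symm⟩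

theorem isDetected_of_isIsotypic {k : Type w} [Field k] {H : Type x} [Group H] {C : Type u}
    [Category.{v} C] [Preadditive C] [Linear k C] [IsSemisimpleCat C] {σ : GAction k H C} {Y : C}
    {N : EqObj σ} (hN : IsIsotypic Y N.obj) : IsDetected Y N :=
  ⟨fun a ha => EqObj.hom_ext (hN.eq_zero_of_from a.1 ha),
    fun a ha => EqObj.hom_ext (hN.eq_zero_of_to a.1 ha)⟩

/-! ### Projective representations and equivariant objects -/

section Rep

variable {k : Type w} [Field k] {H : Type x} [Group H]

namespace ProjRep

variable {α : H → H → kˣ}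

theorem Isomorphic.symm {π : ProjRep.{w, v, x} k H α} {π' : ProjRep.{w, v', x} k H α}
    (h : π.Isomorphic π') : π'.Isomorphic π := by
  obtain ⟨φ, hφ⟩ := h
  refine ⟨φ.symm, fun g z => ?_⟩
  rw [LinearEquiv.symm_apply_eq, hφ, LinearEquiv.apply_symm_apply]

theorem Isomorphic.trans {π : ProjRep.{w, v, x} k H α} {π' : ProjRep.{w, v', x} k H α}
    {π'' : ProjRep.{w, u', x} k H α} (h : π.Isomorphic π') (h' : π'.Isomorphic π'') :
    π.Isomorphic π'' := by
  obtain ⟨φ, hφ⟩ := h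
  obtain ⟨ψ, hψ⟩ := h'
  refine ⟨φ.trans ψ, fun g z => ?_⟩
  rw [LinearEquiv.trans_apply, LinearEquiv.trans_apply, hφ, hψ]

theorem IsIrreducible.of_iso {π : ProjRep.{w, v, x} k H α} {π' : ProjRep.{w, v', x} k H α}
    (hπ : π.IsIrreducible) (h : π.Isomorphic π') : π'.IsIrreducible := by
  obtain ⟨φ, hφ⟩ := h
  have := hπ.1
  refine ⟨φ.symm.toEquiv.nontrivial, fun W hW => ?_⟩
  have h1 := hπ.2 (W.comap φ.toLinearMap) fun g z hz => by
    change φ (π.act g z) ∈ W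
    rw [hφ]
    exact hW g _ hz
  refine h1.imp (fun h => ?_) (fun h => ?_)
  · rw [eq_bot_iff]
    intro z hz
    have : φ.symm z ∈ W.comap φ.toLinearMap := by simpa using hz
    rw [h, Submodule.mem_bot] at this
    simpa using this
  · rw [eq_top_iff]
    intro z _
    have : φ.symm z ∈ W.comap φ.toLinearMap := h ▸ Submodule.mem_top
    simpa using this

/-- The restriction of a projective representation to an invariant subspace. -/
def sub (π : ProjRep.{w, v, x} k H α) (W : Submodule k π.V) (hW : ∀ g, ∀ z ∈ W, π.act g z ∈ W) :
    ProjRep.{w, v, x} k H α where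
  V := W
  act g := LinearEquiv.ofInjectiveEndo ((π.act g).toLinearMap.restrict (hW g)) (by
    intro a b h
    exact Subtype.ext ((π.act g).injective (congrArg Subtype.val h)))
  act_mul g h z := Subtype.ext (π.act_mul g h z)

/-- Transport of a projective representation along a linear isomorphism. -/
def transport (π : ProjRep.{w, v, x} k H α) {W : Type v'} [AddCommGroup W] [Module k W]
    [FiniteDimensional k W] (e : π.V ≃ₗ[k] W) : ProjRep.{w, v', x} k H α where
  V := W
  act g := (e.symm.trans (π.act g)).trans e
  act_mul g h z := by
    simp only [LinearEquiv.trans_apply, LinearEquiv.symm_apply_apply, π.act_mul, map_smul]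

theorem isomorphic_transport (π : ProjRep.{w, v, x} k H α) {W : Type v'} [AddCommGroup W]
    [Module k W] [FiniteDimensional k W] (e : π.V ≃ₗ[k] W) : π.Isomorphic (π.transport e) :=
  ⟨e, fun g z => congrArg (fun t => e (π.act g t)) (e.symm_apply_apply z).symm⟩

/-- Every projective representation is isomorphic to one on a space in the universe of `k`. -/
theorem exists_isomorphic (π : ProjRep.{w, v, x} k H α) :
    ∃ π' : ProjRep.{w, w, x} k H α, π.Isomorphic π' :=
  ⟨_, π.isomorphic_transport ((Module.finBasis k π.V).equivFun.trans
    (LinearEquiv.funCongrLeft k k (Equiv.ulift.{w} : ULift (Fin (Module.finrank k π.V)) ≃ _)))⟩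

end ProjRep

variable [IsAlgClosed k] {C : Type u} [Category.{v} C] [Abelian C] [Linear k C]
  [IsFiniteSemisimple k C] {σ : GAction k H C} {Y : C} [Simple Y] (c : StableIsos σ Y)

theorem homRep_act (N : EqObj σ) (h : H) (f : Y ⟶ N.obj) :
    (homRep Y c N).act h f = (c h).inv ≫ (σ.fn h).map f ≫ N.act h := rfl

theorem homRep_act_comp {N N' : EqObj σ} (a : N ⟶ N') (h : H) (f : Y ⟶ N.obj) :
    (homRep Y c N').act h (f ≫ a.1 : Y ⟶ N'.obj) =
      ((homRep Y c N).act h f : Y ⟶ N.obj) ≫ a.1 := by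
  rw [homRep_act, homRep_act, Functor.map_comp, Category.assoc, Category.assoc, Category.assoc,
    a.2 h]

theorem homRep_isomorphic {N N' : EqObj σ} (e : N ≅ N') :
    (homRep Y c N).Isomorphic (homRep Y c N') :=
  ⟨Linear.homCongr k (Iso.refl Y) ((EqObj.forget σ).mapIso e), fun g f => by
    have h1 : ∀ f : Y ⟶ N.obj,
        Linear.homCongr k (Iso.refl Y) ((EqObj.forget σ).mapIso e) f = f ≫ e.hom.1 :=
      fun f => congrArg (· ≫ e.hom.1) (Category.id_comp f)
    exact (h1 _).trans ((homRep_act_comp c e.hom g f).symm.trans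
      (congrArg ((homRep Y c N').act g) (h1 f).symm))⟩

/-- The isomorphism is `coev`, bijective by Schur's lemma; the `c g` in the structure of `π ⊗ Y`
cancels the inverse built into the action on `Hom(Y, -)`. -/
theorem isomorphic_homRep_repObj (π : ProjRep.{w, v', x} k H (factorSet σ Y c)) :
    π.Isomorphic (homRep Y c (repObj c π)) :=
  ⟨coevEquiv k π.V Y, fun g z => by
    refine Eq.symm ((homRep_act c (repObj c π) g (coev k Y z)).trans ?_)
    have h1 := map_coev_copowerMap (σ.fn g) (π.act g).toLinearMap (c g).hom z
    exact (congrArg _ h1).trans ((c g).inv_hom_id_assoc _)⟩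

/-- The equivariant morphism `π ⊗ Y ⟶ N` corresponding to an intertwiner `π → Hom(Y, N)`. -/
def repDesc (π : ProjRep.{w, v', x} k H (factorSet σ Y c)) {N : EqObj σ}
    (φ : π.V →ₗ[k] (Y ⟶ N.obj)) (hφ : ∀ g z, φ (π.act g z) = (homRep Y c N).act g (φ z)) :
    repObj c π ⟶ N :=
  ⟨copowerDesc φ, fun g => by
    refine copowerMap_copowerDesc (σ.fn g) (π.act g).toLinearMap (c g).hom φ φ (N.act g) fun z => ?_
    refine (congrArg _ (hφ g z)).trans ?_
    rw [homRep_act, Iso.hom_inv_id_assoc]⟩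

theorem coev_repDesc (π : ProjRep.{w, v', x} k H (factorSet σ Y c)) {N : EqObj σ}
    (φ : π.V →ₗ[k] (Y ⟶ N.obj)) (hφ : ∀ g z, φ (π.act g z) = (homRep Y c N).act g (φ z))
    (z : π.V) : coev k Y z ≫ (repDesc c π φ hφ).1 = φ z :=
  coev_copowerDesc φ z

theorem repDesc_injective (π : ProjRep.{w, v', x} k H (factorSet σ Y c)) {N : EqObj σ}
    (φ : π.V →ₗ[k] (Y ⟶ N.obj)) (hφ : ∀ g z, φ (π.act g z) = (homRep Y c N).act g (φ z))
    (hinj : Function.Injective φ) (f : Y ⟶ copower k π.V Y)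
    (hf : f ≫ (repDesc c π φ hφ).1 = 0) : f = 0 := by
  obtain ⟨z, rfl⟩ := coev_surjective (k := k) f
  rw [coev_repDesc] at hf
  rw [hinj (hf.trans (map_zero φ).symm), map_zero]

/-- A subobject of `M` meeting the `Y`-part of an object with irreducible `Hom(Y, M)` contains
the `Y`-part. -/
theorem homRep_lift_of_irreducible {M K : EqObj σ} (hM : (homRep Y c M).IsIrreducible)
    (i : K ⟶ M) [Mono i.1] (h : ∃ f : Y ⟶ K.obj, f ≠ 0) (f : Y ⟶ M.obj) :
    ∃ f' : Y ⟶ K.obj, f' ≫ i.1 = f := by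
  obtain ⟨f₀, hf₀⟩ := h
  let W : Submodule k (Y ⟶ M.obj) := LinearMap.range (Linear.rightComp k Y i.1)
  -- The image of `Hom(Y, K)` is an invariant subspace, because composition with an equivariant
  -- morphism is an intertwiner.
  have hW : W = ⊥ ∨ W = ⊤ := hM.2 W (by
    rintro g _ ⟨f, rfl⟩
    exact ⟨(homRep Y c K).act g f, (homRep_act_comp c i g f).symm⟩)
  have hW' : W = ⊤ := by
    refine hW.resolve_left fun hbot => hf₀ ?_
    have h1 : f₀ ≫ i.1 ∈ W := ⟨f₀, rfl⟩
    rw [hbot, Submodule.mem_bot] at h1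
    rw [← cancel_mono i.1, h1, zero_comp]
  exact (hW' ▸ Submodule.mem_top : f ∈ W)

/-- An isotypic object is detected by `Y`, so injectivity of `φ` makes the morphism mono; the vector
`z` makes it nonzero, and its target is simple. No irreducibility of `π` enters. -/
theorem isIso_repDesc (π : ProjRep.{w, v', x} k H (factorSet σ Y c)) {N : EqObj σ} [Simple N]
    (φ : π.V →ₗ[k] (Y ⟶ N.obj)) (hφ : ∀ g z, φ (π.act g z) = (homRep Y c N).act g (φ z))
    (hinj : Function.Injective φ) (z : π.V) (hz : z ≠ 0) : IsIso (repDesc c π φ hφ) := by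
  have := IsFiniteSemisimple.isSemisimpleCat k C
  have : Mono (repDesc c π φ hφ) :=
    (isDetected_of_isIsotypic (isIsotypic_copower π.V Y)).mono _
      (repDesc_injective c π φ hφ hinj)
  refine isIso_of_mono_of_nonzero fun h0 => hz (hinj ?_)
  rw [← coev_repDesc c π φ hφ z, h0, map_zero]
  exact comp_zero

variable [CharZero k] [Finite H]

theorem simple_repObj (π : ProjRep.{w, v', x} k H (factorSet σ Y c)) (hπ : π.IsIrreducible) :
    Simple (repObj c π) := by
  have := IsFiniteSemisimple.isSemisimpleCat k C
  have hirr := hπ.of_iso (isomorphic_homRep_repObj c π)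
  have : Nontrivial (Y ⟶ (repObj c π).obj) := hirr.1
  exact (isDetected_of_isIsotypic (isIsotypic_copower π.V Y)).simple fun K i _ h f =>
    homRep_lift_of_irreducible c hirr i h f

end Rep

/-! ### Frobenius reciprocity for relative induction -/

section Reciprocity

variable {k : Type w} [Field k] {G : Type x} [Group G] {C : Type u} [Category.{v} C]
  [Preadditive C] [Linear k C]

theorem EqObj.map_act_comp_act {ρ : GAction k G C} (M : EqObj ρ) (g h l : G) (e : g * h = l) :
    (ρ.fn g).map (M.act h) ≫ M.act g = (ρ.comp g h l e).hom.app M.obj ≫ M.act l := by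
  subst e
  exact M.act_mul g h

/-- The structure maps `ρ^t M ⟶ M` of a `G`-object turn the permutation of summands in an induced
object into the action on `M`. This gives the equivariance of the morphism `indDesc` out of an
induced object. -/
theorem indComp_comp_act (ρ : GAction k G C) (M : EqObj ρ) (g t s h : G) (e : s * h = g * t) :
    indComp ρ g t s h e (M.act h) ≫ M.act s = (ρ.fn g).map (M.act t) ≫ M.act g := by
  unfold indComp
  rw [Category.assoc, Category.assoc, M.map_act_comp_act s h _ e, Iso.inv_hom_id_app_assoc,
    M.map_act_comp_act g t _ rfl]

theorem isIso_indComp (ρ : GAction k G C) {X : C} (g t s h : G) (e : s * h = g * t)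
    (ν : (ρ.fn h).obj X ⟶ X) [IsIso ν] : IsIso (indComp ρ g t s h e ν) := by
  unfold indComp
  infer_instance

/-- The trivial coset need not be represented by `1`. Its summand in `L N` is `ρ^b N` for some `b`
in `H`, identified with `N` only through the structure map of `b`. -/
theorem Transversal.rep_one_mem {H : Subgroup G} (r : Transversal H) :
    r.rep ((1 : G) : G ⧸ H) ∈ H := by
  have h := QuotientGroup.eq.1 (r.rep_spec ((1 : G) : G ⧸ H)).symm
  simpa using h

variable [HasFiniteBiproducts C] [Finite G] (ρ : GAction k G C) {H : Subgroup G}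
  (r : Transversal H)

/-- The structure map is a monomial matrix over the permutation `q ↦ g • q`, so its rows have one
nonzero entry just as its columns do. -/
theorem indAct_π (N : EqObj (ρ.restrict H)) (g : G) (q : G ⧸ H) :
    indAct ρ r N g ≫ biproduct.π (fun q : G ⧸ H => (ρ.fn (r.rep q)).obj N.obj) (g • q) =
      (ρ.fn g).map (biproduct.π (fun q : G ⧸ H => (ρ.fn (r.rep q)).obj N.obj) q) ≫
        indComp ρ g (r.rep q) (r.rep (g • q)) (r.cocyc g q) (r.rep_mul_cocyc g q)
          (N.act (r.cocyc g q)) := by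
  apply map_sum_hom_ext (ρ.fn g)
  intro q'
  have h1 := indAct_ι ρ r N g q' (g • q') rfl _ (r.rep_mul_cocyc g q')
  rw [reassoc_of% h1, ← Category.assoc ((ρ.fn g).map _), ← Functor.map_comp]
  by_cases h : q' = q
  · subst h
    rw [biproduct.ι_π_self, biproduct.ι_π_self]
    simp
  · rw [biproduct.ι_π_ne _ h, biproduct.ι_π_ne _ (fun e => h (MulAction.injective g e))]
    simp

/-- The inclusion of a summand of the induced object. -/
def relIndι (N : EqObj (ρ.restrict H)) (q : G ⧸ H) :
    (ρ.fn (r.rep q)).obj N.obj ⟶ ((relInd ρ r).obj N).obj :=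
  biproduct.ι (fun q : G ⧸ H => (ρ.fn (r.rep q)).obj N.obj) q

/-- The projection of the induced object to a summand. -/
def relIndπ (N : EqObj (ρ.restrict H)) (q : G ⧸ H) :
    ((relInd ρ r).obj N).obj ⟶ (ρ.fn (r.rep q)).obj N.obj :=
  biproduct.π (fun q : G ⧸ H => (ρ.fn (r.rep q)).obj N.obj) q

variable {ρ r} in
theorem relInd_hom_ext_ι {N : EqObj (ρ.restrict H)} {Z : C}
    {a b : ((relInd ρ r).obj N).obj ⟶ Z} (h : ∀ q, relIndι ρ r N q ≫ a = relIndι ρ r N q ≫ b) :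
    a = b :=
  biproduct.hom_ext' _ _ h

variable {ρ r} in
theorem relInd_hom_ext_π {N : EqObj (ρ.restrict H)} {Z : C}
    {a b : Z ⟶ ((relInd ρ r).obj N).obj} (h : ∀ q, a ≫ relIndπ ρ r N q = b ≫ relIndπ ρ r N q) :
    a = b :=
  biproduct.hom_ext _ _ h

theorem relIndι_π_self (N : EqObj (ρ.restrict H)) (q : G ⧸ H) :
    relIndι ρ r N q ≫ relIndπ ρ r N q = 𝟙 _ :=
  biproduct.ι_π_self _ _

theorem map_relIndι_act (N : EqObj (ρ.restrict H)) (g : G) (q q' : G ⧸ H) (hq : g • q = q') (h : H)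
    (e : r.rep q' * h = g * r.rep q) :
    (ρ.fn g).map (relIndι ρ r N q) ≫ ((relInd ρ r).obj N).act g =
      indComp ρ g (r.rep q) (r.rep q') h e (N.act h) ≫ relIndι ρ r N q' :=
  indAct_ι ρ r N g q q' hq h e

theorem act_relIndπ (N : EqObj (ρ.restrict H)) (g : G) (q : G ⧸ H) :
    ((relInd ρ r).obj N).act g ≫ relIndπ ρ r N (g • q) = (ρ.fn g).map (relIndπ ρ r N q) ≫
      indComp ρ g (r.rep q) (r.rep (g • q)) (r.cocyc g q) (r.rep_mul_cocyc g q)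
        (N.act (r.cocyc g q)) :=
  indAct_π ρ r N g q

/-- The group permutes the summands transitively through isomorphisms, so equivariance spreads the
vanishing on one summand to all. -/
theorem relInd_hom_eq_zero_of_ι {N : EqObj (ρ.restrict H)} {X : EqObj ρ}
    (a : (relInd ρ r).obj N ⟶ X) (q₀ : G ⧸ H) (h : relIndι ρ r N q₀ ≫ a.1 = 0) : a = 0 := by
  refine EqObj.hom_ext (relInd_hom_ext_ι fun q => ?_)
  obtain ⟨g, rfl⟩ := MulAction.exists_smul_eq G q₀ q
  have h1 := map_relIndι_act ρ r N g q₀ (g • q₀) rfl _ (r.rep_mul_cocyc g q₀)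
  have := N.isIso_act (r.cocyc g q₀)
  have := isIso_indComp ρ g _ _ _ (r.rep_mul_cocyc g q₀) (N.act (r.cocyc g q₀))
  refine Eq.trans ?_ comp_zero.symm
  rw [← cancel_epi (indComp ρ g _ _ _ (r.rep_mul_cocyc g q₀) (N.act (r.cocyc g q₀))),
    ← reassoc_of% h1, a.2 g, ← Category.assoc, ← Functor.map_comp, h, Functor.map_zero, zero_comp,
    comp_zero]

theorem relInd_hom_eq_zero_of_π {N : EqObj (ρ.restrict H)} {X : EqObj ρ}
    (a : X ⟶ (relInd ρ r).obj N) (q₀ : G ⧸ H) (h : a.1 ≫ relIndπ ρ r N q₀ = 0) : a = 0 := by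
  refine EqObj.hom_ext (relInd_hom_ext_π fun q => ?_)
  obtain ⟨g, rfl⟩ := MulAction.exists_smul_eq G q₀ q
  have h1 := act_relIndπ ρ r N g q₀
  have h2 := a.2 g
  have := X.isIso_act g
  refine Eq.trans ?_ zero_comp.symm
  rw [← cancel_epi (X.act g), reassoc_of% h2, h1, ← Category.assoc, ← Functor.map_comp, h,
    Functor.map_zero, zero_comp, comp_zero]

/-- The representative of the trivial coset, as an element of `H`. -/
def Transversal.base {H : Subgroup G} (r : Transversal H) : H :=
  ⟨r.rep ((1 : G) : G ⧸ H), r.rep_one_mem⟩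

/-- The summand of the induced object attached to the trivial coset is `N`. -/
def baseIso (N : EqObj (ρ.restrict H)) :
    (ρ.fn (r.rep ((1 : G) : G ⧸ H))).obj N.obj ≅ N.obj :=
  @asIso C _ ((ρ.fn (r.rep ((1 : G) : G ⧸ H))).obj N.obj) N.obj (N.act r.base)
    (N.isIso_act r.base)

/-- The inclusion `N ⟶ L N` in the underlying category. -/
def unitMap (N : EqObj (ρ.restrict H)) : N.obj ⟶ ((relInd ρ r).obj N).obj :=
  (baseIso ρ r N).inv ≫ relIndι ρ r N ((1 : G) : G ⧸ H)

theorem act_unitMap (N : EqObj (ρ.restrict H)) (h : H) :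
    (N.act h : (ρ.fn h).obj N.obj ⟶ N.obj) ≫ unitMap ρ r N =
      (ρ.fn h).map (unitMap ρ r N) ≫ ((relInd ρ r).obj N).act h := by
  have hq : (h : G) • ((1 : G) : G ⧸ H) = ((1 : G) : G ⧸ H) := by
    change (((h : G) * 1 : G) : G ⧸ H) = _
    rw [QuotientGroup.eq]
    simp
  -- Since `h b = b (b⁻¹ h b)`, the element `h` acts on the base summand `ρ^b N` through its
  -- conjugate by `b`; passing from `ρ^b N` to `N` by `baseIso` undoes the conjugation.
  have e : r.base * (r.base⁻¹ * h * r.base) = h * r.base := by group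
  have e' : r.rep ((1 : G) : G ⧸ H) * ((r.base⁻¹ * h * r.base : H) : G) =
    h * r.rep ((1 : G) : G ⧸ H) := congrArg Subtype.val e
  have h1 := map_relIndι_act ρ r N h ((1 : G) : G ⧸ H) _ hq (r.base⁻¹ * h * r.base) e'
  have h2 : indComp ρ h _ _ _ e' (N.act (r.base⁻¹ * h * r.base)) ≫ (baseIso ρ r N).hom =
      (ρ.fn h).map (baseIso ρ r N).hom ≫ N.act h :=
    indComp_comp_act (ρ.restrict H) N h r.base r.base (r.base⁻¹ * h * r.base) e
  unfold unitMap
  rw [← Iso.eq_comp_inv, Category.assoc] at h2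
  rw [Functor.map_comp, Category.assoc, h1, h2, Category.assoc, ← Category.assoc,
    ← Functor.map_comp_assoc, Iso.inv_hom_id]
  simp

/-- The unit `N ⟶ Res (L N)` of the adjunction between induction and restriction. -/
def indUnit (N : EqObj (ρ.restrict H)) :
    N ⟶ (EqObj.restrict ρ H).obj ((relInd ρ r).obj N) :=
  ⟨unitMap ρ r N, act_unitMap ρ r N⟩

theorem unitMap_π (N : EqObj (ρ.restrict H)) :
    unitMap ρ r N ≫ relIndπ ρ r N ((1 : G) : G ⧸ H) ≫ (baseIso ρ r N).hom = 𝟙 N.obj := by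
  have h1 := relIndι_π_self ρ r N ((1 : G) : G ⧸ H)
  rw [unitMap, Category.assoc, reassoc_of% h1, Iso.inv_hom_id]

instance mono_unitMap (N : EqObj (ρ.restrict H)) : Mono (unitMap ρ r N) :=
  mono_of_mono_fac (unitMap_π ρ r N)

theorem relInd_hom_eq_zero_of_unitMap {N : EqObj (ρ.restrict H)} {X : EqObj ρ}
    (a : (relInd ρ r).obj N ⟶ X) (h : unitMap ρ r N ≫ a.1 = 0) : a = 0 := by
  refine relInd_hom_eq_zero_of_ι ρ r a ((1 : G) : G ⧸ H) ?_
  rw [← cancel_epi (baseIso ρ r N).inv, ← Category.assoc, comp_zero]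
  exact h

/-- The morphism `L N ⟶ X` corresponding to an `H`-equivariant morphism `N ⟶ X`. -/
def indDesc {N : EqObj (ρ.restrict H)} {X : EqObj ρ} (f : N.obj ⟶ X.obj)
    (hf : ∀ h : H, (N.act h : (ρ.fn h).obj N.obj ⟶ N.obj) ≫ f = (ρ.fn h).map f ≫ X.act h) :
    (relInd ρ r).obj N ⟶ X :=
  ⟨biproduct.desc fun q => (ρ.fn (r.rep q)).map f ≫ X.act (r.rep q), fun g => by
    apply map_sum_hom_ext (ρ.fn g)
    intro q
    have h1 := indAct_ι ρ r N g q (g • q) rfl _ (r.rep_mul_cocyc g q)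
    have nat := indComp_naturality ρ f g _ _ _ (r.rep_mul_cocyc g q) _ _ (hf (r.cocyc g q))
    have h2 := indComp_comp_act ρ X g _ _ _ (r.rep_mul_cocyc g q)
    change (ρ.fn g).map _ ≫ indAct ρ r N g ≫ _ = (ρ.fn g).map _ ≫
      (ρ.fn g).map (biproduct.desc fun q => (ρ.fn (r.rep q)).map f ≫ X.act (r.rep q)) ≫ _
    rw [reassoc_of% h1, biproduct.ι_desc, ← reassoc_of% nat, h2, ← Functor.map_comp_assoc,
      ← Functor.map_comp_assoc, biproduct.ι_desc]⟩

theorem relIndι_indDesc {N : EqObj (ρ.restrict H)} {X : EqObj ρ} (f : N.obj ⟶ X.obj)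
    (hf : ∀ h : H, (N.act h : (ρ.fn h).obj N.obj ⟶ N.obj) ≫ f = (ρ.fn h).map f ≫ X.act h)
    (q : G ⧸ H) :
    relIndι ρ r N q ≫ (indDesc ρ r f hf).1 = (ρ.fn (r.rep q)).map f ≫ X.act (r.rep q) :=
  biproduct.ι_desc _ _

theorem unitMap_indDesc {N : EqObj (ρ.restrict H)} {X : EqObj ρ} (f : N.obj ⟶ X.obj)
    (hf : ∀ h : H, (N.act h : (ρ.fn h).obj N.obj ⟶ N.obj) ≫ f = (ρ.fn h).map f ≫ X.act h) :
    unitMap ρ r N ≫ (indDesc ρ r f hf).1 = f := by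
  have h1 : (baseIso ρ r N).hom ≫ f = _ := hf r.base
  rw [unitMap, Category.assoc, relIndι_indDesc, Iso.inv_comp_eq, h1]
  rfl

end Reciprocity

/-! ### Maps from `Y` to an object induced from its inertia group -/

section Isotypic

variable {k : Type w} [Field k] {G : Type x} [Group G] {C : Type u} [Category.{v} C] [Abelian C]
  [Linear k C] (ρ : GAction k G C)

/-- Because `ρ^g` is full and `T ≅ ρ^g ρ^(g⁻¹) T`, a map from `T` to `ρ^g N` comes from one from the
simple object `ρ^(g⁻¹) T` to `N`. -/
theorem IsIsotypic.fn_obj {Y N : C} (h : IsIsotypic Y N) (g : G) :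
    IsIsotypic ((ρ.fn g).obj Y) ((ρ.fn g).obj N) := by
  intro T _ hT f
  have := ρ.isEquivalence g
  have := ρ.simple_fn_obj g⁻¹ T
  let e : (ρ.fn g).obj ((ρ.fn g⁻¹).obj T) ≅ T :=
    (ρ.comp g g⁻¹ 1 (mul_inv_cancel g)).app T ≪≫ (ρ.unit.app T).symm
  obtain ⟨a, ha⟩ := (ρ.fn g).map_surjective (e.hom ≫ f)
  have ha0 : a = 0 := h _ (fun ⟨i⟩ => hT ⟨e.symm ≪≫ (ρ.fn g).mapIso i⟩) a
  rw [← cancel_epi e.hom, ← ha, ha0, Functor.map_zero, comp_zero]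

variable [Finite G] {Y : C} (r : Transversal (ρ.inertia Y))
  {N : EqObj (ρ.restrict (ρ.inertia Y))}

/-- Here the inertia group enters: the summand at `q` is isotypic of type `ρ^t Y`, and `ρ^t Y ≅ Y`
would put `t` in the inertia group. -/
theorem comp_relIndπ_eq_zero [Simple Y] (hN : IsIsotypic Y N.obj)
    (f : Y ⟶ ((relInd ρ r).obj N).obj) (q : G ⧸ ρ.inertia Y) (hq : q ≠ ((1 : G) : G ⧸ ρ.inertia Y)) :
    f ≫ relIndπ ρ r N q = 0 := by
  refine hN.fn_obj ρ (r.rep q) Y (fun ⟨e⟩ => hq ?_) _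
  have h1 : r.rep q ∈ ρ.inertia Y := ⟨e.symm⟩
  rw [← r.rep_spec q]
  exact (QuotientGroup.eq.2 (by simpa using h1)).symm

theorem exists_eq_comp_unitMap [Simple Y] (hN : IsIsotypic Y N.obj) (f : Y ⟶ ((relInd ρ r).obj N).obj) :
    ∃ f' : Y ⟶ N.obj, f' ≫ unitMap ρ r N = f := by
  refine ⟨f ≫ relIndπ ρ r N ((1 : G) : G ⧸ ρ.inertia Y) ≫ (baseIso ρ r N).hom,
    relInd_hom_ext_π fun q => ?_⟩
  by_cases hq : q = ((1 : G) : G ⧸ ρ.inertia Y)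
  · subst hq
    rw [← cancel_mono (baseIso ρ r N).hom]
    simp only [Category.assoc]
    rw [unitMap_π, Category.comp_id]
  · rw [comp_relIndπ_eq_zero ρ r hN _ q hq, comp_relIndπ_eq_zero ρ r hN f q hq]

/-- Equivariant morphisms from or to an induced object are determined on its base summand, a copy of
`N`, and there `Y` detects them since `N` is isotypic. -/
theorem isDetected_relInd [IsSemisimpleCat C] (hN : IsIsotypic Y N.obj) :
    IsDetected Y ((relInd ρ r).obj N) where
  of_from a ha := relInd_hom_eq_zero_of_unitMap ρ r a <| hN.eq_zero_of_from _ fun f => by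
    rw [← Category.assoc]
    exact ha _
  of_to a ha := relInd_hom_eq_zero_of_π ρ r a ((1 : G) : G ⧸ ρ.inertia Y) <|
    (hN.of_iso (baseIso ρ r N)).eq_zero_of_to _ fun f => by
      rw [← Category.assoc, ha f, zero_comp]

end Isotypic

/-! ### The objects `S_{Y,π}` -/

section Clifford

variable {k : Type w} [Field k] [IsAlgClosed k] {C : Type u} [Category.{v} C] [Abelian C]
  [Linear k C] [IsFiniteSemisimple k C] {G : Type x} [Group G] [Finite G] (ρ : GAction k G C)
  {Y : C} [Simple Y] (r : Transversal (ρ.inertia Y)) (c : StableIsos (ρ.restrict (ρ.inertia Y)) Y)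

theorem isomorphic_homRep_relInd {N : EqObj (ρ.restrict (ρ.inertia Y))}
    (hN : IsIsotypic Y N.obj) :
    (homRep Y c N).Isomorphic
      (homRep Y c ((EqObj.restrict ρ (ρ.inertia Y)).obj ((relInd ρ r).obj N))) := by
  let φ : (Y ⟶ N.obj) →ₗ[k] (Y ⟶ ((relInd ρ r).obj N).obj) :=
    Linear.rightComp k Y (unitMap ρ r N)
  have hφ : Function.Bijective φ :=
    ⟨fun _ _ h => (cancel_mono (unitMap ρ r N)).1 h, exists_eq_comp_unitMap ρ r hN⟩
  exact ⟨LinearEquiv.ofBijective φ hφ, fun g f => (homRep_act_comp c (indUnit ρ r N) g f).symm⟩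

theorem isomorphic_homRep_cliffordObj
    (π : ProjRep.{w, v', x} k (ρ.inertia Y) (factorSet (ρ.restrict (ρ.inertia Y)) Y c)) :
    π.Isomorphic
      (homRep Y c ((EqObj.restrict ρ (ρ.inertia Y)).obj (cliffordObj ρ r c π))) :=
  (isomorphic_homRep_repObj c π).trans
    (isomorphic_homRep_relInd ρ r c (isIsotypic_copower π.V Y))

theorem simple_cliffordObj [CharZero k]
    (π : ProjRep.{w, v', x} k (ρ.inertia Y) (factorSet (ρ.restrict (ρ.inertia Y)) Y c))
    (hπ : π.IsIrreducible) : Simple (cliffordObj ρ r c π) := by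
  have := IsFiniteSemisimple.isSemisimpleCat k C
  have hirr := hπ.of_iso (isomorphic_homRep_cliffordObj ρ r c π)
  have : Nontrivial (Y ⟶ (cliffordObj ρ r c π).obj) := hirr.1
  refine IsDetected.simple (Y := Y) (isDetected_relInd ρ r (N := repObj c π)
    (isIsotypic_copower π.V Y)) fun K i _ h f => ?_
  have : Mono ((EqObj.restrict ρ (ρ.inertia Y)).map i).1 := EqObj.mono_val i
  exact homRep_lift_of_irreducible c hirr ((EqObj.restrict ρ (ρ.inertia Y)).map i) h f

section Desc

variable (π : ProjRep.{w, v', x} k (ρ.inertia Y) (factorSet (ρ.restrict (ρ.inertia Y)) Y c))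
  {X : EqObj ρ} (φ : π.V →ₗ[k] (Y ⟶ X.obj))
  (hφ : ∀ g z, φ (π.act g z) =
    (homRep Y c ((EqObj.restrict ρ (ρ.inertia Y)).obj X)).act g (φ z))

/-- The inclusion `V ⊗ Y ⟶ S_{Y,π}` in the underlying category, applied to `v ⊗ Y`. -/
def cliffordVec (z : π.V) : Y ⟶ (cliffordObj ρ r c π).obj :=
  coev k Y z ≫ unitMap ρ r (repObj c π)

/-- The morphism `S_{Y,π} ⟶ X` corresponding to an intertwiner `π → Hom(Y, X)`. -/
def cliffordDesc : cliffordObj ρ r c π ⟶ X :=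
  indDesc ρ r (repDesc c π (N := (EqObj.restrict ρ (ρ.inertia Y)).obj X) φ hφ).1
    (repDesc c π (N := (EqObj.restrict ρ (ρ.inertia Y)).obj X) φ hφ).2

theorem cliffordVec_desc (z : π.V) :
    cliffordVec ρ r c π z ≫ (cliffordDesc ρ r c π φ hφ).1 = φ z := by
  refine (Category.assoc _ _ _).trans ((congrArg _ (unitMap_indDesc ρ r _ _)).trans ?_)
  exact coev_repDesc c π (N := (EqObj.restrict ρ (ρ.inertia Y)).obj X) φ hφ z

theorem exists_eq_cliffordVec (f : Y ⟶ (cliffordObj ρ r c π).obj) :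
    ∃ z : π.V, cliffordVec ρ r c π z = f := by
  obtain ⟨f', rfl⟩ := exists_eq_comp_unitMap ρ r (N := repObj c π) (isIsotypic_copower π.V Y) f
  obtain ⟨z, rfl⟩ := coev_surjective (k := k) (V := π.V) f'
  exact ⟨z, rfl⟩

theorem cliffordVec_zero : cliffordVec ρ r c π 0 = 0 :=
  (congrArg (· ≫ unitMap ρ r (repObj c π)) (map_zero (coev k Y))).trans zero_comp

/-- The induced counterpart of `isIso_repDesc`: detection turns injectivity of `φ` into a
monomorphism to a simple object. As `π` is arbitrary, it applies to every nonzero subrepresentation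
of `Hom(Y, X)`. -/
theorem isIso_cliffordDesc [Simple X] (hinj : Function.Injective φ) (z : π.V) (hz : z ≠ 0) :
    IsIso (cliffordDesc ρ r c π φ hφ) := by
  have := IsFiniteSemisimple.isSemisimpleCat k C
  have : Mono (cliffordDesc ρ r c π φ hφ) := by
    refine IsDetected.mono (Y := Y) (isDetected_relInd ρ r (N := repObj c π)
      (isIsotypic_copower π.V Y)) _ fun f hf => ?_
    obtain ⟨z, rfl⟩ := exists_eq_cliffordVec ρ r c π f
    have h1 := cliffordVec_desc ρ r c π φ hφ z
    have h2 : z = 0 := hinj (h1.symm.trans (hf.trans (map_zero φ).symm))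
    rw [h2]
    exact cliffordVec_zero ρ r c π
  refine isIso_of_mono_of_nonzero fun h0 => hz (hinj ?_)
  rw [← cliffordVec_desc ρ r c π φ hφ z, h0, map_zero]
  exact comp_zero

end Desc

theorem nonempty_iso_cliffordObj (X : EqObj ρ) [Simple X] [Nontrivial (Y ⟶ X.obj)] :
    Nonempty (X ≅ cliffordObj ρ r c
      (homRep Y c ((EqObj.restrict ρ (ρ.inertia Y)).obj X))) := by
  obtain ⟨f, hf⟩ := exists_ne (0 : Y ⟶ X.obj)
  have hiso := isIso_cliffordDesc ρ r c (homRep Y c ((EqObj.restrict ρ (ρ.inertia Y)).obj X))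
    (LinearMap.id : (Y ⟶ X.obj) →ₗ[k] (Y ⟶ X.obj)) (fun _ _ => rfl) Function.injective_id f hf
  exact ⟨(@asIso _ _ _ _ _ hiso).symm⟩

/-- For a nonzero invariant subspace `W` the morphism from `S_{Y,W}` to `X` is an isomorphism. Every
map from `Y` to `X` then comes from one to `S_{Y,W}`, which is given by a vector of `W`; so `W` is
everything. -/
theorem isIrreducible_homRep_restrict (X : EqObj ρ) [Simple X] [hX : Nontrivial (Y ⟶ X.obj)]
    (r : Transversal (ρ.inertia Y)) :
    (homRep Y c ((EqObj.restrict ρ (ρ.inertia Y)).obj X)).IsIrreducible := by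
  refine ⟨hX, fun W hW => or_iff_not_imp_left.2 fun hbot => ?_⟩
  obtain ⟨w₀, hw₀, hne⟩ := Submodule.exists_mem_ne_zero_of_ne_bot hbot
  let π := (homRep Y c ((EqObj.restrict ρ (ρ.inertia Y)).obj X)).sub W hW
  have hiso := isIso_cliffordDesc ρ r c π (X := X) W.subtype (fun _ _ => rfl)
    W.injective_subtype ⟨w₀, hw₀⟩ (fun h => hne (congrArg Subtype.val h))
  rw [eq_top_iff]
  rintro f -
  let F := cliffordDesc ρ r c π (X := X) W.subtype (fun _ _ => rfl)
  let f₁ : Y ⟶ X.obj := f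
  obtain ⟨z, hz⟩ := exists_eq_cliffordVec ρ r c π (f₁ ≫ (inv F).1)
  have h1 := cliffordVec_desc ρ r c π (X := X) W.subtype (fun _ _ => rfl) z
  have h2 : (f₁ ≫ (inv F).1) ≫ F.1 = f₁ := by
    rw [Category.assoc, ← EqObj.comp_val, IsIso.inv_hom_id]
    exact Category.comp_id _
  have h3 : f = z.1 := h2.symm.trans ((congrArg (· ≫ F.1) hz.symm).trans h1)
  rw [h3]
  exact z.2

end Clifford

/-! ### Simple equivariant objects containing a stable simple object -/

section Simple

variable {k : Type w} [Field k] [IsAlgClosed k] {H : Type x} [Group H] {C : Type u}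
  [Category.{v} C] [Abelian C] [Linear k C] [IsFiniteSemisimple k C] {σ : GAction k H C} {Y : C}
  [Simple Y] (c : StableIsos σ Y) (N : EqObj σ) [Simple N]

/-- The argument for induced objects, with `W ⊗ Y` in place of `S_{Y,W}`. -/
theorem isIrreducible_homRep [hN : Nontrivial (Y ⟶ N.obj)] : (homRep Y c N).IsIrreducible := by
  refine ⟨hN, fun W hW => or_iff_not_imp_left.2 fun hbot => ?_⟩
  obtain ⟨w₀, hw₀, hne⟩ := Submodule.exists_mem_ne_zero_of_ne_bot hbot
  let π := (homRep Y c N).sub W hW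
  have hiso := isIso_repDesc c π (N := N) W.subtype (fun _ _ => rfl)
    W.injective_subtype ⟨w₀, hw₀⟩ (fun h => hne (congrArg Subtype.val h))
  rw [eq_top_iff]
  rintro f -
  let F := repDesc c π (N := N) W.subtype (fun _ _ => rfl)
  let f₁ : Y ⟶ N.obj := f
  obtain ⟨z, hz⟩ := coev_surjective (k := k) (V := π.V) (f₁ ≫ (inv F).1)
  have h1 := coev_repDesc c π (N := N) W.subtype (fun _ _ => rfl) z
  have h2 : (f₁ ≫ (inv F).1) ≫ F.1 = f₁ := by
    rw [Category.assoc, ← EqObj.comp_val, IsIso.inv_hom_id]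
    exact Category.comp_id _
  have h3 : f = z.1 := h2.symm.trans ((congrArg (· ≫ F.1) hz.symm).trans h1)
  rw [h3]
  exact z.2

theorem nonempty_iso_repObj [Nontrivial (Y ⟶ N.obj)] :
    Nonempty (N ≅ repObj c (homRep Y c N)) := by
  obtain ⟨f, hf⟩ := exists_ne (0 : Y ⟶ N.obj)
  have hiso := isIso_repDesc c (homRep Y c N)
    (LinearMap.id : (Y ⟶ N.obj) →ₗ[k] (Y ⟶ N.obj)) (fun _ _ => rfl) Function.injective_id f hf
  exact ⟨(@asIso _ _ _ _ _ hiso).symm⟩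

end Simple

/-! ### The Clifford correspondence -/

section Orbits

theorem ProjRep.Isomorphic.nontrivial {k : Type w} [Field k] {H : Type x} [Group H]
    {α : H → H → kˣ} {π : ProjRep.{w, v, x} k H α} {π' : ProjRep.{w, v', x} k H α}
    (h : π.Isomorphic π') [Nontrivial π.V] : Nontrivial π'.V := by
  obtain ⟨φ, -⟩ := h
  exact φ.symm.toEquiv.nontrivial

variable {k : Type w} [Field k] {C : Type u} [Category.{v} C] [Abelian C] [Linear k C]
  {G : Type x} [Group G] (ρ : GAction k G C) {Y : C}

theorem EqObj.id_obj_ne_zero {X : EqObj ρ} [Simple X] : 𝟙 X.obj ≠ 0 := fun h =>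
  id_nonzero X (EqObj.hom_ext h)

variable (Y) in
theorem nonempty_stableIsos : Nonempty (StableIsos (ρ.restrict (ρ.inertia Y)) Y) :=
  ⟨fun h => Classical.choice h.2⟩

/-- All simple constituents of the induced object are conjugates of `Y`. This separates different
orbits in the parametrization. -/
theorem exists_iso_fn_of_hom_relInd [Finite G] (r : Transversal (ρ.inertia Y))
    {N : EqObj (ρ.restrict (ρ.inertia Y))}
    (hN : IsIsotypic Y N.obj) {T : C} [Simple T] (f : T ⟶ ((relInd ρ r).obj N).obj) (hf : f ≠ 0) :
    ∃ g : G, Nonempty (T ≅ (ρ.fn g).obj Y) := by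
  by_contra! hc
  refine hf (relInd_hom_ext_π fun q => ?_)
  rw [zero_comp]
  exact hN.fn_obj ρ (r.rep q) T (fun h => (hc (r.rep q)).false h.some) _

theorem GAction.orbit_eq_iff [Simple Y] (T : C) [Simple T] :
    ρ.orbit T = ρ.orbit Y ↔ ∃ g : G, Nonempty (T ≅ (ρ.fn g).obj Y) := by
  let := ρ.irrAction
  have key : ∀ g : G, g • Irr.mk Y = Irr.mk T ↔ Nonempty (T ≅ (ρ.fn g).obj Y) := by
    intro g
    have := ρ.simple_fn_obj g Y
    have h1 : g • Irr.mk Y = Irr.mk ((ρ.fn g).obj Y) := rfl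
    rw [h1, Irr.ext_iff_iso]
    exact ⟨fun ⟨e⟩ => ⟨e.symm⟩, fun ⟨e⟩ => ⟨e.symm⟩⟩
  constructor
  · intro h
    obtain ⟨g, hg⟩ := _root_.Quotient.exact h
    exact ⟨g, (key g).1 hg⟩
  · rintro ⟨g, hg⟩
    exact _root_.Quotient.sound ⟨g, (key g).2 hg⟩

end Orbits

section Correspondence

variable {k : Type w} [Field k] [IsAlgClosed k] {C : Type u} [Category.{v} C] [Abelian C]
  [Linear k C] [IsFiniteSemisimple k C] {G : Type x} [Group G] (ρ : GAction k G C)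

theorem isIsotypic_of_simple {H : Type x} [Group H] {σ : GAction k H C} {Y : C} [Simple Y]
    (c : StableIsos σ Y) (N : EqObj σ) [Simple N] [Nontrivial (Y ⟶ N.obj)] :
    IsIsotypic Y N.obj := by
  obtain ⟨e⟩ := nonempty_iso_repObj c N
  exact (isIsotypic_copower (k := k) (Y ⟶ N.obj) Y).of_iso ((EqObj.forget σ).mapIso e)

variable [Finite G] {Y : C} [Simple Y] (r : Transversal (ρ.inertia Y))

theorem isomorphic_homRep_of_iso_relInd (c : StableIsos (ρ.restrict (ρ.inertia Y)) Y)
    (N : EqObj (ρ.restrict (ρ.inertia Y))) [Simple N] [Nontrivial (Y ⟶ N.obj)] {X : EqObj ρ}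
    (e : X ≅ (relInd ρ r).obj N) :
    (homRep Y c N).Isomorphic (homRep Y c ((EqObj.restrict ρ (ρ.inertia Y)).obj X)) :=
  (isomorphic_homRep_relInd ρ r c (isIsotypic_of_simple c N)).trans
    (homRep_isomorphic c ((EqObj.restrict ρ (ρ.inertia Y)).mapIso e.symm))

/-- Relative induction is a bijection between the simple objects of `C^{G_Y}` and of `C^G` that
contain `Y`. -/
theorem relInd_bijOn [CharZero k] :
    Set.BijOn (mapIsoClass (relInd ρ r))
      {x | ∃ N : EqObj (ρ.restrict (ρ.inertia Y)),
        Simple N ∧ Nontrivial (Y ⟶ N.obj) ∧ isoClass N = x}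
      {x | ∃ X : EqObj ρ, Simple X ∧ Nontrivial (Y ⟶ X.obj) ∧ isoClass X = x} := by
  -- The isomorphisms `c` are auxiliary: they serve only to pass through projective representations.
  obtain ⟨c⟩ := nonempty_stableIsos ρ Y
  refine ⟨?_, ?_, ?_⟩
  · rintro _ ⟨N, _, _, rfl⟩
    obtain ⟨e⟩ := nonempty_iso_repObj c N
    have := simple_cliffordObj ρ r c _ (isIrreducible_homRep c N)
    have hs : Simple ((relInd ρ r).obj N) := @Simple.of_iso _ _ _ _ _ this ((relInd ρ r).mapIso e)
    have : Nontrivial (homRep Y c N).V := ‹Nontrivial (Y ⟶ N.obj)›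
    exact ⟨(relInd ρ r).obj N, hs,
      (isomorphic_homRep_of_iso_relInd ρ r c N (Iso.refl _)).nontrivial, rfl⟩
  -- `Hom(Y, N)` is read off from `L N`, and `N` is recovered as `Hom(Y, N) ⊗ Y`.
  · rintro _ ⟨N, _, _, rfl⟩ _ ⟨N', _, _, rfl⟩ h
    obtain ⟨e⟩ := _root_.Quotient.exact h
    have h1 := isomorphic_homRep_of_iso_relInd ρ r c N e.symm
    have h2 := isomorphic_homRep_of_iso_relInd ρ r c N' (Iso.refl _)
    obtain ⟨i⟩ := repObj_iso _ _ c _ _ (h1.trans h2.symm)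
    obtain ⟨e₁⟩ := nonempty_iso_repObj c N
    obtain ⟨e₂⟩ := nonempty_iso_repObj c N'
    exact _root_.Quotient.sound ⟨e₁ ≪≫ i ≪≫ e₂.symm⟩
  -- The preimage of `X` is `Hom(Y, X) ⊗ Y`.
  · rintro _ ⟨X, _, hX, rfl⟩
    have hirr := isIrreducible_homRep_restrict ρ c X r
    obtain ⟨e⟩ := nonempty_iso_cliffordObj ρ r c X
    have h1 := isomorphic_homRep_repObj c
      (homRep Y c ((EqObj.restrict ρ (ρ.inertia Y)).obj X))
    have : Nontrivial (homRep Y c ((EqObj.restrict ρ (ρ.inertia Y)).obj X)).V := hX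
    exact ⟨isoClass (repObj c (homRep Y c ((EqObj.restrict ρ (ρ.inertia Y)).obj X))),
      ⟨_, simple_repObj c _ hirr, h1.nontrivial, rfl⟩, _root_.Quotient.sound ⟨e.symm⟩⟩

end Correspondence

section Parametrization

variable {k : Type w} [Field k] [IsAlgClosed k] [CharZero k] {C : Type u} [Category.{v} C]
  [Abelian C] [Linear k C] [IsFiniteSemisimple k C] {G : Type x} [Group G] [Finite G]
  (ρ : GAction k G C)

/-- The simple objects of `C^G` are parametrized by pairs `(Y, π)`. -/
theorem cliffordClass_bijOn (Y : ρ.Orbits → C) [∀ o, Simple (Y o)] (hY : ∀ o, ρ.orbit (Y o) = o)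
    (r : ∀ o, Transversal (ρ.inertia (Y o)))
    (c : ∀ o, StableIsos (ρ.restrict (ρ.inertia (Y o))) (Y o)) :
    Set.BijOn
      (fun p : Σ o, ProjRepClass k (ρ.inertia (Y o))
          (factorSet (ρ.restrict (ρ.inertia (Y o))) (Y o) (c o)) =>
        cliffordClass ρ (r p.1) (c p.1) p.2)
      {p | ∃ π, π.IsIrreducible ∧ _root_.Quotient.mk (ProjRep.setoid k _ _) π = p.2}
      {x | ∃ X : EqObj ρ, Simple X ∧ isoClass X = x} := by
  refine ⟨?_, ?_, ?_⟩
  · rintro ⟨o, p⟩ hp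
    obtain ⟨π, hπ, rfl⟩ : ∃ π : ProjRep.{w, w, x} k (ρ.inertia (Y o))
      (factorSet (ρ.restrict (ρ.inertia (Y o))) (Y o) (c o)),
      π.IsIrreducible ∧ _root_.Quotient.mk (ProjRep.setoid k _ _) π = p := hp
    exact ⟨_, simple_cliffordObj ρ (r o) (c o) π hπ, rfl⟩
  · rintro ⟨o, p⟩ hp ⟨o', p'⟩ hp' h
    obtain ⟨π, hπ, rfl⟩ : ∃ π : ProjRep.{w, w, x} k (ρ.inertia (Y o))
      (factorSet (ρ.restrict (ρ.inertia (Y o))) (Y o) (c o)),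
      π.IsIrreducible ∧ _root_.Quotient.mk (ProjRep.setoid k _ _) π = p := hp
    obtain ⟨π', hπ', rfl⟩ : ∃ π : ProjRep.{w, w, x} k (ρ.inertia (Y o'))
      (factorSet (ρ.restrict (ρ.inertia (Y o'))) (Y o') (c o')),
      π.IsIrreducible ∧ _root_.Quotient.mk (ProjRep.setoid k _ _) π = p' := hp'
    obtain ⟨e⟩ : Nonempty (cliffordObj ρ (r o) (c o) π ≅ cliffordObj ρ (r o') (c o') π') :=
      _root_.Quotient.exact h
    have := hπ'.1
    have h1 := (isomorphic_homRep_cliffordObj ρ (r o') (c o') π').trans (homRep_isomorphic (c o')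
      ((EqObj.restrict ρ (ρ.inertia (Y o'))).mapIso e.symm))
    have h2 : Nontrivial (Y o' ⟶ (cliffordObj ρ (r o) (c o) π).obj) := h1.nontrivial
    obtain ⟨f, hf⟩ := exists_ne (0 : Y o' ⟶ (cliffordObj ρ (r o) (c o) π).obj)
    -- The object `Y o'` maps nontrivially to an object whose simple constituents are all conjugates
    -- of `Y o`.
    have ho : o' = o := by
      rw [← hY o, ← hY o', hY o, hY o', ← hY o, ← hY o', GAction.orbit_eq_iff]
      exact exists_iso_fn_of_hom_relInd ρ (r o) (N := repObj (c o) π)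
        (isIsotypic_copower π.V (Y o)) f hf
    subst ho
    have h3 := (isomorphic_homRep_cliffordObj ρ (r o') (c o') π).trans h1.symm
    exact congrArg (Sigma.mk o') (_root_.Quotient.sound h3)
  · rintro _ ⟨X, _, rfl⟩
    have := IsFiniteSemisimple.isSemisimpleCat k C
    obtain ⟨T, _, f, hf⟩ := exists_simple_hom_ne_zero (X := X.obj) (EqObj.id_obj_ne_zero ρ)
    obtain ⟨g, ⟨e⟩⟩ := (GAction.orbit_eq_iff ρ (Y (ρ.orbit T))).1 (hY (ρ.orbit T))
    generalize ρ.orbit T = o at e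
    -- A constituent `T` of `X` is conjugate to `Y o`; applying `ρ^g` to its inclusion and then the
    -- structure map of `X` gives a nonzero map from `Y o`.
    have hX : Nontrivial (Y o ⟶ X.obj) := by
      have := ρ.isEquivalence g
      have := X.isIso_act g
      refine ⟨e.hom ≫ (ρ.fn g).map f ≫ X.act g, 0, fun h => hf ?_⟩
      have h1 := (cancel_epi e.hom).1 (h.trans comp_zero.symm)
      have h2 := (cancel_mono (X.act g)).1 (h1.trans zero_comp.symm)
      exact (ρ.fn g).map_injective (h2.trans ((ρ.fn g).map_zero _ _).symm)
    have hirr := isIrreducible_homRep_restrict ρ (c o) X (r o)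
    -- `Hom(Y, X)` lives in the universe of morphisms, whereas the classes in `ProjRepClass` are
    -- formed in the universe of `k`.
    obtain ⟨π, hπ⟩ := (homRep (Y o) (c o)
      ((EqObj.restrict ρ (ρ.inertia (Y o))).obj X)).exists_isomorphic
    have hπ' := hirr.of_iso hπ
    refine ⟨⟨o, _root_.Quotient.mk _ π⟩, ⟨π, hπ', rfl⟩, _root_.Quotient.sound ?_⟩
    obtain ⟨φ, hφ⟩ := hπ.symm
    have := hπ'.1
    obtain ⟨z, hz⟩ := exists_ne (0 : π.V)
    have hiso := isIso_cliffordDesc ρ (r o) (c o) π φ.toLinearMap hφ φ.injective z hz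
    exact ⟨@asIso _ _ _ _ _ hiso⟩

end Parametrization

/-! ### Additive functions -/

section Additive

variable {C : Type u} [Category.{v} C] [Preadditive C]

/-- Reindexing of a direct sum decomposition. -/
def SumDecomp.reindex {Z : C} {I J : Type*} [Fintype I] [Fintype J] {S : J → C}
    (b : SumDecomp Z S) (e : I ≃ J) : SumDecomp Z (S ∘ e) where
  inj i := b.inj (e i)
  proj i := b.proj (e i)
  inj_proj_self i := b.inj_proj_self (e i)
  inj_proj_ne _ _ h := b.inj_proj_ne _ _ (fun h' => h (e.injective h'))
  total := (e.sum_comp fun j => b.proj j ≫ b.inj j).trans b.total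

/-- The isomorphism splitting off the first summand. -/
def SumDecomp.isoBiprod [HasFiniteBiproducts C] [HasBinaryBiproducts C] {Z : C} {n : ℕ}
    {S : Fin (n + 1) → C} (b : SumDecomp Z S) : Z ≅ S 0 ⊞ ⨁ fun i : Fin n => S i.succ where
  hom := biprod.lift (b.proj 0) (biproduct.lift fun i => b.proj i.succ)
  inv := biprod.desc (b.inj 0) (biproduct.desc fun i => b.inj i.succ)
  hom_inv_id := by
    rw [biprod.lift_desc, biproduct.lift_desc, ← b.total, Fin.sum_univ_succ]
  inv_hom_id := by
    classical
    apply biprod.hom_ext'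
    · apply biprod.hom_ext
      · simp [b.inj_proj_self]
      · apply biproduct.hom_ext
        intro i
        simp [b.inj_proj_ne _ _ (Fin.succ_ne_zero i).symm]
    · apply biproduct.hom_ext'
      intro i
      apply biprod.hom_ext
      · simp [b.inj_proj_ne _ _ (Fin.succ_ne_zero i)]
      · apply biproduct.hom_ext
        intro j
        by_cases h : i = j
        · subst h
          simp [b.inj_proj_self]
        · have h' : i.succ ≠ j.succ := fun e => h (Fin.succ_injective _ e)
          simp [b.inj_proj_ne _ _ h', biproduct.ι_π_ne _ h]

/-- A function on objects that is additive on finite direct sums. -/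
def IsAdditiveFn (d : C → ℝ) : Prop :=
  ∀ ⦃J : Type⦄ [Fintype J] ⦃S : J → C⦄ ⦃Z : C⦄, SumDecomp Z S → d Z = ∑ j, d (S j)

theorem IsAdditiveFn.sum {d : C → ℝ} (hd : IsAdditiveFn d) {J : Type x} [Fintype J] {S : J → C}
    {Z : C} (b : SumDecomp Z S) : d Z = ∑ j, d (S j) := by
  rw [hd (b.reindex (Fintype.equivFin J).symm)]
  exact (Fintype.equivFin J).symm.sum_comp fun j => d (S j)

theorem IsAdditiveFn.congr {d : C → ℝ} (hd : IsAdditiveFn d) {X Y : C} (e : X ≅ Y) :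
    d X = d Y := by
  rw [hd (SumDecomp.ofUnique e)]
  simp

theorem isAdditiveFn_of_biprod [HasFiniteBiproducts C] [HasBinaryBiproducts C] [HasZeroObject C]
    (d : C → ℝ) (hiso : ∀ A B : C, Nonempty (A ≅ B) → d A = d B)
    (hadd : ∀ A B : C, d (A ⊞ B) = d A + d B) : IsAdditiveFn d := by
  have key : ∀ (n : ℕ) (S : Fin n → C) (Z : C), SumDecomp Z S → d Z = ∑ j, d (S j) := by
    intro n
    induction n with
    | zero =>
      intro S Z b
      have hZ : IsZero Z := by
        rw [IsZero.iff_id_eq_zero, ← b.total]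
        simp
      -- The value at a zero object is not assumed: `Z ⊞ Z ≅ Z` forces `d Z = 2 d Z`.
      have hZZ : IsZero (Z ⊞ Z) := by
        rw [IsZero.iff_id_eq_zero]
        apply biprod.hom_ext'
        · exact hZ.eq_of_src _ _
        · exact hZ.eq_of_src _ _
      have h1 := hadd Z Z
      rw [hiso _ _ ⟨hZZ.iso hZ⟩] at h1
      simp only [Finset.univ_eq_empty, Finset.sum_empty]
      linarith
    | succ n ih =>
      intro S Z b
      rw [hiso _ _ ⟨b.isoBiprod⟩, hadd, Fin.sum_univ_succ,
        ih (fun i => S i.succ) _ (SumDecomp.biproduct _)]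
  intro J _ S Z b
  rw [key _ _ _ (b.reindex (Fintype.equivFin J).symm)]
  exact (Fintype.equivFin J).symm.sum_comp fun j => d (S j)

end Additive

theorem IsAdditiveFn.cliffordObj {k : Type w} [Field k] [IsAlgClosed k] {C : Type u}
    [Category.{v} C] [Abelian C] [Linear k C] [IsFiniteSemisimple k C] {G : Type x} [Group G]
    [Finite G] (ρ : GAction k G C) {Y : C} [Simple Y] (r : Transversal (ρ.inertia Y))
    (c : StableIsos (ρ.restrict (ρ.inertia Y)) Y)
    (π : ProjRep.{w, v', x} k (ρ.inertia Y) (factorSet (ρ.restrict (ρ.inertia Y)) Y c))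
    {d : C → ℝ} (hd : IsAdditiveFn d) (hG : ∀ (g : G) (A : C), d ((ρ.fn g).obj A) = d A) :
    d (EquivClifford.cliffordObj ρ r c π).obj = π.dim * (ρ.inertia Y).index * d Y := by
  let := Fintype.ofFinite (G ⧸ ρ.inertia Y)
  have h1 : d (copower k π.V Y) = π.dim * d Y := by
    rw [hd.sum (SumDecomp.biproduct fun _ : Fin (Module.finrank k π.V) => Y)]
    simp [ProjRep.dim]
  refine (hd.sum (SumDecomp.biproduct fun q : G ⧸ ρ.inertia Y =>
    (ρ.fn (r.rep q)).obj (copower k π.V Y))).trans ?_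
  simp only [hG, h1, Finset.sum_const, nsmul_eq_mul, Finset.card_univ, ← Nat.card_eq_fintype_card,
    Subgroup.index]
  ring

/-! ### Perron vectors of positive matrices -/

section Perron

open Matrix

variable {I : Type u} [Fintype I]

theorem mulVec_pos {P : Matrix I I ℝ} (hP : ∀ i j, 0 < P i j) {y : I → ℝ} (hy : ∀ i, 0 ≤ y i)
    (hy0 : y ≠ 0) (i : I) : 0 < (P *ᵥ y) i := by
  obtain ⟨j, hj⟩ := Function.ne_iff.1 hy0
  exact Finset.sum_pos' (fun l _ => mul_nonneg (hP i l).le (hy l))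
    ⟨j, Finset.mem_univ j, mul_pos (hP i j) (lt_of_le_of_ne (hy j) (Ne.symm hj))⟩

/-- Perron's theorem: a matrix with positive entries has a positive eigenvector. -/
theorem exists_perron_vector [Nonempty I] (P : Matrix I I ℝ) (hP : ∀ i j, 0 < P i j) :
    ∃ (y : I → ℝ) (t : ℝ), (∀ i, 0 < y i) ∧ P *ᵥ y = t • y := by
  let T : ℝ := ∑ i, ∑ j, P i j
  have hbound : ∀ y ∈ stdSimplex ℝ I, ∀ t : ℝ, (∀ i, t * y i ≤ (P *ᵥ y) i) → t ≤ T := by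
    intro y hy t ht
    calc t = ∑ i, t * y i := by rw [← Finset.mul_sum, hy.2, mul_one]
      _ ≤ ∑ i, (P *ᵥ y) i := Finset.sum_le_sum fun i _ => ht i
      _ ≤ T := Finset.sum_le_sum fun i _ => Finset.sum_le_sum fun j _ =>
          mul_le_of_le_one_right (hP i j).le
            ((Finset.single_le_sum (fun l _ => hy.1 l) (Finset.mem_univ j)).trans_eq hy.2)
  have hcont : ∀ i, Continuous fun p : (I → ℝ) × ℝ => (P *ᵥ p.1) i := fun i =>
    continuous_finsetSum _ fun j _ =>
      continuous_const.mul ((continuous_apply j).comp continuous_fst)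
  -- The Collatz–Wielandt argument: among the pairs with `y` in the simplex and `t y ≤ P y`, a
  -- compact set, one with maximal `t` is chosen.
  let K : Set ((I → ℝ) × ℝ) :=
    (stdSimplex ℝ I ×ˢ Set.Icc 0 T) ∩ ⋂ i, {p | p.2 * p.1 i ≤ (P *ᵥ p.1) i}
  have hK : IsCompact K := ((isCompact_stdSimplex ℝ I).prod isCompact_Icc).inter_right
    (isClosed_iInter fun i => isClosed_le
      (continuous_snd.mul ((continuous_apply i).comp continuous_fst)) (hcont i))
  have hT : 0 ≤ T := Finset.sum_nonneg fun i _ => Finset.sum_nonneg fun j _ => (hP i j).le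
  have hne : K.Nonempty := by
    classical
    obtain ⟨i₀⟩ := ‹Nonempty I›
    have h0 := single_mem_stdSimplex ℝ i₀
    refine ⟨(_, 0), ⟨h0, le_rfl, hT⟩, Set.mem_iInter.2 fun i => ?_⟩
    change 0 * _ ≤ (P *ᵥ _) i
    rw [zero_mul]
    exact Finset.sum_nonneg fun j _ => mul_nonneg (hP i j).le (h0.1 j)
  obtain ⟨⟨y, t⟩, hyt, hmax⟩ := hK.exists_isMaxOn hne continuous_snd.continuousOn
  obtain ⟨⟨hy, ht0, -⟩, hle⟩ := hyt
  have hle' : ∀ i, t * y i ≤ (P *ᵥ y) i := fun i => Set.mem_iInter.1 hle i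
  have hy0 : y ≠ 0 := by
    rintro rfl
    simpa using hy.2
  have hz := mulVec_pos hP hy.1 hy0
  have heq : P *ᵥ y = t • y := by
    by_contra hneq
    -- If `t y ≤ P y` were not an equality, applying `P` would make it strict in every coordinate
    -- for the vector `P y`, leaving room to increase `t`.
    have hpos : ∀ i, 0 < (P *ᵥ (P *ᵥ y - t • y)) i :=
      mulVec_pos hP (fun i => sub_nonneg.2 (hle' i)) (sub_ne_zero.2 hneq)
    rw [mulVec_sub, mulVec_smul] at hpos
    obtain ⟨i₀, hi₀⟩ := Finite.exists_min fun i =>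
      (P *ᵥ (P *ᵥ y) - t • (P *ᵥ y)) i / (P *ᵥ y) i
    -- The smallest relative slack, which is the largest amount by which `t` may be raised for the
    -- vector `P y`.
    set e := (P *ᵥ (P *ᵥ y) - t • (P *ᵥ y)) i₀ / (P *ᵥ y) i₀ with he
    have he0 : 0 < e := div_pos (hpos i₀) (hz i₀)
    have hs : 0 < ∑ i, (P *ᵥ y) i := Finset.sum_pos (fun i _ => hz i) Finset.univ_nonempty
    set s := ∑ i, (P *ᵥ y) i with hs'
    have hmem : s⁻¹ • (P *ᵥ y) ∈ stdSimplex ℝ I := by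
      refine ⟨fun i => mul_nonneg (inv_nonneg.2 hs.le) (hz i).le, ?_⟩
      simp only [Pi.smul_apply, smul_eq_mul]
      rw [← Finset.mul_sum, ← hs', inv_mul_cancel₀ hs.ne']
    have hle2 : ∀ i, (t + e) * (s⁻¹ • (P *ᵥ y)) i ≤ (P *ᵥ (s⁻¹ • (P *ᵥ y))) i := by
      intro i
      have h1 := (le_div_iff₀ (hz i)).1 (hi₀ i)
      rw [mulVec_smul]
      simp only [Pi.smul_apply, Pi.sub_apply, smul_eq_mul] at h1 ⊢
      rw [mul_left_comm]
      refine mul_le_mul_of_nonneg_left ?_ (inv_nonneg.2 hs.le)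
      linarith
    have hin : (s⁻¹ • (P *ᵥ y), t + e) ∈ K :=
      ⟨⟨hmem, add_nonneg ht0 he0.le, hbound _ hmem _ hle2⟩, Set.mem_iInter.2 hle2⟩
    have h2 : t + e ≤ t := hmax hin
    linarith
  refine ⟨y, t, fun i => lt_of_le_of_ne (hy.1 i) fun h => ?_, heq⟩
  have h1 := hz i
  rw [heq, Pi.smul_apply, ← h, smul_zero] at h1
  exact lt_irrefl _ h1

/-- The eigenspace of a positive eigenvector of a positive matrix is one-dimensional. -/
theorem eq_smul_of_perron_vector [Nonempty I] {P : Matrix I I ℝ} (hP : ∀ i j, 0 < P i j)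
    {y z : I → ℝ} {t : ℝ} (hy : ∀ i, 0 < y i) (hPy : P *ᵥ y = t • y) (hPz : P *ᵥ z = t • z) :
    ∃ a : ℝ, z = a • y := by
  -- With `a` the minimal ratio, `z - a y` is nonnegative and vanishes at `i₀`. It satisfies the
  -- eigenvector equation, so its image under `P` vanishes at `i₀` too, while positivity of `P`
  -- forbids this unless `z = a y`.
  obtain ⟨i₀, hi₀⟩ := Finite.exists_min fun i => z i / y i
  refine ⟨z i₀ / y i₀, ?_⟩
  set a := z i₀ / y i₀ with ha
  by_contra hne
  have h0 : ∀ i, 0 ≤ (z - a • y) i := fun i =>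
    sub_nonneg.2 ((le_div_iff₀ (hy i)).1 (hi₀ i))
  have h1 := mulVec_pos hP h0 (sub_ne_zero.2 hne) i₀
  rw [mulVec_sub, mulVec_smul, hPy, hPz] at h1
  simp only [Pi.sub_apply, Pi.smul_apply, smul_eq_mul] at h1
  have h2 : a * y i₀ = z i₀ := div_mul_cancel₀ _ (hy i₀).ne'
  have h3 : t * z i₀ - a * (t * y i₀) = 0 := by rw [← h2]; ring
  linarith

end Perron

/-! ### Additive functions and multiplicities -/

section Multiplicity

namespace IsAdditiveFn

variable {D : Type u} [Category.{v} D] [Preadditive D]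

theorem comp {D' : Type u'} [Category.{v'} D'] [Preadditive D'] {d : D → ℝ} (hd : IsAdditiveFn d)
    (F : D' ⥤ D) [F.Additive] : IsAdditiveFn fun Z => d (F.obj Z) :=
  fun _ _ _ _ b => hd (b.map F)

theorem mul_const {d : D → ℝ} (hd : IsAdditiveFn d) (a : ℝ) : IsAdditiveFn fun Z => d Z * a :=
  fun _ _ _ _ b => by simp only [hd b, Finset.sum_mul]

theorem fintype_sum {I : Type*} [Fintype I] {d : I → D → ℝ} (hd : ∀ i, IsAdditiveFn (d i)) :
    IsAdditiveFn fun Z => ∑ i, d i Z :=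
  fun J _ S Z b => by
    rw [Finset.sum_comm]
    exact Finset.sum_congr rfl fun i _ => hd i b

theorem finrank_hom (k : Type w) [Field k] [Linear k D] [∀ X Y : D, FiniteDimensional k (X ⟶ Y)]
    (T : D) : IsAdditiveFn fun Z => (Module.finrank k (T ⟶ Z) : ℝ) :=
  fun _ _ _ _ b => by simp only [b.finrank_hom k T, Nat.cast_sum]

end IsAdditiveFn

theorem Irr.simple_rep {D : Type u} [Category.{v} D] [HasZeroMorphisms D] (i : Irr D) :
    Simple i.rep :=
  i.property.choose_spec.1

attribute [instance] Irr.simple_rep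

theorem Irr.mk_rep {D : Type u} [Category.{v} D] [HasZeroMorphisms D] (i : Irr D) :
    Irr.mk i.rep = i :=
  Subtype.ext i.property.choose_spec.2

theorem Irr.nonempty_iso_rep {D : Type u} [Category.{v} D] [HasZeroMorphisms D] (S : D)
    [Simple S] : Nonempty (S ≅ (Irr.mk S).rep) :=
  (Irr.ext_iff_iso _ _).1 (Irr.mk_rep (Irr.mk S)).symm

variable {k : Type w} [Field k] [IsAlgClosed k] {D : Type u} [Category.{v} D] [Preadditive D]
  [Linear k D] [HasKernels D] [∀ X Y : D, FiniteDimensional k (X ⟶ Y)] [Fintype (Irr D)]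

variable (k) in
theorem sum_finrank_rep_hom_simple (d : Irr D → ℝ) (S : D) [Simple S] :
    ∑ j : Irr D, (Module.finrank k (j.rep ⟶ S) : ℝ) * d j = d (Irr.mk S) := by
  have key : ∀ j : Irr D, Nonempty (j.rep ≅ S) ↔ j = Irr.mk S := fun j => by
    rw [← Irr.ext_iff_iso, Irr.mk_rep]
  rw [Finset.sum_eq_single (Irr.mk S)]
  · rw [(finrank_hom_simple_simple_eq_one_iff k _ _).2 ((key _).2 rfl)]
    simp
  · intro j _ hj
    rw [(finrank_hom_simple_simple_eq_zero_iff k _ _).2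
      (not_nonempty_iff.1 fun h => hj ((key j).1 h))]
    simp
  · intro h
    exact absurd (Finset.mem_univ _) h

variable [IsSemisimpleCat D]

variable (k) in
/-- The value of an additive function is determined by the multiplicities of simple objects. -/
theorem IsAdditiveFn.eq_sum {d : D → ℝ} (hd : IsAdditiveFn d) (Z : D) :
    d Z = ∑ j : Irr D, (Module.finrank k (j.rep ⟶ Z) : ℝ) * d j.rep := by
  obtain ⟨J, _, S, hS, ⟨b⟩⟩ := IsSemisimpleCat.decomp Z
  rw [hd b]
  simp only [b.finrank_hom k, Nat.cast_sum, Finset.sum_mul]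
  rw [Finset.sum_comm]
  refine Finset.sum_congr rfl fun l _ => ?_
  have := hS l
  rw [sum_finrank_rep_hom_simple k (fun j => d j.rep)]
  exact hd.congr (Irr.nonempty_iso_rep (S l)).some

theorem IsAdditiveFn.ext (k : Type w) [Field k] [IsAlgClosed k] {D : Type u} [Category.{v} D]
    [Preadditive D] [Linear k D] [HasKernels D] [∀ X Y : D, FiniteDimensional k (X ⟶ Y)]
    [Finite (Irr D)] [IsSemisimpleCat D] {d d' : D → ℝ} (hd : IsAdditiveFn d)
    (hd' : IsAdditiveFn d')
    (h : ∀ j : Irr D, d j.rep = d' j.rep) (Z : D) : d Z = d' Z := by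
  let := Fintype.ofFinite (Irr D)
  rw [hd.eq_sum k, hd'.eq_sum k]
  simp only [h]

end Multiplicity

/-! ### Frobenius-Perron dimension and characters -/

section FP

open MonoidalCategory

/-- A dimension function: additive, multiplicative, and positive on simple objects. -/
structure IsDimFn {D : Type u} [Category.{v} D] [Preadditive D] [MonoidalCategory D]
    (d : D → ℝ) : Prop where
  additive : IsAdditiveFn d
  pos (S : D) [Simple S] : 0 < d S
  mul (X Y : D) : d (X ⊗ Y) = d X * d Y

variable {k : Type w} [Field k] [IsAlgClosed k]

/-- The vector of values of `d` on simple objects is a positive left eigenvector of the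
multiplication matrix with eigenvalue `d X`. This makes `d X` an eigenvalue, and weighting absolute
values by that vector bounds every real eigenvalue by `d X`. In particular dimension functions are
unique. -/
theorem IsDimFn.FPdim_eq {D : Type u} [Category.{v} D] [Preadditive D] [Linear k D] [HasKernels D]
    [∀ X Y : D, FiniteDimensional k (X ⟶ Y)] [Finite (Irr D)] [IsSemisimpleCat D] [Nonempty (Irr D)]
    [MonoidalCategory D] {d : D → ℝ} (hd : IsDimFn d) (X : D) : FPdim k X = d X := by
  classical
  let := Fintype.ofFinite (Irr D)
  let N : Matrix (Irr D) (Irr D) ℝ := fun i j => (Module.finrank k (i.rep ⟶ X ⊗ j.rep) : ℝ)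
  let δ : Irr D → ℝ := fun i => d i.rep
  have hδ : ∀ i, 0 < δ i := fun i => hd.pos i.rep
  have hN : ∀ j, ∑ i, δ i * N i j = d X * δ j := fun j => by
    have h := hd.additive.eq_sum k (X ⊗ j.rep)
    rw [hd.mul] at h
    rw [h]
    exact Finset.sum_congr rfl fun i _ => mul_comm _ _
  have hset : {a : ℝ | ∃ z : Irr D → ℝ, z ≠ 0 ∧ ∀ i : Irr D,
      ∑ᶠ j : Irr D, (Module.finrank k (i.rep ⟶ X ⊗ j.rep) : ℝ) * z j = a * z i} =
      {a : ℝ | ∃ z : Irr D → ℝ, z ≠ 0 ∧ ∀ i, ∑ j, N i j * z j = a * z i} := by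
    simp only [finsum_eq_sum_of_fintype]
    rfl
  unfold FPdim
  rw [hset]
  refine IsGreatest.csSup_eq ⟨?_, ?_⟩
  -- A determinant passes from the left eigenvector at hand to the right eigenvector required.
  · have hdet : (N - d X • (1 : Matrix (Irr D) (Irr D) ℝ)).det = 0 := by
      refine Matrix.exists_vecMul_eq_zero_iff.1 ⟨δ, ?_, ?_⟩
      · intro h
        obtain ⟨i⟩ := ‹Nonempty (Irr D)›
        exact (hδ i).ne' (congrFun h i)
      · rw [Matrix.vecMul_sub, Matrix.vecMul_smul, Matrix.vecMul_one, sub_eq_zero]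
        funext j
        exact hN j
    obtain ⟨z, hz, hz0⟩ := Matrix.exists_mulVec_eq_zero_iff.2 hdet
    refine ⟨z, hz, fun i => ?_⟩
    rw [Matrix.sub_mulVec, Matrix.smul_mulVec, Matrix.one_mulVec, sub_eq_zero] at hz0
    exact congrFun hz0 i
  · rintro a ⟨z, hz, hza⟩
    obtain ⟨i₀, hi₀⟩ := Function.ne_iff.1 hz
    have hpos : 0 < ∑ i, δ i * |z i| :=
      Finset.sum_pos' (fun i _ => mul_nonneg (hδ i).le (abs_nonneg _))
        ⟨i₀, Finset.mem_univ _, mul_pos (hδ i₀) (abs_pos.2 hi₀)⟩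
    refine le_of_mul_le_mul_right ?_ hpos
    calc a * ∑ i, δ i * |z i| ≤ |a| * ∑ i, δ i * |z i| :=
          mul_le_mul_of_nonneg_right (le_abs_self a) hpos.le
      _ = ∑ i, δ i * |∑ j, N i j * z j| := by
          rw [Finset.mul_sum]
          refine Finset.sum_congr rfl fun i _ => ?_
          rw [hza, abs_mul]
          ring
      _ ≤ ∑ i, δ i * ∑ j, N i j * |z j| := by
          refine Finset.sum_le_sum fun i _ => mul_le_mul_of_nonneg_left ?_ (hδ i).le
          refine (Finset.abs_sum_le_sum_abs _ _).trans_eq (Finset.sum_congr rfl fun j _ => ?_)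
          rw [abs_mul, abs_of_nonneg (Nat.cast_nonneg _)]
      _ = ∑ j, (∑ i, δ i * N i j) * |z j| := by
          simp only [Finset.mul_sum, Finset.sum_mul]
          rw [Finset.sum_comm]
          exact Finset.sum_congr rfl fun j _ => Finset.sum_congr rfl fun i _ => by ring
      _ = d X * ∑ i, δ i * |z i| := by
          rw [Finset.mul_sum]
          exact Finset.sum_congr rfl fun j _ => by rw [hN, mul_assoc]

/-! ### Existence of a dimension function on a fusion category -/

section Rigid

variable {C : Type u} [Category.{v} C] [Abelian C] [MonoidalCategory C] [MonoidalPreadditive C]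
  [RigidCategory C] [Simple (𝟙_ C)]

/-- Tensoring with a dual object is faithful on objects. -/
theorem id_rightDual_tensor_ne_zero [IsSemisimpleCat C] {Y X : C} (hY : 𝟙 Y ≠ 0) (hX : 𝟙 X ≠ 0) :
    𝟙 (Yᘁ ⊗ X) ≠ 0 := by
  intro h
  -- If the coevaluation vanished, the zigzag identity would make the identity of `Y` zero.
  have hη : η_ Y Yᘁ ≠ 0 := by
    intro h0
    have h1 := ExactPairing.evaluation_coevaluation Y Yᘁ
    rw [h0] at h1
    simp only [MonoidalPreadditive.zero_whiskerRight, zero_comp] at h1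
    refine hY ?_
    rw [← cancel_epi (λ_ Y).hom, ← cancel_mono (ρ_ Y).inv]
    simpa using h1.symm
  -- As the unit is simple, the coevaluation is a split monomorphism. Tensored with `X` it makes `X`
  -- a retract of `Y ⊗ (Yᘁ ⊗ X)`, which would be zero.
  have := mono_of_nonzero_from_simple hη
  obtain ⟨s, hs⟩ := exists_retraction (η_ Y Yᘁ)
  have h2 : η_ Y Yᘁ ▷ X = 0 := by
    rw [← cancel_mono (α_ Y Yᘁ X).hom, zero_comp]
    have h3 : 𝟙 (Y ⊗ (Yᘁ ⊗ X)) = 0 := by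
      rw [← MonoidalCategory.whiskerLeft_id, h, MonoidalPreadditive.whiskerLeft_zero]
    rw [← Category.comp_id (η_ Y Yᘁ ▷ X ≫ _), h3, comp_zero]
  have h4 : 𝟙 (𝟙_ C ⊗ X) = 0 := by
    rw [← MonoidalCategory.id_whiskerRight, ← hs, MonoidalCategory.comp_whiskerRight, h2, zero_comp]
  refine hX ?_
  rw [← cancel_epi (λ_ X).hom, Category.comp_id, ← Category.id_comp (λ_ X).hom, h4, zero_comp,
    zero_comp]

/-- By duality `Hom(X, Y ⊗ S)` is `Hom(Yᘁ ⊗ X, S)`, and the nonzero object `Yᘁ ⊗ X` has a simple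
quotient `S`. This is the positivity needed for Perron's theorem. -/
theorem exists_hom_tensor_ne_zero [IsSemisimpleCat C] (X Y : C) [Simple X] [Simple Y] :
    ∃ i : Irr C, ∃ f : X ⟶ Y ⊗ i.rep, f ≠ 0 := by
  obtain ⟨J, _, S, hS, ⟨b⟩⟩ := IsSemisimpleCat.decomp (Yᘁ ⊗ X)
  have hne : ∃ j, b.proj j ≠ 0 := by
    by_contra! hc
    exact id_rightDual_tensor_ne_zero (id_nonzero Y) (id_nonzero X)
      (b.eq_zero_of_proj _ fun j => by rw [Category.id_comp, hc])
  obtain ⟨j, hj⟩ := hne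
  have := hS j
  obtain ⟨e⟩ := Irr.nonempty_iso_rep (S j)
  let E := tensorLeftHomEquiv X Y Yᘁ (Irr.mk (S j)).rep
  have hE : E.symm 0 = 0 := by
    simp [E, tensorLeftHomEquiv]
  refine ⟨Irr.mk (S j), E (b.proj j ≫ e.hom), fun h => hj ?_⟩
  have h1 : b.proj j ≫ e.hom = 0 := by
    rw [← E.symm_apply_apply (b.proj j ≫ e.hom), h, hE]
  rw [← cancel_mono e.hom, h1, zero_comp]

/-- A fusion category has a dimension function. -/
theorem exists_isDimFn (k : Type w) [Field k] [IsAlgClosed k] (C : Type u) [Category.{v} C]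
    [Abelian C] [Linear k C] [IsFiniteSemisimple k C] [MonoidalCategory C] [MonoidalPreadditive C]
    [RigidCategory C] [Simple (𝟙_ C)] : ∃ d : C → ℝ, IsDimFn d := by
  have := IsFiniteSemisimple.isSemisimpleCat k C
  have : Finite (Irr C) := IsFiniteSemisimple.finite_irr k
  have : Nonempty (Irr C) := ⟨Irr.mk (𝟙_ C)⟩
  let := Fintype.ofFinite (Irr C)
  -- Multiplicities for right multiplication by the sum of all simple objects; summing over all of
  -- them makes every entry positive.
  let P : Matrix (Irr C) (Irr C) ℝ := fun j l =>
    ∑ i : Irr C, (Module.finrank k (l.rep ⟶ j.rep ⊗ i.rep) : ℝ)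
  have hP : ∀ j l, 0 < P j l := fun j l => by
    obtain ⟨i, f, hf⟩ := exists_hom_tensor_ne_zero l.rep j.rep
    have : Nontrivial (l.rep ⟶ j.rep ⊗ i.rep) := ⟨f, 0, hf⟩
    exact Finset.sum_pos' (fun _ _ => Nat.cast_nonneg _)
      ⟨i, Finset.mem_univ i, Nat.cast_pos.2 Module.finrank_pos⟩
  obtain ⟨y, t, hy, hPy⟩ := exists_perron_vector P hP
  let d : C → ℝ := fun X => ∑ l : Irr C, (Module.finrank k (l.rep ⟶ X) : ℝ) * y l
  have hd : IsAdditiveFn d :=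
    IsAdditiveFn.fintype_sum fun l => (IsAdditiveFn.finrank_hom k l.rep).mul_const (y l)
  have hdS : ∀ (S : C) [Simple S], d S = y (Irr.mk S) := fun S _ =>
    sum_finrank_rep_hom_simple k y S
  have hdrep : ∀ j : Irr C, d j.rep = y j := fun j => by rw [hdS, Irr.mk_rep]
  have hPf : ∀ {f : C → ℝ}, IsAdditiveFn f → ∀ j,
      (P.mulVec fun l => f l.rep) j = ∑ i : Irr C, f (j.rep ⊗ i.rep) := fun {f} hf j => by
    simp only [hf.eq_sum k (_ ⊗ _)]
    rw [Finset.sum_comm]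
    exact Finset.sum_congr rfl fun l _ => Finset.sum_mul _ _ _
  have hdt : ∀ Z : C, ∑ i : Irr C, d (Z ⊗ i.rep) = d Z * t := by
    refine IsAdditiveFn.ext k
      (IsAdditiveFn.fintype_sum fun i : Irr C => hd.comp (tensorRight i.rep))
      (hd.mul_const t) fun j => ?_
    refine (hPf hd j).symm.trans ?_
    simp only [hdrep, hPy, Pi.smul_apply, smul_eq_mul, mul_comm]
  -- Left multiplication by `X` commutes with right multiplication by the associator, so `Z ↦ d (X ⊗
  -- Z)` lies in the same eigenspace as `d`. That space is a line, whence the scalar `a`.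
  have hmul : ∀ X : C, ∃ a : ℝ, ∀ Z : C, d (X ⊗ Z) = d Z * a := by
    intro X
    have hX : IsAdditiveFn fun Z => d (X ⊗ Z) := hd.comp (tensorLeft X)
    obtain ⟨a, ha⟩ := eq_smul_of_perron_vector hP (z := fun l => d (X ⊗ l.rep)) hy hPy (by
      funext j
      rw [hPf hX]
      simp only [← hd.congr (α_ X j.rep _), hdt, Pi.smul_apply, smul_eq_mul, mul_comm])
    refine ⟨a, IsAdditiveFn.ext k hX (hd.mul_const a) fun j => ?_⟩
    rw [congrFun ha j, hdrep, Pi.smul_apply, smul_eq_mul, mul_comm]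
  have h1 : 0 < d (𝟙_ C) := by
    rw [hdS]
    exact hy _
  -- Taking `Z` to be the unit shows that `a` is `d X / d 𝟙`, so this normalization is
  -- multiplicative.
  refine ⟨fun X => d X * (d (𝟙_ C))⁻¹, hd.mul_const _, fun S _ => ?_, fun X Z => ?_⟩
  · rw [hdS]
    exact mul_pos (hy _) (inv_pos.2 h1)
  · obtain ⟨a, ha⟩ := hmul X
    have h2 : d X = d (𝟙_ C) * a := by rw [← ha, hd.congr (ρ_ X)]
    rw [ha, h2]
    field_simp

end Rigid

end FP

/-! ### Finiteness of the set of simple equivariant objects -/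

section Free

variable {k : Type w} [Field k] {G : Type x} [Group G] {C : Type u} [Category.{v} C]
  [Preadditive C] [Linear k C] (ρ : GAction k G C)

/-- The isomorphism `ρ^h T ⟶ T` for `h = 1`. -/
def unitAct (T : C) (h : G) (hh : h = 1) : (ρ.fn h).obj T ⟶ T :=
  (ρ.fn h).map (ρ.unit.hom.app T) ≫ (ρ.comp h 1 1 (by rw [hh, mul_one])).hom.app T ≫
    ρ.unit.inv.app T

/-- `unitAct` carries a proof of `h = 1` because elements of the trivial subgroup equal `1` only
propositionally; at `1` itself it is the inverse of the unit isomorphism. -/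
theorem unitAct_one (T : C) : unitAct ρ T 1 rfl = ρ.unit.inv.app T := by
  have h1 := ρ.unit_right 1 T
  unfold unitAct
  rw [← Category.assoc, h1]
  exact Category.id_comp _

theorem unitAct_naturality {T X : C} (f : T ⟶ X) (h : G) (hh : h = 1) :
    unitAct ρ T h hh ≫ f = (ρ.fn h).map f ≫ unitAct ρ X h hh := by
  subst hh
  rw [unitAct_one, unitAct_one]
  exact (ρ.unit.inv.naturality f).symm

theorem EqObj.act_eq_unitAct {ρ : GAction k G C} (X : EqObj ρ) (h : G) (hh : h = 1) :
    X.act h = unitAct ρ X.obj h hh := by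
  subst hh
  rw [unitAct_one, ← cancel_epi (ρ.unit.hom.app X.obj), X.act_one]
  exact (Iso.hom_inv_id_app ρ.unit X.obj).symm

theorem unitAct_mul (T : C) (g h l : G) (e : g * h = l) (hg : g = 1) (hh : h = 1) (hl : l = 1) :
    (ρ.fn g).map (unitAct ρ T h hh) ≫ unitAct ρ T g hg =
      (ρ.comp g h l e).hom.app T ≫ unitAct ρ T l hl := by
  subst hg hh hl
  rw [unitAct_one]
  have h1 := ρ.unit_left 1 T
  have h2 : (ρ.fn 1).map (ρ.unit.inv.app T) ≫ ρ.unit.inv.app T =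
      ρ.unit.inv.app ((ρ.fn 1).obj T) ≫ ρ.unit.inv.app T :=
    ρ.unit.inv.naturality (ρ.unit.inv.app T)
  rw [h2]
  have h3 : ρ.unit.inv.app ((ρ.fn 1).obj T) = (ρ.comp 1 1 1 e).hom.app T := by
    rw [← cancel_epi (ρ.unit.hom.app ((ρ.fn 1).obj T)), h1]
    exact Iso.hom_inv_id_app ρ.unit _
  rw [h3]

/-- The equivariant structure of an object for the trivial subgroup. -/
def trivialEqObj (T : C) : EqObj (ρ.restrict (⊥ : Subgroup G)) :=
  have mul : ∀ g h : (⊥ : Subgroup G),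
      ((ρ.restrict (⊥ : Subgroup G)).fn g).map (unitAct ρ T h (Subgroup.mem_bot.1 h.2)) ≫
          unitAct ρ T g (Subgroup.mem_bot.1 g.2) =
        ((ρ.restrict (⊥ : Subgroup G)).comp g h _ rfl).hom.app T ≫
          unitAct ρ T (g * h : (⊥ : Subgroup G)) (Subgroup.mem_bot.1 (g * h).2) :=
    fun g h => unitAct_mul ρ T g h _ rfl _ _ _
  have one : (ρ.restrict (⊥ : Subgroup G)).unit.hom.app T ≫
      unitAct ρ T ((1 : (⊥ : Subgroup G)) : G) (Subgroup.mem_bot.1 (1 : (⊥ : Subgroup G)).2) =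
        𝟙 T := by
    refine (congrArg _ (unitAct_one ρ T)).trans ?_
    exact Iso.hom_inv_id_app ρ.unit T
  { obj := T
    act := fun h => unitAct ρ T h (Subgroup.mem_bot.1 h.2)
    isIso_act := EqObj.isIso_of_laws (ρ.restrict (⊥ : Subgroup G)) T _ mul one
    act_mul := mul
    act_one := one }

theorem nonempty_transversal (H : Subgroup G) : Nonempty (Transversal H) :=
  ⟨⟨Quotient.out, Quotient.out_eq'⟩⟩

end Free

/-- Let `T` be a simple constituent of a simple equivariant `X`. Reciprocity for the trivial
subgroup gives a nonzero morphism from `L T` to `X`, so `X` is one of the finitely many simple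
summands of `L T`, and there are finitely many `T`. -/
theorem EqObj.finite_irr {k : Type w} [Field k] [CharZero k] {C : Type u} [Category.{v} C]
    [Abelian C] [Linear k C] [∀ X Y : C, FiniteDimensional k (X ⟶ Y)] [IsSemisimpleCat C]
    [Finite (Irr C)] {G : Type x} [Group G] [Finite G] (ρ : GAction k G C) :
    Finite (Irr (EqObj ρ)) := by
  obtain ⟨r⟩ := nonempty_transversal (⊥ : Subgroup G)
  let L : C → EqObj ρ := fun T => (relInd ρ r).obj (trivialEqObj ρ T)
  choose J hJ S hS b using fun i : Irr C => IsSemisimpleCat.decomp (L i.rep)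
  let Φ : (Σ i : Irr C, J i) → Irr (EqObj ρ) := fun p =>
    haveI := hS p.1 p.2
    Irr.mk (S p.1 p.2)
  refine Finite.of_surjective Φ fun y => ?_
  obtain ⟨T, _, f, hf⟩ := exists_simple_hom_ne_zero (X := y.rep.obj) (EqObj.id_obj_ne_zero ρ)
  obtain ⟨e⟩ := Irr.nonempty_iso_rep T
  have hf' : e.inv ≫ f ≠ 0 := fun h => hf ((cancel_epi e.inv).1 (h.trans comp_zero.symm))
  have hequiv : ∀ h : (⊥ : Subgroup G), ((trivialEqObj ρ (Irr.mk T).rep).act h :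
      (ρ.fn h).obj (Irr.mk T).rep ⟶ (Irr.mk T).rep) ≫ e.inv ≫ f =
        (ρ.fn h).map (e.inv ≫ f) ≫ y.rep.act h := fun h => by
    rw [y.rep.act_eq_unitAct h (Subgroup.mem_bot.1 h.2)]
    exact unitAct_naturality ρ (e.inv ≫ f) h _
  let F : L (Irr.mk T).rep ⟶ y.rep :=
    indDesc ρ r (N := trivialEqObj ρ (Irr.mk T).rep) (e.inv ≫ f) hequiv
  have hF : F ≠ 0 := fun h => hf' <|
    (unitMap_indDesc ρ r (N := trivialEqObj ρ (Irr.mk T).rep) (e.inv ≫ f) hequiv).symm.trans <|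
      (congrArg (fun t : L (Irr.mk T).rep ⟶ y.rep => unitMap ρ r _ ≫ t.1) h).trans comp_zero
  obtain ⟨b⟩ := b (Irr.mk T)
  have hj : ∃ j, b.inj j ≫ F ≠ 0 := by
    by_contra! hc
    exact hF (b.eq_zero_of_inj F hc)
  obtain ⟨j, hj⟩ := hj
  have := hS (Irr.mk T) j
  have := isIso_of_hom_simple hj
  refine ⟨⟨Irr.mk T, j⟩, ?_⟩
  refine Eq.trans ?_ y.mk_rep
  exact (Irr.ext_iff_iso _ _).2 ⟨asIso (b.inj j ≫ F)⟩

/-! ### Frobenius-Perron dimensions of equivariant objects -/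

section FP

open MonoidalCategory

variable {k : Type w} [Field k] {C : Type u} [Category.{v} C] [Abelian C] [Linear k C]
  [MonoidalCategory C] {G : Type x} [Group G] {ρ : GAction k G C} {d : C → ℝ}

theorem IsDimFn.pos_of_id_ne_zero [IsSemisimpleCat C] (hd : IsDimFn d) {Z : C} (hZ : 𝟙 Z ≠ 0) :
    0 < d Z := by
  obtain ⟨J, _, S, hS, ⟨b⟩⟩ := IsSemisimpleCat.decomp Z
  have hJ : Nonempty J := by
    by_contra hJ
    have := not_nonempty_iff.1 hJ
    exact hZ (by rw [← b.total, Finset.univ_eq_empty, Finset.sum_empty])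
  rw [hd.additive b]
  exact Finset.sum_pos (fun j _ => by
    have := hS j
    exact hd.pos (S j)) Finset.univ_nonempty

theorem IsDimFn.fn [TensorAction ρ] (hd : IsDimFn d) (g : G) :
    IsDimFn fun Z => d ((ρ.fn g).obj Z) where
  additive := hd.additive.comp (ρ.fn g)
  pos S _ := by
    have := ρ.simple_fn_obj g S
    exact hd.pos _
  mul X Y := by
    rw [← hd.mul]
    exact hd.additive.congr (Functor.Monoidal.μIso (ρ.fn g) X Y).symm

/-- The forgetful functor is strictly monoidal and sends nonzero objects to nonzero objects, so
dimension functions pull back to `C^G`. -/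
theorem IsDimFn.forget [IsSemisimpleCat C] [TensorAction ρ] (hd : IsDimFn d) :
    IsDimFn fun Z : EqObj ρ => d Z.obj where
  additive := hd.additive.comp (EqObj.forget ρ)
  pos _ _ := hd.pos_of_id_ne_zero (EqObj.id_obj_ne_zero ρ)
  mul X Y := hd.mul X.obj Y.obj

end FP

open MonoidalCategory in
theorem FPdim_cliffordObj {k : Type w} [Field k] [IsAlgClosed k] [CharZero k] {C : Type u}
    [Category.{v} C] [Abelian C] [Linear k C] [IsFiniteSemisimple k C] {G : Type x} [Group G]
    [Finite G] (ρ : GAction k G C) {Y : C} [Simple Y] (r : Transversal (ρ.inertia Y))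
    (c : StableIsos (ρ.restrict (ρ.inertia Y)) Y)
    (π : ProjRep.{w, v', x} k (ρ.inertia Y) (factorSet (ρ.restrict (ρ.inertia Y)) Y c))
    (hπ : π.IsIrreducible) [MonoidalCategory C] [MonoidalPreadditive C] [RigidCategory C]
    [Simple (𝟙_ C)] [TensorAction ρ] {X : EqObj ρ} (e : X ≅ cliffordObj ρ r c π) :
    FPdim k X = π.dim * (ρ.inertia Y).index * FPdim k Y := by
  have := IsFiniteSemisimple.isSemisimpleCat k C
  have : Finite (Irr C) := IsFiniteSemisimple.finite_irr k
  have : Nonempty (Irr C) := ⟨Irr.mk (𝟙_ C)⟩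
  have := EqObj.finite_irr ρ
  have := simple_cliffordObj ρ r c π hπ
  have : Nonempty (Irr (EqObj ρ)) := ⟨Irr.mk (cliffordObj ρ r c π)⟩
  obtain ⟨d, hd⟩ := exists_isDimFn k C
  rw [hd.forget.FPdim_eq (k := k) X, hd.FPdim_eq (k := k) Y]
  refine (hd.additive.congr ((EqObj.forget ρ).mapIso e)).trans ?_
  -- Invariance of `d` under `G`: both `d` and its composite with `ρ^g` are dimension functions, so
  -- both equal `FPdim`.
  exact hd.additive.cliffordObj ρ r c π fun g A => by
    rw [← (hd.fn (ρ := ρ) g).FPdim_eq (k := k) A, hd.FPdim_eq (k := k) A]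

end

end EquivClifford

theorem theorem2p12 {k : Type w} [Field k] [IsAlgClosed k] [CharZero k] {C : Type u}
    [Category.{v} C] [Abelian C] [Linear k C] [IsFiniteSemisimple k C] {G : Type x} [Group G]
    [Finite G] (ρ : GAction k G C) :
    -- relative induction `L_Y` and simple equivariant objects containing `Y`
    (∀ (Y : C) [Simple Y] (r : Transversal (ρ.inertia Y)),
      Set.BijOn (mapIsoClass (relInd ρ r))
        {x | ∃ N : EqObj (ρ.restrict (ρ.inertia Y)),
          Simple N ∧ Nontrivial (Y ⟶ N.obj) ∧ isoClass N = x}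
        {x | ∃ X : EqObj ρ, Simple X ∧ Nontrivial (Y ⟶ X.obj) ∧ isoClass X = x} ∧
      ∀ (N : EqObj (ρ.restrict (ρ.inertia Y))) (X : EqObj ρ),
        Simple N → Nontrivial (Y ⟶ N.obj) → Nonempty (X ≅ (relInd ρ r).obj N) →
          (∀ c : StableIsos (ρ.restrict (ρ.inertia Y)) Y,
            (homRep Y c N).Isomorphic
              (homRep Y c ((EqObj.restrict ρ (ρ.inertia Y)).obj X))) ∧
          Nonempty (N.obj ≅ copower k (Y ⟶ N.obj) Y)) ∧
    -- parametrization of the simple objects of `C^G` by pairs `(Y, π)`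
    (∀ (Y : ρ.Orbits → C) [∀ o, Simple (Y o)], (∀ o, ρ.orbit (Y o) = o) →
      ∀ (r : ∀ o, Transversal (ρ.inertia (Y o)))
        (c : ∀ o, StableIsos (ρ.restrict (ρ.inertia (Y o))) (Y o)),
        Set.BijOn
          (fun p : Σ o, ProjRepClass k (ρ.inertia (Y o))
              (factorSet (ρ.restrict (ρ.inertia (Y o))) (Y o) (c o)) =>
            cliffordClass ρ (r p.1) (c p.1) p.2)
          {p | ∃ π, π.IsIrreducible ∧
            _root_.Quotient.mk (ProjRep.setoid k _ _) π = p.2}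
          {x | ∃ X : EqObj ρ, Simple X ∧ isoClass X = x}) ∧
    -- the simple object corresponding to `(Y, π)` and its dimension
    (∀ (Y : C) [Simple Y] (r : Transversal (ρ.inertia Y))
      (c : StableIsos (ρ.restrict (ρ.inertia Y)) Y)
      (π : ProjRep.{w, w, x} k (ρ.inertia Y) (factorSet (ρ.restrict (ρ.inertia Y)) Y c)),
      π.IsIrreducible → ∀ X : EqObj ρ, Nonempty (X ≅ cliffordObj ρ r c π) →
        Nonempty (X.obj ≅ ⨁ fun q : G ⧸ ρ.inertia Y =>
          (ρ.fn (r.rep q)).obj (copower k π.V Y)) ∧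
        π.Isomorphic (homRep Y c ((EqObj.restrict ρ (ρ.inertia Y)).obj X)) ∧
        (∀ d : C → ℝ, (∀ A B : C, Nonempty (A ≅ B) → d A = d B) →
          (∀ A B : C, d (A ⊞ B) = d A + d B) → (∀ (g : G) (A : C), d ((ρ.fn g).obj A) = d A) →
            d X.obj = π.dim * (ρ.inertia Y).index * d Y) ∧
        (∀ [MonoidalCategory C] [MonoidalPreadditive C] [MonoidalLinear k C] [RigidCategory C]
          [Simple (𝟙_ C)] [TensorAction ρ],
            FPdim k X = π.dim * (ρ.inertia Y).index * FPdim k Y)) := by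
  refine ⟨fun Y _ r => ⟨relInd_bijOn ρ r, fun N X _ _ ⟨e⟩ => ⟨fun c => ?_, ?_⟩⟩,
    fun Y _ hY r c => cliffordClass_bijOn ρ Y hY r c, fun Y _ r c π hπ X ⟨e⟩ => ⟨?_, ?_, ?_, ?_⟩⟩
  · exact isomorphic_homRep_of_iso_relInd ρ r c N e
  · obtain ⟨c⟩ := nonempty_stableIsos ρ Y
    obtain ⟨i⟩ := nonempty_iso_repObj c N
    exact ⟨(EqObj.forget _).mapIso i⟩
  · exact ⟨(EqObj.forget ρ).mapIso e⟩
  · exact (isomorphic_homRep_cliffordObj ρ r c π).trans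
      (homRep_isomorphic c ((EqObj.restrict ρ (ρ.inertia Y)).mapIso e.symm))
  · intro d hiso hadd hG
    refine (hiso _ _ ⟨(EqObj.forget ρ).mapIso e⟩).trans ?_
    exact (isAdditiveFn_of_biprod d hiso hadd).cliffordObj ρ r c π hG
  · intro _ _ _ _ _ _
    exact FPdim_cliffordObj ρ r c π hπ e
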